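/- Let $\mathcal E$ be a smooth (Hausdorff, second countable) manifold, $M\subseteq\mathcal E$ an embedded submanifold of positive codimension, and $E=T\mathcal E|_M/TM\to M$ its normal bundle, with fiber-wise scalar multiplication $h_t:E\to E$. Definitions. A (scalar) differential operator (DO) of order $q$ on a manifold $N$ is an $\mathbb R$-linear map $\Delta:C^\infty(N)\to C^\infty(N)$ with $[\cdots[[\Delta,f_0],f_1],\cdots,f_q]=0$ for all $f_i\in C^\infty(N)$; its symbol is the symmetric $q$-multivector field $\sigma(\Delta)(f_1,\dots,f_q)=[\cdots[\Delta,f_1],\cdots,f_q]$. A function $F\in C^\infty(\mathcal E)$ is linearizable if $F|_M=0$; its linearization is the function $F_{\mathrm{lin}}\in C^\infty(E)$, $F_{\mathrm{lin}}([w])=dF(w)$. A symmetric $q$-multivector field $P$ on $\mathcal E$ is linearizable if, for $q\ge1$, it lies in the ideal (in the algebra of symmetric multivector fields) generated by the vector fields tangent to $M$, and, for $q=0$, it is a function vanishing on $M$. A DO $\Delta$ of order $q$ on $\mathcal E$ is order $q$ linearizable if $\sigma(\Delta)$ is linearizable. On $E$, a symmetric $q$-multivector field $P$ is fiber-wise linear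 (FWL) if $h_t^*P=t^{1-q}P$ for all $t\ne0$, and a DO $\Delta$ of order $q$ is an order $q$ FWL DO if $h_t^*\Delta=t^{1-q}\Delta$ for all $t\neq 0$. The linearization of an order $q$ linearizable DO $\Delta$ is the order $q$ FWL DO $\Delta_{\mathrm{lin}}$ on $E$ such that (i) $\sigma(\Delta_{\mathrm{lin}})$ is the linearization of $\sigma(\Delta)$, i.e. the FWL symmetric $q$-multivector field with $\sigma(\Delta_{\mathrm{lin}})((F_1)_{\mathrm{lin}},\dots,(F_q)_{\mathrm{lin}})=\big(\sigma(\Delta)(F_1,\dots,F_q)\big)_{\mathrm{lin}}$ for all linearizable $F_1,\dots,F_q$ (the function $\sigma(\Delta)(F_1,\dots,F_q)$ being linearizable); (ii) if $q\ge1$, then $[\cdots[\Delta_{\mathrm{lin}},(F_1)_{\mathrm{lin}}],\cdots,(F_{q-1})_{\mathrm{lin}}](1)$ is the pull-back to $E$ of the function $[\cdots[\Delta,F_1],\cdots,F_{q-1}](1)|_M$ on $M$, for all linearizable $F_1,\dots,F_{q-1}$. Theorem. (a) The linearization is well defined: for every $q\ge0$ and every order $q$ linearizable DO $\Delta$ on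 $\mathcal E$ there is exactly one order $q$ FWL DO $\Delta_{\mathrm{lin}}$ on $E$ satisfying (i) and (ii). (b) Let $q,q'\ge0$, and let $\Delta$ and $\Delta'$ be an order $q+1$ linearizable and an order $q'+1$ linearizable DO on $\mathcal E$. Then $[\Delta,\Delta']$ is order $q+q'+1$ linearizable, and its linearization is $[\Delta_{\mathrm{lin}},\Delta'_{\mathrm{lin}}]$. -/

import Mathlib

open Set
open scoped Manifold ContDiff

noncomputable section

/-! ### Scalar differential operators on a commutative algebra -/

section Algebraic

variable {A : Type*} [CommRing A] [Algebra ℝ A]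

/-- The nested commutator `[⋯[[Δ, f₁], f₂], ⋯, fₙ]`, where a function acts by multiplication. -/
def nestedComm (Δ : Module.End ℝ A) {n : ℕ} (f : Fin n → A) : Module.End ℝ A :=
  (List.ofFn f).foldl (fun D g => ⁅D, LinearMap.mulLeft ℝ g⁆) Δ

/-- `Δ` is a scalar differential operator of order `q` (that is, of order at most `q`):
all the nested commutators with `q + 1` functions vanish. -/
def IsDO (q : ℕ) (Δ : Module.End ℝ A) : Prop :=
  ∀ f : Fin (q + 1) → A, nestedComm Δ f = 0

/-- The symbol `σ(Δ)(f₁, …, f_q) = [⋯[Δ, f₁], ⋯, f_q]` of an operator of order `q`. For such an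
operator the nested commutator has order `0`, hence it is the multiplication by its value at `1`. -/
def symbol (q : ℕ) (Δ : Module.End ℝ A) (f : Fin q → A) : A :=
  nestedComm Δ f 1

/-- Symmetric `q`-multivector fields, seen as symmetric maps of `q` functions which are
derivations in each argument. For `q = 0` these are just functions. -/
structure IsSymMultivector {q : ℕ} (P : (Fin q → A) → A) : Prop where
  symm : ∀ (τ : Equiv.Perm (Fin q)) (f : Fin q → A), P (f ∘ τ) = P f
  map_add : ∀ (f : Fin q → A) (i : Fin q) (a b : A),
    P (Function.update f i (a + b)) = P (Function.update f i a) + P (Function.update f i b)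
  map_smul : ∀ (f : Fin q → A) (i : Fin q) (c : ℝ) (a : A),
    P (Function.update f i (c • a)) = c • P (Function.update f i a)
  leibniz : ∀ (f : Fin q → A) (i : Fin q) (a b : A),
    P (Function.update f i (a * b)) =
      a * P (Function.update f i b) + b * P (Function.update f i a)

/-- The symmetric product `X ⊙ Q` of a vector field `X` and a `q`-multivector `Q`:
`(X ⊙ Q)(f₀, …, f_q) = ∑ⱼ X(fⱼ) Q(f₀, …, fⱼ₋₁, fⱼ₊₁, …, f_q)`. -/
def vectorProd {q : ℕ} (X : Derivation ℝ A A) (Q : (Fin q → A) → A) (f : Fin (q + 1) → A) : A :=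
  ∑ j : Fin (q + 1), X (f j) * Q (fun i => f (j.succAbove i))

end Algebraic

section Geometric

variable (V : Type*) [NormedAddCommGroup V] [NormedSpace ℝ V]
variable {𝓔 : Type*} [TopologicalSpace 𝓔] [ChartedSpace V 𝓔]

/-! ### Submanifolds and the ideal of tangent multivectors -/

/-- The algebra `C^∞(𝓔)`. -/
abbrev SmoothFun (𝓔 : Type*) [TopologicalSpace 𝓔] [ChartedSpace V 𝓔] : Type _ :=
  C^∞⟮𝓘(ℝ, V), 𝓔; 𝓘(ℝ, ℝ), ℝ⟯

/-- A chart `φ` of `𝓔` adapted to `M`: in its domain `M` is the preimage under `φ` of the linear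
subspace `S` of the model space. -/
def IsAdaptedChart (M : Set 𝓔) (S : Submodule ℝ V) (φ : OpenPartialHomeomorph 𝓔 V) : Prop :=
  φ ∈ IsManifold.maximalAtlas 𝓘(ℝ, V) ∞ 𝓔 ∧ ∀ p ∈ φ.source, p ∈ M ↔ φ p ∈ S

/-- `M` is an (embedded) submanifold of `𝓔` of dimension `m`. -/
def IsSubmanifold (m : ℕ) (M : Set 𝓔) : Prop :=
  ∀ p ∈ M, ∃ (S : Submodule ℝ V) (φ : OpenPartialHomeomorph 𝓔 V),
    Module.finrank ℝ S = m ∧ IsAdaptedChart V M S φ ∧ p ∈ φ.source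

/-- The ideal of the linearizable functions `F ∈ C^∞(𝓔)`, those with `F|_M = 0`. -/
def vanishingIdeal (M : Set 𝓔) : Ideal (SmoothFun V 𝓔) where
  carrier := {F | ∀ p ∈ M, F p = 0}
  add_mem' := by
    intro F G hF hG p hp
    simp [hF p hp, hG p hp]
  zero_mem' := by
    intro p _
    simp
  smul_mem' := by
    intro F G hG p hp
    simp [hG p hp]

/-- A vector field (a derivation of `C^∞(𝓔)`) is tangent to `M`. -/
def IsTangent (M : Set 𝓔) (X : Derivation ℝ (SmoothFun V 𝓔) (SmoothFun V 𝓔)) : Prop :=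
  ∀ F ∈ vanishingIdeal V M, X F ∈ vanishingIdeal V M

/-- The linearizable `q`-multivectors. In positive degree they are the elements of the ideal of
symmetric multivectors generated by the vector fields tangent to `M`, i.e. finite sums
`∑ₐ Xₐ ⊙ Qₐ` with `Xₐ` tangent to `M`; in degree `0` they are the functions vanishing on `M`. -/
def IsLinearizableMultivector (M : Set 𝓔) :
    (q : ℕ) → ((Fin q → SmoothFun V 𝓔) → SmoothFun V 𝓔) → Prop
  | 0, P => P Fin.elim0 ∈ vanishingIdeal V M
  | q + 1, P => ∃ (N : ℕ) (X : Fin N → Derivation ℝ (SmoothFun V 𝓔) (SmoothFun V 𝓔))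
      (Q : Fin N → (Fin q → SmoothFun V 𝓔) → SmoothFun V 𝓔),
      (∀ a, IsTangent V M (X a)) ∧ (∀ a, IsSymMultivector (Q a)) ∧
        ∀ f, P f = ∑ a, vectorProd (X a) (Q a) f

/-- `Δ` is an order `q` linearizable differential operator (around `M`). -/
def IsLinearizable (M : Set 𝓔) (q : ℕ) (Δ : Module.End ℝ (SmoothFun V 𝓔)) : Prop :=
  IsDO q Δ ∧ IsLinearizableMultivector V M q (symbol q Δ)

/-! ### The normal bundle and its smooth functions -/

/-- The tangent space `T_pM ⊆ T_p𝓔` of a submanifold `M` at a point `p ∈ M`: the common kernel of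
the differentials at `p` of the smooth functions vanishing on `M`. -/
def tangentTo (M : Set 𝓔) (p : 𝓔) : Submodule ℝ (TangentSpace 𝓘(ℝ, V) p) where
  carrier := {w | ∀ F ∈ vanishingIdeal V M, mfderiv 𝓘(ℝ, V) 𝓘(ℝ, ℝ) F p w = 0}
  add_mem' := by
    intro v w hv hw F hF
    rw [map_add, hv F hF, hw F hF, add_zero]
  zero_mem' := by
    intro F _
    exact map_zero _
  smul_mem' := by
    intro c w hw F hF
    rw [map_smul, hw F hF, smul_zero]

/-- The total space of the normal bundle `E = T𝓔|_M / TM → M`. -/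
abbrev NormalBundle (M : Set 𝓔) : Type _ :=
  Σ p : M, TangentSpace 𝓘(ℝ, V) (p : 𝓔) ⧸ tangentTo V M (p : 𝓔)

/-- The fiber-wise scalar multiplication `h_t : E → E`. -/
def fiberScale {M : Set 𝓔} (t : ℝ) (e : NormalBundle V M) : NormalBundle V M :=
  ⟨e.1, t • e.2⟩

/-- A function on the total space of the normal bundle is smooth if it is a smooth function of the
vector bundle coordinates given by any adapted chart. The chart `φ` adapted to `S` identifies
`M ∩ dom φ` with the open subset `S ∩ φ(dom φ)` of `S`, and the fiber of `E` at `p` with `V ⧸ S`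
through `dφ_p`; a function of `(s, v mod S)` is smooth iff it is a smooth function of `(s, v)`. -/
def IsSmoothOnNormalBundle {M : Set 𝓔} (g : NormalBundle V M → ℝ) : Prop :=
  ∀ (S : Submodule ℝ V) (φ : OpenPartialHomeomorph 𝓔 V) (hφ : IsAdaptedChart V M S φ),
    ∃ G : S × V → ℝ, ContDiffOn ℝ ∞ G {y | (y.1 : V) ∈ φ.target} ∧
      ∀ (p : M) (hp : (p : 𝓔) ∈ φ.source) (w : TangentSpace 𝓘(ℝ, V) (p : 𝓔)),
        g ⟨p, Submodule.Quotient.mk w⟩ =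
          G (⟨φ p, (hφ.2 p hp).1 p.2⟩, mfderiv 𝓘(ℝ, V) 𝓘(ℝ, V) φ (p : 𝓔) w)

/-- The algebra `C^∞(E)` of smooth functions on the total space of the normal bundle. -/
def NormalFun (M : Set 𝓔) : Subalgebra ℝ (NormalBundle V M → ℝ) where
  carrier := {g | IsSmoothOnNormalBundle V g}
  mul_mem' := by
    intro g g' hg hg' S φ hφ
    obtain ⟨G, hG, h⟩ := hg S φ hφ
    obtain ⟨G', hG', h'⟩ := hg' S φ hφ
    refine ⟨fun y => G y * G' y, hG.mul hG', fun p hp w => ?_⟩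
    simp only [Pi.mul_apply, h p hp w, h' p hp w]
  add_mem' := by
    intro g g' hg hg' S φ hφ
    obtain ⟨G, hG, h⟩ := hg S φ hφ
    obtain ⟨G', hG', h'⟩ := hg' S φ hφ
    refine ⟨fun y => G y + G' y, hG.add hG', fun p hp w => ?_⟩
    simp only [Pi.add_apply, h p hp w, h' p hp w]
  algebraMap_mem' := by
    intro c S φ hφ
    exact ⟨fun _ => c, contDiffOn_const, fun p hp w => rfl⟩

/-- The pull-back `h_t^* : C^∞(E) → C^∞(E)`. -/
def pullScale {M : Set 𝓔} (t : ℝ) (g : NormalFun V M) : NormalFun V M :=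
  ⟨fun e => g.1 (fiberScale V t e), by
    intro S φ hφ
    obtain ⟨G, hG, h⟩ := g.2 S φ hφ
    refine ⟨fun y => G (y.1, t • y.2), ?_, fun p hp w => ?_⟩
    · exact hG.comp (by fun_prop) (fun y hy => hy)
    · have h1 := h p hp (t • w)
      rw [map_smul] at h1
      exact h1⟩

variable {V}

/-- The differential of a function, read in a chart. -/
theorem mfderiv_eq_fderiv_chart [IsManifold 𝓘(ℝ, V) ∞ 𝓔] (F : SmoothFun V 𝓔)
    {φ : OpenPartialHomeomorph 𝓔 V} (hφ : φ ∈ IsManifold.maximalAtlas 𝓘(ℝ, V) ∞ 𝓔)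
    {p : 𝓔} (hp : p ∈ φ.source) (w : TangentSpace 𝓘(ℝ, V) p) :
    mfderiv 𝓘(ℝ, V) 𝓘(ℝ, ℝ) F p w =
      fderiv ℝ (F ∘ φ.symm) (φ p) (mfderiv 𝓘(ℝ, V) 𝓘(ℝ, V) φ p w) := by
  have hF : MDifferentiableAt 𝓘(ℝ, V) 𝓘(ℝ, ℝ) F (φ.symm (φ p)) :=
    F.contMDiff.mdifferentiable (by simp) _
  have h1 : MDifferentiableAt 𝓘(ℝ, V) 𝓘(ℝ, V) φ p :=
    (contMDiffAt_of_mem_maximalAtlas hφ hp).mdifferentiableAt (by simp)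
  have h2 : MDifferentiableAt 𝓘(ℝ, V) 𝓘(ℝ, V) φ.symm (φ p) :=
    (contMDiffAt_symm_of_mem_maximalAtlas hφ (φ.map_source hp)).mdifferentiableAt (by simp)
  have h3 : MDifferentiableAt 𝓘(ℝ, V) 𝓘(ℝ, ℝ) (F ∘ φ.symm) (φ p) := hF.comp _ h2
  have h4 : (F : 𝓔 → ℝ) =ᶠ[nhds p] (F ∘ φ.symm) ∘ φ := by
    filter_upwards [φ.open_source.mem_nhds hp] with x hx
    simp [φ.left_inv hx]
  rw [h4.mfderiv_eq, mfderiv_comp p h3 h1, mfderiv_eq_fderiv]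
  rfl

/-- A smooth function is smooth in every chart. -/
theorem contDiffOn_chart [IsManifold 𝓘(ℝ, V) ∞ 𝓔] (F : SmoothFun V 𝓔)
    {φ : OpenPartialHomeomorph 𝓔 V} (hφ : φ ∈ IsManifold.maximalAtlas 𝓘(ℝ, V) ∞ 𝓔) :
    ContDiffOn ℝ ∞ (F ∘ φ.symm) φ.target :=
  contMDiffOn_iff_contDiffOn.1
    (F.contMDiff.comp_contMDiffOn (contMDiffOn_symm_of_mem_maximalAtlas hφ))

variable (V)

/-- The linearization `F_lin = ℓ_{dF|_M} ∈ C^∞(E)` of a function `F` with `F|_M = 0`: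
`F_lin(p, [w]) = dF_p(w)`. -/
def linFun [IsManifold 𝓘(ℝ, V) ∞ 𝓔] {M : Set 𝓔} (F : vanishingIdeal V M) : NormalFun V M :=
  ⟨fun e => (tangentTo V M (e.1 : 𝓔)).liftQ
      (mfderiv 𝓘(ℝ, V) 𝓘(ℝ, ℝ) F.1 (e.1 : 𝓔)).toLinearMap (fun _ hw => hw F.1 F.2) e.2, by
    intro S φ hφ
    refine ⟨fun y => fderiv ℝ (F.1 ∘ φ.symm) (y.1 : V) y.2, ?_, fun p hp w => ?_⟩
    · have h1 : ContDiffOn ℝ ∞ (fderiv ℝ (F.1 ∘ φ.symm)) φ.target :=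
        (contDiffOn_chart F.1 hφ.1).fderiv_of_isOpen φ.open_target (by simp)
      have h2 : ContDiffOn ℝ ∞ (fun y : S × V => fderiv ℝ (F.1 ∘ φ.symm) (y.1 : V))
          {y | (y.1 : V) ∈ φ.target} :=
        h1.comp (S.subtypeL.contDiff.comp contDiff_fst).contDiffOn (fun y hy => hy)
      exact h2.clm_apply contDiff_snd.contDiffOn
    · exact mfderiv_eq_fderiv_chart F.1 hφ.1 hp w⟩

/-! ### Fiber-wise linear objects and linearization -/

/-- A symmetric `q`-multivector `P` on `E` is fiber-wise linear: `h_t^* P = t^{1-q} P` for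
`t ≠ 0`, where `(h_t^* P)(f₁, …) = h_t^* (P (h_{1/t}^* f₁, …))`. -/
def IsFWLMultivector {M : Set 𝓔} {q : ℕ} (P : (Fin q → NormalFun V M) → NormalFun V M) : Prop :=
  IsSymMultivector P ∧ ∀ t : ℝ, t ≠ 0 → ∀ f : Fin q → NormalFun V M,
    pullScale V t (P fun i => pullScale V t⁻¹ (f i)) = t ^ (1 - (q : ℤ)) • P f

/-- Fiber-wise linear differential operators of order `q` on `E`: operators `Δ` of order `q` with
`h_t^* Δ = t^{1-q} Δ` for `t ≠ 0`, where `h_t^* Δ = h_t^* ∘ Δ ∘ h_{1/t}^*`. -/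
def IsFWLDO {M : Set 𝓔} (q : ℕ) (Δ : Module.End ℝ (NormalFun V M)) : Prop :=
  IsDO q Δ ∧ ∀ t : ℝ, t ≠ 0 → ∀ g : NormalFun V M,
    pullScale V t (Δ (pullScale V t⁻¹ g)) = t ^ (1 - (q : ℤ)) • Δ g

/-- `P'` is the linearization of the `q`-multivector `P`: it is the fiber-wise linear multivector
with `P'((F₁)_lin, …, (F_q)_lin) = P(F₁, …, F_q)_lin` for all linearizable functions `Fᵢ` (the
function `P(F₁, …, F_q)` being linearizable). -/
def IsLinearizationMultivector [IsManifold 𝓘(ℝ, V) ∞ 𝓔] {M : Set 𝓔} {q : ℕ}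
    (P : (Fin q → SmoothFun V 𝓔) → SmoothFun V 𝓔)
    (P' : (Fin q → NormalFun V M) → NormalFun V M) : Prop :=
  IsFWLMultivector V P' ∧ ∀ F : Fin q → vanishingIdeal V M,
    ∃ h : P (fun i => (F i).1) ∈ vanishingIdeal V M,
      P' (fun i => linFun V (F i)) = linFun V ⟨P (fun i => (F i).1), h⟩

/-- `Δ'` is the linearization of the order `q` linearizable operator `Δ`: it is the fiber-wise
linear operator of order `q` on `E` whose symbol is the linearization of the symbol of `Δ`, and
such that, for linearizable functions `F₁, …, F_{q-1}` (when `q ≥ 1`), the function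
`[⋯[Δ', (F₁)_lin], ⋯, (F_{q-1})_lin](1)` on `E` is the pull-back of the function
`[⋯[Δ, F₁], ⋯, F_{q-1}](1)|_M` on `M`. A fiber-wise linear operator corresponds to the pair formed
by its symbol and by the map `(φ₁, …, φ_{q-1}) ↦ [⋯[Δ', ℓ_{φ₁}], ⋯, ℓ_{φ_{q-1}}](1)`. -/
structure IsLinearization [IsManifold 𝓘(ℝ, V) ∞ 𝓔] (M : Set 𝓔) (q : ℕ)
    (Δ : Module.End ℝ (SmoothFun V 𝓔)) (Δ' : Module.End ℝ (NormalFun V M)) : Prop where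
  isFWLDO : IsFWLDO V q Δ'
  symbol_lin : IsLinearizationMultivector V (symbol q Δ) (symbol q Δ')
  nested_lin : ∀ n : ℕ, q = n + 1 → ∀ (F : Fin n → vanishingIdeal V M) (e : NormalBundle V M),
    (nestedComm Δ' (fun i => linFun V (F i)) 1).1 e =
      (nestedComm Δ (fun i => (F i).1) 1) (e.1 : 𝓔)

end Geometric

end

/-! Filter `C^∞(𝓔)` by the order of vanishing along `M`. A function vanishing to order `k` has a
leading term on `E`, homogeneous of degree `k` along the fibers: the pull-back of `f|_M` for `k =
0`, `F_lin` for `k = 1`, and products of these (`HasLead`). An operator of order `q` lowers the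
order of vanishing by at most `q`; a linearizable one lowers it by at most `q - 1`, because its
symbol sends functions vanishing on `M` to a function vanishing on `M`. The operator induced on
leading terms (`IsLead`) is the linearization: commuting with `q` or `q - 1` functions vanishing on
`M` and evaluating at `1` gives (i) and (ii) (`IsLead.isLinearization`). Part (b) is then formal:
leading parts respect commutators, and the drops add up to `q + q' = (q + q' + 1) - 1`.

Existence (`IsLinearizable.exists_lead`): locally, up to a nonvanishing factor, Euler's identity for
symmetric multivectors writes the operator through compositions of frame fields, of weight `0` if
tangent to `M` and `1` if transverse, and each frame field has a leading part on `E`. The local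
leading parts are compatible, hence glue, because a differential operator on `E` is determined by
its values on polynomials in base functions and linearizations: these realise all first jets, hence
all jets (`IsLead.unique`).

Uniqueness (`eq_zero_of_nestedComm_linFun`): let `D` be the difference of two linearizations.
Commuted with `j` linear functions and applied to a base function, it gives a function homogeneous
of degree `j + 1 - q` along the fibers. This is zero by smoothness if the degree is negative, by (i)
if `j ≥ q`, and by (i), (ii) and positive codimension if `j = q - 1`. Peeling off linear factors,
`D` vanishes on all the polynomials.

Linearizability of the commutator (`IsLinearizable.lie`) asks for more, namely membership in the
ideal generated by tangent fields. Multivectors are lifted to operators (`exists_symbol_eq`), so a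
linearizable operator is `∑ Xₐ Dₐ` with `Xₐ` tangent, plus lower order terms, and the commutator of
two such compositions can be rewritten with a tangent field in front of every term
(`lie_derivation_comp`). -/

noncomputable section

/-! ### Differential operators on a commutative algebra -/

section Algebra

variable {A : Type*} [CommRing A] [Algebra ℝ A]

/-- Multiplication by a function, as an operator. -/
abbrev mulOp (a : A) : Module.End ℝ A := LinearMap.mulLeft ℝ a

/-- Differential operators of order `< n`, defined recursively. -/
def DOlt : ℕ → Module.End ℝ A → Prop
  | 0, D => D = 0
  | n + 1, D => ∀ a : A, DOlt n ⁅D, mulOp a⁆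

theorem bracket_mulOp_apply (D : Module.End ℝ A) (a x : A) :
    ⁅D, mulOp a⁆ x = D (a * x) - a * D x := by
  simp [Ring.lie_def]

theorem zero_bracket (E : Module.End ℝ A) : ⁅(0 : Module.End ℝ A), E⁆ = 0 := by
  simp [Ring.lie_def]

theorem bracket_zero (E : Module.End ℝ A) : ⁅E, (0 : Module.End ℝ A)⁆ = 0 := by
  simp [Ring.lie_def]

theorem add_mulOp_bracket (D E : Module.End ℝ A) (a : A) :
    ⁅D + E, mulOp a⁆ = ⁅D, mulOp a⁆ + ⁅E, mulOp a⁆ := by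
  simp only [Ring.lie_def, add_mul, mul_add]
  abel

theorem nestedComm_succ (D : Module.End ℝ A) {n : ℕ} (f : Fin (n + 1) → A) :
    nestedComm D f = nestedComm ⁅D, mulOp (f 0)⁆ (fun i => f i.succ) := by
  simp [nestedComm, List.ofFn_succ]

theorem nestedComm_succ_last (D : Module.End ℝ A) {n : ℕ} (f : Fin (n + 1) → A) :
    nestedComm D f = ⁅nestedComm D (fun i => f i.castSucc), mulOp (f (Fin.last n))⁆ := by
  simp only [nestedComm, List.ofFn_succ_last, List.foldl_append, List.foldl_cons, List.foldl_nil]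

theorem nestedComm_zero' (D : Module.End ℝ A) (f : Fin 0 → A) : nestedComm D f = D := by
  simp [nestedComm]

/-- This is the Jacobi identity for commuting multiplications; it makes nested commutators symmetric
in their arguments. -/
theorem bracket_mulOp_comm (D : Module.End ℝ A) (a b : A) :
    ⁅⁅D, mulOp a⁆, mulOp b⁆ = ⁅⁅D, mulOp b⁆, mulOp a⁆ := by
  ext x
  simp only [bracket_mulOp_apply]
  rw [mul_left_comm a b x]
  ring

theorem nestedComm_perm (D : Module.End ℝ A) {n : ℕ} (f : Fin n → A) (τ : Equiv.Perm (Fin n)) :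
    nestedComm D (f ∘ τ) = nestedComm D f := by
  unfold nestedComm
  exact (Equiv.Perm.ofFn_comp_perm τ f).foldl_eq'
    (fun a _ b _ E => bracket_mulOp_comm E a b) D

theorem nestedComm_succAbove (D : Module.End ℝ A) {n : ℕ} (f : Fin (n + 1) → A)
    (j : Fin (n + 1)) :
    nestedComm D f = nestedComm ⁅D, mulOp (f j)⁆ (fun i => f (j.succAbove i)) := by
  have h : (List.ofFn f).Perm (f j :: List.ofFn (fun i => f (j.succAbove i))) := by
    rw [← Multiset.coe_eq_coe, ← Multiset.cons_coe, List.ofFn_eq_map, List.ofFn_eq_map,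
      ← Multiset.map_coe, ← Multiset.map_coe]
    have e : ∀ m, ((List.finRange m : List (Fin m)) : Multiset (Fin m)) = Finset.univ.val :=
      fun m => rfl
    rw [e, e, Fin.univ_succAbove n j, Finset.cons_val, Multiset.map_cons, Finset.map_val,
      Multiset.map_map]
    rfl
  unfold nestedComm
  rw [h.foldl_eq' (fun a _ b _ E => bracket_mulOp_comm E a b) D]
  rfl

theorem nestedComm_bracket (D : Module.End ℝ A) (a : A) {n : ℕ} (f : Fin n → A) :
    nestedComm ⁅D, mulOp a⁆ f = ⁅nestedComm D f, mulOp a⁆ := by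
  have h1 := nestedComm_succ D (Fin.cons a f : Fin (n + 1) → A)
  have h2 := nestedComm_succ_last D (Fin.snoc f a : Fin (n + 1) → A)
  simp only [Fin.cons_zero, Fin.cons_succ, Fin.snoc_castSucc, Fin.snoc_last] at h1 h2
  rw [← h1, ← h2]
  have h3 := nestedComm_succAbove D (Fin.snoc f a : Fin (n + 1) → A) (Fin.last n)
  simp only [Fin.snoc_last, Fin.succAbove_last, Fin.snoc_castSucc] at h3
  rw [h3, h1]

theorem nestedComm_add (D E : Module.End ℝ A) {n : ℕ} (f : Fin n → A) :
    nestedComm (D + E) f = nestedComm D f + nestedComm E f := by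
  induction n generalizing D E with
  | zero => simp [nestedComm_zero']
  | succ n ih => rw [nestedComm_succ, add_mulOp_bracket, ih, ← nestedComm_succ, ← nestedComm_succ]

theorem nestedComm_zero (n : ℕ) (f : Fin n → A) : nestedComm (0 : Module.End ℝ A) f = 0 := by
  have := nestedComm_add (0 : Module.End ℝ A) 0 f
  simpa using this

theorem nestedComm_neg (D : Module.End ℝ A) {n : ℕ} (f : Fin n → A) :
    nestedComm (-D) f = -nestedComm D f := by
  have := nestedComm_add (-D) D f
  rw [neg_add_cancel, nestedComm_zero] at this
  exact eq_neg_of_add_eq_zero_left this.symm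

theorem nestedComm_sub (D E : Module.End ℝ A) {n : ℕ} (f : Fin n → A) :
    nestedComm (D - E) f = nestedComm D f - nestedComm E f := by
  rw [sub_eq_add_neg, nestedComm_add, nestedComm_neg, sub_eq_add_neg]

theorem nestedComm_sum {κ : Type*} (s : Finset κ) (D : κ → Module.End ℝ A) {n : ℕ}
    (f : Fin n → A) : nestedComm (∑ k ∈ s, D k) f = ∑ k ∈ s, nestedComm (D k) f := by
  classical
  induction s using Finset.induction_on with
  | empty => simp [nestedComm_zero]
  | insert a s ha ih => rw [Finset.sum_insert ha, Finset.sum_insert ha, nestedComm_add, ih]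

theorem nestedComm_mulOp_comp (a : A) (D : Module.End ℝ A) {n : ℕ} (f : Fin n → A) :
    nestedComm (mulOp a * D) f = mulOp a * nestedComm D f := by
  induction n generalizing D with
  | zero => simp [nestedComm_zero']
  | succ n ih =>
    rw [nestedComm_succ, nestedComm_succ, ← ih]
    congr 1
    ext x
    simp only [bracket_mulOp_apply, Module.End.mul_apply, LinearMap.mulLeft_apply]
    ring

theorem DOlt_iff {n : ℕ} {D : Module.End ℝ A} :
    DOlt n D ↔ ∀ f : Fin n → A, nestedComm D f = 0 := by
  induction n generalizing D with
  | zero =>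
    simp only [nestedComm_zero', forall_const]
    rfl
  | succ n ih =>
    constructor
    · intro h f
      rw [nestedComm_succ]
      exact ih.1 (h _) _
    · intro h a
      refine ih.2 fun f => ?_
      have := h (Fin.cons a f)
      rwa [nestedComm_succ] at this

theorem isDO_iff {q : ℕ} {D : Module.End ℝ A} : IsDO q D ↔ DOlt (q + 1) D := DOlt_iff.symm

theorem DOlt.zero (n : ℕ) : DOlt n (0 : Module.End ℝ A) :=
  DOlt_iff.2 fun f => nestedComm_zero n f

theorem DOlt.add {n : ℕ} {D E : Module.End ℝ A} (hD : DOlt n D) (hE : DOlt n E) :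
    DOlt n (D + E) :=
  DOlt_iff.2 fun f => by rw [nestedComm_add, DOlt_iff.1 hD, DOlt_iff.1 hE, add_zero]

theorem DOlt.neg {n : ℕ} {D : Module.End ℝ A} (hD : DOlt n D) : DOlt n (-D) :=
  DOlt_iff.2 fun f => by rw [nestedComm_neg, DOlt_iff.1 hD, neg_zero]

theorem DOlt.sub {n : ℕ} {D E : Module.End ℝ A} (hD : DOlt n D) (hE : DOlt n E) :
    DOlt n (D - E) := by
  rw [sub_eq_add_neg]
  exact hD.add hE.neg

theorem DOlt.sum {κ : Type*} {s : Finset κ} {n : ℕ} {D : κ → Module.End ℝ A}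
    (h : ∀ k ∈ s, DOlt n (D k)) : DOlt n (∑ k ∈ s, D k) :=
  DOlt_iff.2 fun f => by
    rw [nestedComm_sum]
    exact Finset.sum_eq_zero fun k hk => DOlt_iff.1 (h k hk) f

theorem DOlt.mulOp_comp {n : ℕ} {D : Module.End ℝ A} (a : A) (hD : DOlt n D) :
    DOlt n (mulOp a * D) :=
  DOlt_iff.2 fun f => by rw [nestedComm_mulOp_comp, DOlt_iff.1 hD, mul_zero]

theorem DOlt.succ {n : ℕ} {D : Module.End ℝ A} (hD : DOlt n D) : DOlt (n + 1) D :=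
  DOlt_iff.2 fun f => by
    rw [nestedComm_succ_last, DOlt_iff.1 hD, zero_bracket]

theorem DOlt.mono {m n : ℕ} {D : Module.End ℝ A} (hD : DOlt m D) (h : m ≤ n) : DOlt n D := by
  induction h with
  | refl => exact hD
  | step _ ih => exact ih.succ

theorem DOlt.bracket_mulOp {n : ℕ} {D : Module.End ℝ A} (hD : DOlt n D) (a : A) :
    DOlt (n - 1) ⁅D, mulOp a⁆ := by
  cases n with
  | zero =>
    have h : D = 0 := hD
    rw [h, zero_bracket]
    exact DOlt.zero _
  | succ n => exact hD a

/-- Orders at most `m - 1` and `n - 1` add up to at most `m + n - 2`. The induction uses that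
commuting with a multiplication obeys the Leibniz rule; zero operators are treated apart because of
truncated subtraction. -/
theorem DOlt.comp {m n : ℕ} {D E : Module.End ℝ A} (hD : DOlt m D) (hE : DOlt n E) :
    DOlt (m + n - 1) (D * E) := by
  induction hk : m + n using Nat.strong_induction_on generalizing m n D E with
  | _ k ih =>
    rcases Nat.eq_zero_or_pos m with rfl | hm
    · have h : D = 0 := hD
      rw [h, zero_mul]
      exact DOlt.zero _
    rcases Nat.eq_zero_or_pos n with rfl | hn
    · have h : E = 0 := hE
      rw [h, mul_zero]
      exact DOlt.zero _
    obtain ⟨l, rfl⟩ : ∃ l, k = l + 2 := ⟨k - 2, by omega⟩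
    intro a
    have e : ⁅D * E, mulOp a⁆ = D * ⁅E, mulOp a⁆ + ⁅D, mulOp a⁆ * E := by
      simp only [Ring.lie_def, mul_sub, sub_mul, mul_assoc]
      abel
    rw [e]
    have h1 := ih (m + (n - 1)) (by omega) hD (hE.bracket_mulOp a) rfl
    have h2 := ih ((m - 1) + n) (by omega) (hD.bracket_mulOp a) hE rfl
    exact (h1.mono (by omega)).add (h2.mono (by omega))

/-- One order better than the composition: the induction now starts from two operators of order
zero, which are multiplications and commute. -/
theorem DOlt.lie {m n : ℕ} {D E : Module.End ℝ A} (hD : DOlt m D) (hE : DOlt n E) :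
    DOlt (m + n - 2) ⁅D, E⁆ := by
  induction hk : m + n using Nat.strong_induction_on generalizing m n D E with
  | _ k ih =>
    rcases Nat.eq_zero_or_pos m with rfl | hm
    · have h : D = 0 := hD
      rw [h, zero_bracket]
      exact DOlt.zero _
    rcases Nat.eq_zero_or_pos n with rfl | hn
    · have h : E = 0 := hE
      rw [h, bracket_zero]
      exact DOlt.zero _
    obtain ⟨l, rfl⟩ : ∃ l, k = l + 2 := ⟨k - 2, by omega⟩
    rcases Nat.eq_zero_or_pos l with rfl | hl
    · obtain rfl : m = 1 := by omega
      obtain rfl : n = 1 := by omega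
      have key : ∀ F : Module.End ℝ A, DOlt 1 F → ∀ x, F x = x * F 1 := by
        intro F hF x
        have h : ⁅F, mulOp x⁆ = 0 := hF x
        have h' := LinearMap.congr_fun h 1
        rw [bracket_mulOp_apply, mul_one] at h'
        simpa [sub_eq_zero] using h'
      change ⁅D, E⁆ = 0
      ext x
      simp only [Ring.lie_def, LinearMap.sub_apply, Module.End.mul_apply, LinearMap.zero_apply]
      rw [key D hD (E x), key E hE x, key E hE (D x), key D hD x]
      ring
    obtain ⟨l', rfl⟩ : ∃ l', l = l' + 1 := ⟨l - 1, by omega⟩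
    intro a
    have e : ⁅⁅D, E⁆, mulOp a⁆ = ⁅D, ⁅E, mulOp a⁆⁆ + ⁅⁅D, mulOp a⁆, E⁆ := by
      simp only [Ring.lie_def, mul_sub, sub_mul, mul_assoc]
      abel
    rw [e]
    have h1 := ih (m + (n - 1)) (by omega) hD (hE.bracket_mulOp a) rfl
    have h2 := ih ((m - 1) + n) (by omega) (hD.bracket_mulOp a) hE rfl
    exact (h1.mono (by omega)).add (h2.mono (by omega))

theorem DOlt_one_mulOp (a : A) : DOlt 1 (mulOp a) := by
  intro b
  change ⁅mulOp a, mulOp b⁆ = 0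
  ext x
  rw [bracket_mulOp_apply]
  simp only [LinearMap.mulLeft_apply, LinearMap.zero_apply]
  ring

theorem DOlt.apply_of_one {D : Module.End ℝ A} (hD : DOlt 1 D) (x : A) : D x = x * D 1 := by
  have h : ⁅D, mulOp x⁆ = 0 := hD x
  have h' := LinearMap.congr_fun h 1
  rw [bracket_mulOp_apply, mul_one] at h'
  simpa [sub_eq_zero] using h'

theorem derivation_bracket_mulOp (X : Derivation ℝ A A) (a : A) :
    ⁅(X : Module.End ℝ A), mulOp a⁆ = mulOp (X a) := by
  ext x
  rw [bracket_mulOp_apply]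
  simp only [Derivation.coeFn_coe, Derivation.leibniz, smul_eq_mul, LinearMap.mulLeft_apply]
  ring

theorem DOlt_two_derivation (X : Derivation ℝ A A) : DOlt 2 (X : Module.End ℝ A) := by
  intro a
  rw [derivation_bracket_mulOp]
  exact DOlt_one_mulOp _

/-- An operator of order `< n` maps the `n`-th power of an ideal into the ideal. -/
theorem DOlt.apply_mem {n : ℕ} {D : Module.End ℝ A} (hD : DOlt n D) (J : Ideal A) {x : A}
    (hx : x ∈ J ^ n) : D x ∈ J := by
  induction n generalizing D x with
  | zero =>
    have h : D = 0 := hD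
    simp [h]
  | succ n ih =>
    rw [pow_succ'] at hx
    refine Submodule.mul_induction_on hx (fun a ha b hb => ?_) (fun u v hu hv => ?_)
    · have h := ih (hD a) hb
      rw [bracket_mulOp_apply] at h
      have h2 : a * D b ∈ J := J.mul_mem_right _ ha
      have h3 := J.add_mem h h2
      rwa [sub_add_cancel] at h3
    · rw [map_add]
      exact J.add_mem hu hv

/-- An operator of order `≤ q` whose nested commutators of length `q` vanish at `1` has
order `< q`. -/
theorem DOlt.of_symbol_eq_zero {q : ℕ} {D : Module.End ℝ A} (hD : DOlt (q + 1) D)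
    (h : ∀ f : Fin q → A, symbol q D f = 0) : DOlt q D := by
  refine DOlt_iff.2 fun f => ?_
  have h1 : DOlt 1 (nestedComm D f) := by
    intro a
    have := DOlt_iff.1 hD (Fin.snoc f a)
    rw [nestedComm_succ_last] at this
    simp only [Fin.snoc_castSucc, Fin.snoc_last] at this
    exact this
  ext x
  rw [h1.apply_of_one x]
  have := h f
  rw [symbol] at this
  rw [this, mul_zero, LinearMap.zero_apply]

theorem DOlt.symbol_eq_zero {q : ℕ} {D : Module.End ℝ A} (hD : DOlt q D) (f : Fin q → A) :
    symbol q D f = 0 := by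
  rw [symbol, DOlt_iff.1 hD, LinearMap.zero_apply]

theorem DOlt.nestedComm {n k : ℕ} {D : Module.End ℝ A} (hD : DOlt n D) (f : Fin k → A) :
    DOlt (n - k) (nestedComm D f) := by
  induction k generalizing n D with
  | zero => rwa [nestedComm_zero']
  | succ k ih =>
    rw [nestedComm_succ]
    exact (ih (hD.bracket_mulOp (f 0)) _).mono (by omega)

theorem nestedComm_update (D : Module.End ℝ A) {q : ℕ} (f : Fin (q + 1) → A) (i : Fin (q + 1))
    (a : A) : nestedComm D (Function.update f i a) =
      ⁅nestedComm D (fun k => f (i.succAbove k)), mulOp a⁆ := by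
  rw [nestedComm_succAbove D _ i, nestedComm_bracket]
  simp

/-- With all arguments but one frozen, the nested commutator `N` has order at most one, so `[N, a]`
is a multiplication; evaluating it at `b` gives the Leibniz rule. -/
theorem isSymMultivector_symbol {q : ℕ} {D : Module.End ℝ A} (hD : DOlt (q + 1) D) :
    IsSymMultivector (symbol q D) := by
  refine ⟨fun τ f => by simp only [symbol, nestedComm_perm], ?_, ?_, ?_⟩
  · intro f i a b
    cases q with
    | zero => exact i.elim0
    | succ q =>
      simp only [symbol, nestedComm_update, bracket_mulOp_apply, mul_one, map_add]
      ring
  · intro f i c a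
    cases q with
    | zero => exact i.elim0
    | succ q =>
      simp only [symbol, nestedComm_update, bracket_mulOp_apply, mul_one, map_smul, smul_sub,
        smul_mul_assoc]
  · intro f i a b
    cases q with
    | zero => exact i.elim0
    | succ q =>
      simp only [symbol, nestedComm_update]
      set N := _root_.nestedComm D (fun k => f (i.succAbove k)) with hN
      have hN2 : DOlt 2 N := (hD.nestedComm _).mono (by omega)
      have h := (hN2 a).apply_of_one b
      simp only [bracket_mulOp_apply, mul_one] at h ⊢
      linear_combination h

/-- Since `[X, a]` is already a multiplication, `X` absorbs at most one of the functions; the sum is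
over which one. -/
theorem nestedComm_derivation_comp (X : Derivation ℝ A A) (D : Module.End ℝ A) {n : ℕ}
    (f : Fin (n + 1) → A) :
    nestedComm ((X : Module.End ℝ A) * D) f = (X : Module.End ℝ A) * nestedComm D f +
      ∑ j, mulOp (X (f j)) * nestedComm D (fun i => f (j.succAbove i)) := by
  have e : ∀ (E : Module.End ℝ A) (a : A), ⁅(X : Module.End ℝ A) * E, mulOp a⁆ =
      (X : Module.End ℝ A) * ⁅E, mulOp a⁆ + mulOp (X a) * E := by
    intro E a
    rw [← derivation_bracket_mulOp]
    simp only [Ring.lie_def, mul_sub, sub_mul, mul_assoc]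
    abel
  induction n generalizing D with
  | zero => simp [nestedComm_succ, nestedComm_zero', e]
  | succ n ih =>
    rw [nestedComm_succ, e, nestedComm_add, ih, nestedComm_mulOp_comp,
      Fin.sum_univ_succ (n := n + 1), nestedComm_succ D f, add_assoc]
    congr 1
    rw [add_comm]
    congr 1
    refine Finset.sum_congr rfl fun j _ => ?_
    rw [nestedComm_succ D (fun i => f (j.succ.succAbove i))]
    simp

theorem symbol_derivation_comp (X : Derivation ℝ A A) {D : Module.End ℝ A} {n : ℕ}
    (hD : DOlt (n + 1) D) (f : Fin (n + 1) → A) :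
    symbol (n + 1) ((X : Module.End ℝ A) * D) f = vectorProd X (symbol n D) f := by
  rw [symbol, nestedComm_derivation_comp, DOlt_iff.1 hD]
  simp [vectorProd, symbol]

theorem symbol_add {q : ℕ} (D E : Module.End ℝ A) (f : Fin q → A) :
    symbol q (D + E) f = symbol q D f + symbol q E f := by
  simp [symbol, nestedComm_add]

theorem symbol_sub {q : ℕ} (D E : Module.End ℝ A) (f : Fin q → A) :
    symbol q (D - E) f = symbol q D f - symbol q E f := by
  simp [symbol, nestedComm_sub]

theorem symbol_sum {q : ℕ} {κ : Type*} (s : Finset κ) (D : κ → Module.End ℝ A) (f : Fin q → A) :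
    symbol q (∑ k ∈ s, D k) f = ∑ k ∈ s, symbol q (D k) f := by
  simp [symbol, nestedComm_sum, LinearMap.sum_apply]

theorem symbol_mulOp_comp {q : ℕ} (a : A) (D : Module.End ℝ A) (f : Fin q → A) :
    symbol q (mulOp a * D) f = a * symbol q D f := by
  simp [symbol, nestedComm_mulOp_comp]

/-- The commutator of two compositions with derivations on the left. -/
theorem lie_derivation_comp (X X' D D' : Module.End ℝ A) :
    ⁅X * D, X' * D'⁆ = X * (⁅D, X'⁆ * D') - X' * (⁅D', X⁆ * D) + ⁅X, X'⁆ * (D * D') +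
      X' * (X * ⁅D, D'⁆) := by
  simp only [Ring.lie_def, mul_sub, sub_mul, mul_assoc]
  abel

end Algebra

/-! ### Symbols and frames -/

theorem comp_cycleRange_symm {A : Type*} {q : ℕ} (f : Fin (q + 1) → A) (j : Fin (q + 1)) :
    f ∘ (Fin.cycleRange j).symm = Fin.cons (f j) (fun i => f (j.succAbove i)) := by
  funext i
  refine Fin.cases ?_ (fun i => ?_) i
  · simp
  · simp [Fin.cycleRange_symm_succ]

section Frames

variable {A : Type*} [CommRing A] [Algebra ℝ A]

theorem IsSymMultivector.eq_cons {q : ℕ} {P : (Fin (q + 1) → A) → A} (hP : IsSymMultivector P)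
    (f : Fin (q + 1) → A) (j : Fin (q + 1)) :
    P f = P (Fin.cons (f j) (fun i => f (j.succAbove i))) := by
  rw [← comp_cycleRange_symm, hP.symm]

/-- Freezing all the arguments of a multivector but the first gives a derivation. -/
def IsSymMultivector.derivation {q : ℕ} {P : (Fin (q + 1) → A) → A} (hP : IsSymMultivector P)
    (g : Fin q → A) : Derivation ℝ A A :=
  Derivation.mk'
    { toFun := fun a => P (Fin.cons a g)
      map_add' := fun a b => by
        have := hP.map_add (Fin.cons 0 g) 0 a b
        simpa only [Fin.update_cons_zero] using this
      map_smul' := fun c a => by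
        have := hP.map_smul (Fin.cons 0 g) 0 c a
        simpa only [Fin.update_cons_zero, RingHom.id_apply] using this }
    (fun a b => by
      have := hP.leibniz (Fin.cons 0 g) 0 a b
      simp only [Fin.update_cons_zero] at this
      exact this)

theorem IsSymMultivector.derivation_apply {q : ℕ} {P : (Fin (q + 1) → A) → A}
    (hP : IsSymMultivector P) (g : Fin q → A) (a : A) :
    hP.derivation g a = P (Fin.cons a g) := rfl

theorem IsSymMultivector.contract {q : ℕ} {P : (Fin (q + 1) → A) → A} (hP : IsSymMultivector P)
    (y : A) : IsSymMultivector (fun g : Fin q → A => P (Fin.cons y g)) := by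
  refine ⟨fun τ f => ?_, fun f i a b => ?_, fun f i c a => ?_, fun f i a b => ?_⟩
  · have h : (Fin.cons y (f ∘ τ) : Fin (q + 1) → A) =
        (Fin.cons y f : Fin (q + 1) → A) ∘ (Equiv.Perm.decomposeFin.symm (0, τ)) := by
      funext i
      refine Fin.cases ?_ (fun i => ?_) i <;> simp
    rw [h, hP.symm]
  · simp only [Fin.cons_update]
    exact hP.map_add _ _ _ _
  · simp only [Fin.cons_update]
    exact hP.map_smul _ _ _ _
  · simp only [Fin.cons_update]
    exact hP.leibniz _ _ _ _

variable {ι : Type*}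

/-- Properties of operators of order `< n` and degree `d`, stable under the operations used to
build an operator with a given symbol. -/
structure IsLiftClass (I : Ideal A) (w : ι → ℤ) (Z : ι → Derivation ℝ A A)
    (Φ : ℕ → ℤ → Module.End ℝ A → Prop) : Prop where
  -- The degree `d` bounds the loss of order of vanishing along `I`: the field `Z i` costs `w i`, a
  -- function costs nothing, and a function in `I` gains one. Two classes are used: all operators
  -- with the degree ignored, and operators having a leading part on the normal bundle.
  zero : ∀ n d, Φ n d 0
  add : ∀ n d D E, Φ n d D → Φ n d E → Φ n d (D + E)
  mulOp_comp : ∀ n d a D, Φ n d D → Φ n d (mulOp a * D)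
  of_mul : ∀ a, Φ 1 0 (mulOp a)
  of_mem : ∀ a ∈ I, Φ 1 (-1) (mulOp a)
  comp : ∀ n d i D, Φ n d D → Φ (n + 1) (d + w i) ((Z i : Module.End ℝ A) * D)
  mono : ∀ n d D, Φ n d D → Φ n (d + 1) D
  succ : ∀ n d D, Φ n d D → Φ (n + 1) d D
  isDO : ∀ n d D, Φ n d D → DOlt n D

section

variable {I : Ideal A} {w : ι → ℤ} {Z : ι → Derivation ℝ A A} {Φ : ℕ → ℤ → Module.End ℝ A → Prop}

theorem IsLiftClass.sum (hΦ : IsLiftClass I w Z Φ) {κ : Type*} (s : Finset κ) {n : ℕ} {d : ℤ}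
    {D : κ → Module.End ℝ A} (hD : ∀ k ∈ s, Φ n d (D k)) : Φ n d (∑ k ∈ s, D k) := by
  classical
  induction s using Finset.induction_on with
  | empty => exact hΦ.zero n d
  | insert a s ha ih =>
    rw [Finset.sum_insert ha]
    exact hΦ.add _ _ _ _ (hD a (Finset.mem_insert_self _ _))
      (ih fun k hk => hD k (Finset.mem_insert_of_mem hk))

end

/-- The class of all differential operators. -/
theorem isLiftClass_DOlt (Z : ι → Derivation ℝ A A) :
    IsLiftClass (⊥ : Ideal A) (fun _ => 0) Z (fun n _ D => DOlt n D) where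
  zero n _ := DOlt.zero n
  add _ _ _ _ h h' := h.add h'
  mulOp_comp _ _ a _ h := h.mulOp_comp a
  of_mul a := DOlt_one_mulOp a
  of_mem a _ := DOlt_one_mulOp a
  comp n _ i D h := ((DOlt_two_derivation (Z i)).comp h).mono (by omega)
  mono _ _ _ h := h
  succ _ _ _ h := h.succ
  isDO _ _ _ h := h

variable [Fintype ι]

/-- `Z` is a frame dual to the functions `y` where `ψ` does not vanish. -/
def IsFrame (ψ : A) (y : ι → A) (Z : ι → Derivation ℝ A A) : Prop :=
  ∀ (X : Derivation ℝ A A) (a : A), ψ * X a = ∑ i, ψ * (X (y i) * Z i a)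

/-- Euler's identity for `P` seen as a homogeneous polynomial of degree `q + 1` in the frame:
expanding `P` along the frame in any one of its `q + 1` arguments returns `ψ * P`. -/
theorem IsFrame.sum_vectorProd {ψ : A} {y : ι → A} {Z : ι → Derivation ℝ A A}
    (h : IsFrame ψ y Z) {q : ℕ} {P : (Fin (q + 1) → A) → A} (hP : IsSymMultivector P)
    (f : Fin (q + 1) → A) :
    ψ * ∑ i, vectorProd (Z i) (fun g => P (Fin.cons (y i) g)) f = ((q : ℝ) + 1) • (ψ * P f) := by
  simp only [vectorProd]
  rw [Finset.sum_comm, Finset.mul_sum]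
  have : ∀ j : Fin (q + 1), ψ * ∑ i, Z i (f j) * P (Fin.cons (y i) (fun k => f (j.succAbove k))) =
      ψ * P f := by
    intro j
    have h1 := h (hP.derivation (fun k => f (j.succAbove k))) (f j)
    simp only [hP.derivation_apply] at h1
    rw [hP.eq_cons f j, h1, Finset.mul_sum]
    refine Finset.sum_congr rfl fun i _ => ?_
    ring
  rw [Finset.sum_congr rfl fun j _ => this j, Finset.sum_const, Finset.card_univ,
    Fintype.card_fin, ← Nat.cast_smul_eq_nsmul ℝ]
  push_cast
  rfl

/-- Euler's identity divided by `q + 1`: lifts of the contractions of `P` with the coordinates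
assemble into a lift of `P`. -/
theorem IsFrame.symbol_lift {ψ : A} {y : ι → A} {Z : ι → Derivation ℝ A A}
    (h : IsFrame ψ y Z) {q : ℕ} {P : (Fin (q + 1) → A) → A} (hP : IsSymMultivector P) {N : ℕ}
    {D : ι → Module.End ℝ A} (hD : ∀ i, DOlt (q + 1) (D i))
    (hs : ∀ i f, symbol q (D i) f = ψ ^ N * P (Fin.cons (y i) f)) (f : Fin (q + 1) → A) :
    symbol (q + 1) (mulOp (((q : ℝ) + 1)⁻¹ • ψ) * ∑ i, (Z i : Module.End ℝ A) * D i) f =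
      ψ ^ (N + 1) * P f := by
  rw [symbol_mulOp_comp, symbol_sum]
  have h1 : ∀ i, symbol (q + 1) ((Z i : Module.End ℝ A) * D i) f =
      ψ ^ N * vectorProd (Z i) (fun g => P (Fin.cons (y i) g)) f := by
    intro i
    rw [symbol_derivation_comp _ (hD i)]
    simp only [vectorProd, hs, Finset.mul_sum]
    refine Finset.sum_congr rfl fun j _ => ?_
    ring
  rw [Finset.sum_congr rfl fun i _ => h1 i, ← Finset.mul_sum, smul_mul_assoc, mul_left_comm,
    h.sum_vectorProd hP, mul_smul_comm, smul_smul, inv_mul_cancel₀ (by positivity), one_smul]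
  ring

section

variable {I : Ideal A} {w : ι → ℤ} {Z : ι → Derivation ℝ A A} {Φ : ℕ → ℤ → Module.End ℝ A → Prop}

variable {ψ : A} {y : ι → A}

/-- The inductive step of the construction of operators with a given symbol. -/
theorem IsLiftClass.lift_succ (hΦ : IsLiftClass I w Z Φ) (hf : IsFrame ψ y Z) {q : ℕ} {d : ℤ}
    {P : (Fin (q + 1) → A) → A} (hP : IsSymMultivector P)
    (h : ∀ i, ∃ (N : ℕ) (D : Module.End ℝ A), Φ (q + 1) (d - w i) D ∧
      ∀ f, symbol q D f = ψ ^ N * P (Fin.cons (y i) f)) :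
    ∃ (N : ℕ) (D : Module.End ℝ A), Φ (q + 2) d D ∧
      ∀ f, symbol (q + 1) D f = ψ ^ N * P f := by
  choose N D hD hs using h
  -- The exponents `N i` depend on `i`; multiplying the `i`-th operator by the missing power of `ψ`
  -- brings them all to `∑ i, N i`.
  refine ⟨(∑ i, N i) + 1, _, ?_, fun f => hf.symbol_lift hP (N := ∑ i, N i)
    (D := fun i => mulOp (ψ ^ (∑ k, N k - N i)) * D i) (fun i => ?_) (fun i g => ?_) f⟩
  · refine hΦ.mulOp_comp _ _ _ _ (hΦ.sum _ fun i _ => ?_)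
    have := hΦ.comp _ _ i _ (hΦ.mulOp_comp _ _ (ψ ^ (∑ k, N k - N i)) _ (hD i))
    rwa [sub_add_cancel] at this
  · exact (hΦ.isDO _ _ _ (hD i)).mulOp_comp _
  · rw [symbol_mulOp_comp, hs, ← mul_assoc, ← pow_add,
      Nat.sub_add_cancel (Finset.single_le_sum (fun _ _ => Nat.zero_le _) (Finset.mem_univ i))]

theorem symbol_zero_mulOp (a : A) (f : Fin 0 → A) : symbol 0 (mulOp a) f = a := by
  simp [symbol, nestedComm_zero']

/-- The crude bound: every frame field costs at most one, so composing `q` of them costs at most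
`q`. -/
theorem IsLiftClass.lift (hΦ : IsLiftClass I w Z Φ) (hf : IsFrame ψ y Z)
    (hw : ∀ i, w i = 0 ∨ w i = 1) {q : ℕ} {P : (Fin q → A) → A} (hP : IsSymMultivector P) :
    ∃ (N : ℕ) (D : Module.End ℝ A), Φ (q + 1) q D ∧ ∀ f, symbol q D f = ψ ^ N * P f := by
  induction q with
  | zero =>
    refine ⟨0, mulOp (P Fin.elim0), hΦ.of_mul _, fun f => ?_⟩
    rw [symbol_zero_mulOp, pow_zero, one_mul, Subsingleton.elim f Fin.elim0]
  | succ q ih =>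
    refine hΦ.lift_succ hf hP fun i => ?_
    obtain ⟨N, D, hD, hs⟩ := ih (hP.contract (y i))
    refine ⟨N, D, ?_, hs⟩
    rcases hw i with h | h
    · rw [h]
      have := hΦ.mono _ _ _ hD
      push_cast
      rwa [sub_zero]
    · rw [h]
      push_cast
      rwa [add_sub_cancel_right]

/-- One degree is gained over `lift` in every term. A frame field of weight `0` saves it at once,
and the crude bound serves for the rest. If the weight is `1` then `y i ∈ I`, so contracting with `y
i` keeps the property of preserving `I`, and the induction goes on, down to a function in `I`, of
degree `-1`. -/
theorem IsLiftClass.lift_of_mem (hΦ : IsLiftClass I w Z Φ) (hf : IsFrame ψ y Z)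
    (hw : ∀ i, w i = 0 ∨ (w i = 1 ∧ y i ∈ I)) {q : ℕ} {P : (Fin q → A) → A}
    (hP : IsSymMultivector P) (hPI : ∀ f, (∀ i, f i ∈ I) → P f ∈ I) :
    ∃ (N : ℕ) (D : Module.End ℝ A), Φ (q + 1) (q - 1) D ∧
      ∀ f, symbol q D f = ψ ^ N * P f := by
  induction q with
  | zero =>
    refine ⟨0, mulOp (P Fin.elim0), ?_, fun f => ?_⟩
    · have := hΦ.of_mem _ (hPI Fin.elim0 fun i => i.elim0)
      simpa using this
    · rw [symbol_zero_mulOp, pow_zero, one_mul, Subsingleton.elim f Fin.elim0]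
  | succ q ih =>
    refine hΦ.lift_succ hf hP fun i => ?_
    rcases hw i with h | ⟨h, hy⟩
    · obtain ⟨N, D, hD, hs⟩ := hΦ.lift hf (fun i => (hw i).imp_right And.left)
        (hP.contract (y i))
      refine ⟨N, D, ?_, hs⟩
      rw [h]
      push_cast
      rwa [add_sub_cancel_right, sub_zero]
    · obtain ⟨N, D, hD, hs⟩ := ih (hP.contract (y i)) fun f hf => hPI _ fun k => by
        refine Fin.cases ?_ (fun k => ?_) k
        · exact hy
        · simpa using hf k
      refine ⟨N, D, ?_, hs⟩
      rw [h]
      push_cast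
      rwa [add_sub_cancel_right]

/-- Up to a power of `ψ`, an operator of order `≤ q` is in the class in degree `q`. -/
theorem IsLiftClass.of_isDO (hΦ : IsLiftClass I w Z Φ) (hf : IsFrame ψ y Z)
    (hw : ∀ i, w i = 0 ∨ w i = 1) {q : ℕ} {D : Module.End ℝ A} (hD : DOlt (q + 1) D) :
    ∃ N : ℕ, Φ (q + 1) q (mulOp (ψ ^ N) * D) := by
  induction q generalizing D with
  | zero =>
    refine ⟨0, ?_⟩
    have e : mulOp (ψ ^ 0) * D = mulOp (D 1) := by
      ext x
      simp [hD.apply_of_one x, mul_comm]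
    rw [e]
    exact hΦ.of_mul _
  | succ q ih =>
    obtain ⟨N, E, hE, hs⟩ := hΦ.lift hf hw (isSymMultivector_symbol hD)
    have h1 : DOlt (q + 1) (mulOp (ψ ^ N) * D - E) :=
      ((hD.mulOp_comp _).sub (hΦ.isDO _ _ _ hE)).of_symbol_eq_zero fun f => by
        rw [symbol_sub, symbol_mulOp_comp, hs, sub_self]
    obtain ⟨N', h2⟩ := ih h1
    refine ⟨N' + N, ?_⟩
    have e : mulOp (ψ ^ (N' + N)) * D =
        mulOp (ψ ^ N') * (mulOp (ψ ^ N) * D - E) + mulOp (ψ ^ N') * E := by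
      ext x
      simp [pow_add, mul_sub]
    rw [e]
    push_cast at hE ⊢
    exact hΦ.add _ _ _ _ (hΦ.mono _ _ _ (hΦ.succ _ _ _ h2)) (hΦ.mulOp_comp _ _ _ _ hE)

/-- Up to a power of `ψ`, an operator of order `≤ q` whose symbol preserves `I` is in the class
in degree `q - 1`. -/
theorem IsLiftClass.of_isDO_of_mem (hΦ : IsLiftClass I w Z Φ) (hf : IsFrame ψ y Z)
    (hw : ∀ i, w i = 0 ∨ (w i = 1 ∧ y i ∈ I)) {q : ℕ} {D : Module.End ℝ A}
    (hD : DOlt (q + 1) D) (hPI : ∀ f : Fin q → A, (∀ i, f i ∈ I) → symbol q D f ∈ I) :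
    ∃ N : ℕ, Φ (q + 1) (q - 1) (mulOp (ψ ^ N) * D) := by
  obtain ⟨N, E, hE, hs⟩ := hΦ.lift_of_mem hf hw (isSymMultivector_symbol hD) hPI
  have h1 : DOlt q (mulOp (ψ ^ N) * D - E) :=
    ((hD.mulOp_comp _).sub (hΦ.isDO _ _ _ hE)).of_symbol_eq_zero fun f => by
      rw [symbol_sub, symbol_mulOp_comp, hs, sub_self]
  -- The remainder has order at most `q - 1`, so the crude bound already gives degree `q - 1`.
  have key : ∃ N' : ℕ, Φ (q + 1) (q - 1) (mulOp (ψ ^ N') * (mulOp (ψ ^ N) * D - E)) := by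
    cases q with
    | zero =>
      refine ⟨0, ?_⟩
      have h : mulOp (ψ ^ N) * D - E = 0 := h1
      rw [h, mul_zero]
      exact hΦ.zero _ _
    | succ q =>
      obtain ⟨N', h2⟩ := hΦ.of_isDO hf (fun i => (hw i).imp_right And.left) h1
      refine ⟨N', ?_⟩
      push_cast
      rw [add_sub_cancel_right]
      exact hΦ.succ _ _ _ h2
  obtain ⟨N', h2⟩ := key
  refine ⟨N' + N, ?_⟩
  have e : mulOp (ψ ^ (N' + N)) * D =
      mulOp (ψ ^ N') * (mulOp (ψ ^ N) * D - E) + mulOp (ψ ^ N') * E := by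
    ext x
    simp [pow_add, mul_sub]
  rw [e]
  exact hΦ.add _ _ _ _ h2 (hΦ.mulOp_comp _ _ _ _ hE)

end

/-- First jets give all jets: an element of `m ^ k` is a sum of products of elements of `m`, and
replacing the factors by approximations in `R` changes it only modulo `m ^ (k + 1)`. -/
theorem exists_sub_mem_pow {m : Ideal A} {R : Subalgebra ℝ A}
    (h : ∀ a : A, ∃ r ∈ R, a - r ∈ m ^ 2) (n : ℕ) (a : A) : ∃ r ∈ R, a - r ∈ m ^ n := by
  have key : ∀ (k : ℕ) (a : A), a ∈ m ^ k → ∃ r ∈ R, r ∈ m ^ k ∧ a - r ∈ m ^ (k + 1) := by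
    intro k
    induction k with
    | zero =>
      intro a _
      obtain ⟨r, hr, h1⟩ := h a
      exact ⟨r, hr, by simp, Ideal.pow_le_pow_right (by omega) h1⟩
    | succ k ih =>
      intro a ha
      rw [pow_succ'] at ha
      refine Submodule.mul_induction_on ha (fun b hb c hc => ?_) (fun u v hu hv => ?_)
      · obtain ⟨r, hr, h1⟩ := h b
        obtain ⟨s, hs, hsm, h2⟩ := ih c hc
        have hrm : r ∈ m := by
          have h3 : b - r ∈ m := Ideal.pow_le_self (by norm_num) h1
          have h4 := m.sub_mem hb h3
          rwa [sub_sub_cancel] at h4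
        refine ⟨r * s, R.mul_mem hr hs, ?_, ?_⟩
        · rw [pow_succ']
          exact Ideal.mul_mem_mul hrm hsm
        · have e : b * c - r * s = b * (c - s) + (b - r) * s := by ring
          rw [e]
          refine Ideal.add_mem _ ?_ ?_
          · rw [pow_succ']
            exact Ideal.mul_mem_mul hb h2
          · have h5 := Ideal.mul_mem_mul h1 hsm
            rw [← pow_add] at h5
            exact Ideal.pow_le_pow_right (by omega) h5
      · obtain ⟨r, hr, hr1, hr2⟩ := hu
        obtain ⟨s, hs, hs1, hs2⟩ := hv
        refine ⟨r + s, R.add_mem hr hs, Ideal.add_mem _ hr1 hs1, ?_⟩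
        rw [add_sub_add_comm]
        exact Ideal.add_mem _ hr2 hs2
  induction n with
  | zero => exact ⟨0, R.zero_mem, by simp⟩
  | succ n ih =>
    obtain ⟨r, hr, h1⟩ := ih
    obtain ⟨s, hs, -, h2⟩ := key n _ h1
    exact ⟨r + s, R.add_mem hr hs, by rwa [← sub_sub]⟩

/-- A differential operator is determined at a point by its values on a subalgebra containing
representatives of all the first jets. -/
theorem DOlt.apply_mem_of_subalgebra {n : ℕ} {D : Module.End ℝ A} (hD : DOlt n D) {m : Ideal A}
    {R : Subalgebra ℝ A} (h : ∀ a : A, ∃ r ∈ R, a - r ∈ m ^ 2) (hR : ∀ r ∈ R, D r ∈ m) (a : A) :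
    D a ∈ m := by
  obtain ⟨r, hr, h1⟩ := exists_sub_mem_pow h n a
  have h2 := m.add_mem (hD.apply_mem m h1) (hR r hr)
  rwa [← map_add, sub_add_cancel] at h2

end Frames

/-! ### Hadamard's lemma -/

section Hadamard

open MeasureTheory

variable {U : Type*} [NormedAddCommGroup U] [NormedSpace ℝ U]

/-- The mean derivative of `G` on the segment from `x₀` to `x`. -/
def meanDeriv (G : U → ℝ) (x₀ x : U) : U →L[ℝ] ℝ :=
  ∫ t in (0 : ℝ)..1, fderiv ℝ G (x₀ + t • (x - x₀))

/-- The mean is the value at `0` of the convolution of the indicator of `(0, 1]` with a family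
compactly supported in `t`, so smoothness in `x` is that of convolutions with parameters. The sign
of `t` in `g` is the one of the convolution. -/
theorem contDiffOn_meanDeriv {G : U → ℝ} {O s : Set U} {x₀ : U} (hO : IsOpen O) (hs : IsOpen s)
    (hst : ∀ x ∈ s, ∀ t : ℝ, |t| < 2 → x₀ + t • (x - x₀) ∈ O) (hG : ContDiffOn ℝ ∞ G O) :
    ContDiffOn ℝ ∞ (meanDeriv G x₀) s := by
  -- A cutoff in `t`: it is `1` on `[-1, 1]`, where the integral lives, and vanishes from `3 / 2`
  -- on, inside the range `|t| < 2` where the integrand is smooth.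
  let β : ContDiffBump (0 : ℝ) := ⟨1, 3 / 2, by norm_num, by norm_num⟩
  let g : U → ℝ → (U →L[ℝ] ℝ) := fun x t => β t • fderiv ℝ G (x₀ + (-t) • (x - x₀))
  have hD : ContDiffOn ℝ ∞ (fderiv ℝ G) O := hG.fderiv_of_isOpen hO (by simp)
  have hg : ContDiffOn ℝ ∞ (Function.uncurry g) (s ×ˢ univ) := by
    rintro ⟨x, t⟩ ⟨hx, -⟩
    refine ContDiffAt.contDiffWithinAt ?_
    by_cases ht : |t| < 2
    · have h1 : ContDiffAt ℝ ∞ (fun y : U × ℝ => x₀ + (-y.2) • (y.1 - x₀)) (x, t) := by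
        fun_prop
      have h2 : ContDiffAt ℝ ∞ (fderiv ℝ G) (x₀ + (-t) • (x - x₀)) :=
        hD.contDiffAt (hO.mem_nhds (hst x hx (-t) (by rwa [abs_neg])))
      have h3 : ContDiffAt ℝ ∞ (fun y : U × ℝ => β y.2) (x, t) :=
        β.contDiff.contDiffAt.comp _ contDiffAt_snd
      exact h3.smul (h2.comp (x, t) h1)
    · have h1 : ∀ᶠ y : U × ℝ in nhds (x, t), Function.uncurry g y = 0 := by
        have h2 : {y : U × ℝ | 3 / 2 < |y.2|} ∈ nhds (x, t) := by
          refine (isOpen_lt continuous_const continuous_snd.abs).mem_nhds ?_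
          have : (2 : ℝ) ≤ |t| := not_lt.1 ht
          show (3 / 2 : ℝ) < |t|
          linarith
        filter_upwards [h2] with y hy
        have h3 : β y.2 = 0 := β.zero_of_le_dist (by simpa using (le_of_lt hy))
        simp [Function.uncurry, g, h3]
      exact contDiffAt_const.congr_of_eventuallyEq h1
  have hgs : ∀ p, ∀ x, p ∈ s → x ∉ Metric.closedBall (0 : ℝ) (3 / 2) → g p x = 0 := by
    intro p x _ hx
    have h3 : β x = 0 := β.zero_of_le_dist (by
      simp only [Metric.mem_closedBall, not_le] at hx
      exact hx.le)
    simp [g, h3]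
  have hf : LocallyIntegrable (Set.indicator (Ioc (0 : ℝ) 1) (fun _ => (1 : ℝ))) volume :=
    (locallyIntegrable_const (1 : ℝ)).indicator measurableSet_Ioc
  have h := contDiffOn_convolution_right_with_param_comp (n := ⊤) (𝕜 := ℝ) (μ := volume)
    (ContinuousLinearMap.lsmul ℝ ℝ : ℝ →L[ℝ] (U →L[ℝ] ℝ) →L[ℝ] (U →L[ℝ] ℝ)) (v := fun _ => 0)
    contDiffOn_const hs (isCompact_closedBall (0 : ℝ) (3 / 2)) hgs hf hg
  refine h.congr fun x hx => ?_
  rw [meanDeriv, intervalIntegral.integral_of_le zero_le_one,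
    ← integral_indicator measurableSet_Ioc, convolution_def]
  congr 1
  funext t
  by_cases ht : t ∈ Ioc (0 : ℝ) 1
  · have h4 : β (-t) = 1 := β.one_of_mem_closedBall (by
      simp only [Metric.mem_closedBall, dist_zero_right, norm_neg, Real.norm_eq_abs]
      rw [abs_of_pos ht.1]
      exact ht.2)
    simp [ht, g, h4]
  · simp [ht]

theorem meanDeriv_apply_sub {G : U → ℝ} {O s : Set U} {x₀ : U} (hO : IsOpen O)
    (hst : ∀ x ∈ s, ∀ t : ℝ, |t| < 2 → x₀ + t • (x - x₀) ∈ O) (hG : ContDiffOn ℝ ∞ G O) {x : U}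
    (hx : x ∈ s) : G x = G x₀ + meanDeriv G x₀ x (x - x₀) := by
  have hD : ContDiffOn ℝ ∞ (fderiv ℝ G) O := hG.fderiv_of_isOpen hO (by simp)
  have hmem : ∀ t ∈ uIcc (0 : ℝ) 1, x₀ + t • (x - x₀) ∈ O := fun t ht => by
    rw [uIcc_of_le zero_le_one] at ht
    exact hst x hx t (by rw [abs_of_nonneg ht.1]; linarith [ht.2])
  have hc : ContinuousOn (fun t : ℝ => fderiv ℝ G (x₀ + t • (x - x₀))) (uIcc 0 1) :=
    hD.continuousOn.comp (by fun_prop) hmem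
  have h1 : ∀ t ∈ uIcc (0 : ℝ) 1, HasDerivAt (fun t : ℝ => G (x₀ + t • (x - x₀)))
      (fderiv ℝ G (x₀ + t • (x - x₀)) (x - x₀)) t := by
    intro t ht
    have h2 : HasFDerivAt G (fderiv ℝ G (x₀ + t • (x - x₀))) (x₀ + t • (x - x₀)) :=
      ((hG.contDiffAt (hO.mem_nhds (hmem t ht))).differentiableAt (by simp)).hasFDerivAt
    have h3 : HasDerivAt (fun t : ℝ => x₀ + t • (x - x₀)) (x - x₀) t := by
      simpa using ((hasDerivAt_id t).smul_const (x - x₀)).const_add x₀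
    exact h2.comp_hasDerivAt t h3
  have h4 := intervalIntegral.integral_eq_sub_of_hasDerivAt h1
    ((hc.clm_apply continuousOn_const).intervalIntegrable)
  have h5 : meanDeriv G x₀ x (x - x₀) =
      ∫ t in (0 : ℝ)..1, fderiv ℝ G (x₀ + t • (x - x₀)) (x - x₀) := by
    rw [meanDeriv, ContinuousLinearMap.intervalIntegral_apply hc.intervalIntegrable]
  rw [h5, h4]
  simp

end Hadamard

/-! ### Functions and vector fields from charts -/

set_option linter.unusedSectionVars false

section Manifold

open Filter Topology

theorem meanDeriv_self {U : Type*} [NormedAddCommGroup U] [NormedSpace ℝ U] (G : U → ℝ) (x₀ : U) :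
    meanDeriv G x₀ x₀ = fderiv ℝ G x₀ := by
  simp [meanDeriv]

variable {V : Type*} [NormedAddCommGroup V] [NormedSpace ℝ V]
variable {𝓔 : Type*} [TopologicalSpace 𝓔] [ChartedSpace V 𝓔]

theorem SmoothFun.sum_apply {κ : Type*} (s : Finset κ) (f : κ → SmoothFun V 𝓔) (p : 𝓔) :
    (∑ k ∈ s, f k) p = ∑ k ∈ s, f k p := by
  classical
  induction s using Finset.induction_on with
  | empty => simp
  | insert a s ha ih => rw [Finset.sum_insert ha, Finset.sum_insert ha, ← ih]; rfl

theorem SmoothFun.pow_apply (f : SmoothFun V 𝓔) (n : ℕ) (p : 𝓔) : (f ^ n) p = f p ^ n := by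
  induction n with
  | zero => simp
  | succ n ih => rw [pow_succ, pow_succ, ← ih]; rfl

theorem exists_bump [FiniteDimensional ℝ V] [T2Space 𝓔] [IsManifold 𝓘(ℝ, V) ∞ 𝓔] {p : 𝓔}
    {U : Set 𝓔} (hU : U ∈ 𝓝 p) :
    ∃ χ : SmoothFun V 𝓔, (∀ᶠ x in 𝓝 p, χ x = 1) ∧ tsupport χ ⊆ U := by
  obtain ⟨f, -, hf⟩ := (SmoothBumpFunction.nhds_basis_tsupport (I := 𝓘(ℝ, V)) p).mem_iff.1 hU
  exact ⟨⟨f, f.contMDiff⟩, f.eventuallyEq_one, hf⟩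

theorem tsupport_mul_subset {f g : 𝓔 → ℝ} : tsupport (fun p => f p * g p) ⊆ tsupport f :=
  closure_mono fun p hp hf => hp (by simp [hf])

variable [IsManifold 𝓘(ℝ, V) ∞ 𝓔]

/-- The product of a cutoff function with a function of the coordinates. -/
def chartMul (χ : SmoothFun V 𝓔) {φ : OpenPartialHomeomorph 𝓔 V}
    (hφ : φ ∈ IsManifold.maximalAtlas 𝓘(ℝ, V) ∞ 𝓔) (hχ : tsupport χ ⊆ φ.source) (f : V → ℝ)
    (hf : ∀ p ∈ tsupport χ, ContDiffAt ℝ ∞ f (φ p)) : SmoothFun V 𝓔 :=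
  ⟨fun p => χ p * f (φ p), contMDiff_of_tsupport fun p hp => by
    have hp' : p ∈ tsupport χ := tsupport_mul_subset hp
    exact (χ.contMDiff p).mul
      ((hf p hp').contMDiffAt.comp p (contMDiffAt_of_mem_maximalAtlas hφ (hχ hp')))⟩

theorem chartMul_apply (χ : SmoothFun V 𝓔) {φ : OpenPartialHomeomorph 𝓔 V}
    (hφ : φ ∈ IsManifold.maximalAtlas 𝓘(ℝ, V) ∞ 𝓔) (hχ : tsupport χ ⊆ φ.source) (f : V → ℝ)
    (hf : ∀ p ∈ tsupport χ, ContDiffAt ℝ ∞ f (φ p)) (p : 𝓔) :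
    chartMul χ hφ hχ f hf p = χ p * f (φ p) := rfl

theorem contDiffAt_chart (F : SmoothFun V 𝓔) {φ : OpenPartialHomeomorph 𝓔 V}
    (hφ : φ ∈ IsManifold.maximalAtlas 𝓘(ℝ, V) ∞ 𝓔) {x : V} (hx : x ∈ φ.target) :
    ContDiffAt ℝ ∞ (F ∘ φ.symm) x :=
  (contDiffOn_chart F hφ).contDiffAt (φ.open_target.mem_nhds hx)

/-- The vector field `θ ∂_a` of a chart. -/
def chartDeriv (θ : SmoothFun V 𝓔) {φ : OpenPartialHomeomorph 𝓔 V}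
    (hφ : φ ∈ IsManifold.maximalAtlas 𝓘(ℝ, V) ∞ 𝓔) (hθ : tsupport θ ⊆ φ.source) (a : V) :
    Derivation ℝ (SmoothFun V 𝓔) (SmoothFun V 𝓔) :=
  Derivation.mk'
    { toFun := fun F => chartMul θ hφ hθ (fun x => fderiv ℝ (F ∘ φ.symm) x a) (fun p hp =>
        ((contDiffAt_chart F hφ (φ.map_source (hθ hp))).fderiv_right (m := ∞) (by simp)).clm_apply
          contDiffAt_const)
      map_add' := fun F G => by
        ext p
        by_cases hp : p ∈ φ.source
        · have hF := (contDiffAt_chart F hφ (φ.map_source hp)).differentiableAt (by simp)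
          have hG := (contDiffAt_chart G hφ (φ.map_source hp)).differentiableAt (by simp)
          have e : ((F : 𝓔 → ℝ) + (G : 𝓔 → ℝ)) ∘ φ.symm = F ∘ φ.symm + G ∘ φ.symm := rfl
          simp only [chartMul_apply, e, fderiv_add hF hG, ContMDiffMap.coe_add, Pi.add_apply,
            _root_.add_apply, mul_add]
        · have h0 : θ p = 0 := image_eq_zero_of_notMem_tsupport fun h => hp (hθ h)
          simp [chartMul_apply, h0]
      map_smul' := fun c F => by
        ext p
        by_cases hp : p ∈ φ.source
        · have hF := (contDiffAt_chart F hφ (φ.map_source hp)).differentiableAt (by simp)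
          have e : (c • (F : 𝓔 → ℝ)) ∘ φ.symm = c • (F ∘ φ.symm) := rfl
          simp only [chartMul_apply, e, fderiv_const_smul hF, ContMDiffMap.coe_smul, Pi.smul_apply,
            _root_.smul_apply, smul_eq_mul, RingHom.id_apply]
          ring
        · have h0 : θ p = 0 := image_eq_zero_of_notMem_tsupport fun h => hp (hθ h)
          simp [chartMul_apply, h0] }
    (fun F G => by
      ext p
      by_cases hp : p ∈ φ.source
      · have hF := (contDiffAt_chart F hφ (φ.map_source hp)).differentiableAt (by simp)
        have hG := (contDiffAt_chart G hφ (φ.map_source hp)).differentiableAt (by simp)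
        have e : ((F : 𝓔 → ℝ) * (G : 𝓔 → ℝ)) ∘ φ.symm = (F ∘ φ.symm) * (G ∘ φ.symm) := rfl
        simp only [LinearMap.coe_mk, AddHom.coe_mk, chartMul_apply, e, fderiv_mul hF hG,
          ContMDiffMap.coe_add, Pi.add_apply, smul_eq_mul, ContMDiffMap.coe_mul, Pi.mul_apply,
          _root_.add_apply, _root_.smul_apply, Function.comp_apply,
          φ.left_inv hp]
        ring
      · have h0 : θ p = 0 := image_eq_zero_of_notMem_tsupport fun h => hp (hθ h)
        simp [chartMul_apply, h0])

theorem chartDeriv_apply (θ : SmoothFun V 𝓔) {φ : OpenPartialHomeomorph 𝓔 V}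
    (hφ : φ ∈ IsManifold.maximalAtlas 𝓘(ℝ, V) ∞ 𝓔) (hθ : tsupport θ ⊆ φ.source) (a : V)
    (F : SmoothFun V 𝓔) (p : 𝓔) :
    chartDeriv θ hφ hθ a F p = θ p * fderiv ℝ (F ∘ φ.symm) (φ p) a := rfl

/-- A function which is cut off and linear in the coordinates. -/
def chartCoord (θ : SmoothFun V 𝓔) {φ : OpenPartialHomeomorph 𝓔 V}
    (hφ : φ ∈ IsManifold.maximalAtlas 𝓘(ℝ, V) ∞ 𝓔) (hθ : tsupport θ ⊆ φ.source) (l : V →L[ℝ] ℝ) :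
    SmoothFun V 𝓔 :=
  chartMul θ hφ hθ l (fun _ _ => l.contDiff.contDiffAt)

variable [FiniteDimensional ℝ V] [T2Space 𝓔]

/-- Hadamard's lemma on a manifold. -/
theorem exists_hadamard {ι : Type*} [Fintype ι] (b : Module.Basis ι ℝ V) {θ : SmoothFun V 𝓔}
    {φ : OpenPartialHomeomorph 𝓔 V} (hφ : φ ∈ IsManifold.maximalAtlas 𝓘(ℝ, V) ∞ 𝓔)
    (hθ : tsupport θ ⊆ φ.source) {c : 𝓔} (hc : c ∈ φ.source) (hc1 : ∀ᶠ x in 𝓝 c, θ x = 1)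
    (F : SmoothFun V 𝓔) :
    ∃ (χ : SmoothFun V 𝓔) (h : ι → SmoothFun V 𝓔), χ c = 1 ∧
      (∀ i, h i c = fderiv ℝ (F ∘ φ.symm) (φ c) (b i)) ∧
      χ * (F - algebraMap ℝ _ (F c)) =
        ∑ i, (chartCoord θ hφ hθ (b.coord i).toContinuousLinearMap -
          algebraMap ℝ _ (b.coord i (φ c))) * h i := by
  obtain ⟨r, hr, hball⟩ := Metric.isOpen_iff.1 φ.open_target (φ c) (φ.map_source hc)
  have hO : IsOpen (Metric.ball (φ c) r) := Metric.isOpen_ball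
  -- Half the radius compensates for the range `|t| < 2` required by `contDiffOn_meanDeriv`.
  have hst : ∀ x ∈ Metric.ball (φ c) (r / 2), ∀ t : ℝ, |t| < 2 →
      φ c + t • (x - φ c) ∈ Metric.ball (φ c) r := by
    intro x hx t ht
    rw [Metric.mem_ball, dist_eq_norm] at hx ⊢
    rw [add_sub_cancel_left, norm_smul, Real.norm_eq_abs]
    nlinarith [abs_nonneg t, norm_nonneg (x - φ c)]
  have hG : ContDiffOn ℝ ∞ (F ∘ φ.symm) (Metric.ball (φ c) r) := (contDiffOn_chart F hφ).mono hball
  have hU : {x | θ x = 1} ∩ (φ.source ∩ φ ⁻¹' Metric.ball (φ c) (r / 2)) ∈ 𝓝 c :=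
    inter_mem hc1 ((φ.isOpen_inter_preimage Metric.isOpen_ball).mem_nhds
      ⟨hc, Metric.mem_ball_self (by positivity)⟩)
  obtain ⟨χ, hχ1, hχ⟩ := exists_bump (V := V) hU
  have hmean := contDiffOn_meanDeriv hO Metric.isOpen_ball hst hG
  refine ⟨χ, fun i => chartMul χ hφ (fun p hp => (hχ hp).2.1)
    (fun x => meanDeriv (F ∘ φ.symm) (φ c) x (b i)) (fun p hp =>
      (hmean.contDiffAt (Metric.isOpen_ball.mem_nhds (hχ hp).2.2)).clm_apply contDiffAt_const),
    hχ1.self_of_nhds, fun i => ?_, ?_⟩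
  · change χ c * meanDeriv (F ∘ φ.symm) (φ c) (φ c) (b i) = _
    rw [hχ1.self_of_nhds, meanDeriv_self, one_mul]
  · ext p
    rw [SmoothFun.sum_apply]
    change χ p * (F p - F c) = ∑ i, (θ p * b.coord i (φ p) - b.coord i (φ c)) *
      (χ p * meanDeriv (F ∘ φ.symm) (φ c) (φ p) (b i))
    by_cases hp : χ p = 0
    · simp [hp]
    · obtain ⟨h1, h2, h3⟩ := hχ (subset_tsupport _ hp)
      have h1 : θ p = 1 := h1
      have h4 := meanDeriv_apply_sub hO hst hG h3
      simp only [Function.comp_apply, φ.left_inv h2, φ.left_inv hc] at h4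
      have h5 : φ p - φ c = ∑ i, b.coord i (φ p - φ c) • b i := by
        simp only [Module.Basis.coord_apply, b.sum_repr]
      rw [h4, add_sub_cancel_left]
      conv_lhs => rw [h5, map_sum]
      rw [Finset.mul_sum]
      refine Finset.sum_congr rfl fun i _ => ?_
      rw [map_smul, map_sub, h1, smul_eq_mul]
      ring

/-- Apply `X` to Hadamard's identity centred at `c` and evaluate at `c`: the factors vanishing at
`c` kill the derivatives of `χ` and of the `h i`, leaving the coordinate expansion of `X F`. The
function `ψ` is supported where `θ` is locally `1`, so that the cut-off coordinates are true
coordinates there. -/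
theorem exists_isFrame {ι : Type*} [Fintype ι] (b : Module.Basis ι ℝ V)
    {φ : OpenPartialHomeomorph 𝓔 V} (hφ : φ ∈ IsManifold.maximalAtlas 𝓘(ℝ, V) ∞ 𝓔) {p : 𝓔}
    (hp : p ∈ φ.source) :
    ∃ (θ ψ : SmoothFun V 𝓔) (hθ : tsupport θ ⊆ φ.source), (∀ᶠ x in 𝓝 p, θ x = 1) ∧ ψ p ≠ 0 ∧
      IsFrame ψ (fun i => chartCoord θ hφ hθ (b.coord i).toContinuousLinearMap)
        (fun i => chartDeriv θ hφ hθ (b i)) := by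
  obtain ⟨θ, hθ1, hθ⟩ := exists_bump (V := V) (φ.open_source.mem_nhds hp)
  have hU : {c | ∀ᶠ x in 𝓝 c, θ x = 1} ∈ 𝓝 p := hθ1.eventually_nhds
  obtain ⟨ψ, hψ1, hψ⟩ := exists_bump (V := V) hU
  refine ⟨θ, ψ, hθ, hθ1, by rw [hψ1.self_of_nhds]; exact one_ne_zero, fun X F => ?_⟩
  ext c
  rw [SmoothFun.sum_apply]
  change ψ c * X F c = ∑ i, ψ c * (_ * _)
  by_cases hc : ψ c = 0
  · simp [hc]
  have hc1 : ∀ᶠ x in 𝓝 c, θ x = 1 := hψ (subset_tsupport _ hc)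
  have hcs : c ∈ φ.source := hθ (subset_tsupport _ (by
    rw [Function.mem_support, hc1.self_of_nhds]
    exact one_ne_zero))
  obtain ⟨χ, h, hχ, hh, e⟩ := exists_hadamard b hφ hθ hcs hc1 F
  rw [← Finset.mul_sum]
  congr 1
  have h1 := congrArg (fun G => X G c) e
  simp only [map_sum, Derivation.leibniz, map_sub, Derivation.map_algebraMap, sub_zero,
    SmoothFun.sum_apply] at h1
  change χ c * X F c + (F c - F c) * X χ c = ∑ i, ((θ c * b.coord i (φ c) - b.coord i (φ c)) *
    X (h i) c + h i c * _) at h1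
  simp only [hχ, hh, hc1.self_of_nhds, one_mul, sub_self, zero_mul, add_zero, zero_add] at h1
  rw [h1]
  refine Finset.sum_congr rfl fun i _ => ?_
  rw [chartDeriv_apply, hc1.self_of_nhds, one_mul, mul_comm]

/-! ### Glueing operators by partitions of unity -/

section Lift

variable [SecondCountableTopology 𝓔]

/-- Glueing of operators with a smooth partition of unity; the functions `g i` are smooth on the
supports of the partition. -/
def glueOp {κ : Type*} (ρ : SmoothPartitionOfUnity κ 𝓘(ℝ, V) 𝓔) (g : κ → SmoothFun V 𝓔)
    (hg : ∀ i, ∀ x ∈ tsupport (ρ i), g i x ≠ 0) (D : κ → Module.End ℝ (SmoothFun V 𝓔)) :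
    Module.End ℝ (SmoothFun V 𝓔) where
  toFun F := ⟨fun x => ∑ᶠ i, ρ i x • ((g i x)⁻¹ * D i F x),
    ρ.contMDiff_finsum_smul fun i x hx =>
      ((g i).contMDiff x).inv₀ (hg i x hx) |>.mul ((D i F).contMDiff x)⟩
  map_add' F G := by
    ext x
    have hf : ∀ H : SmoothFun V 𝓔,
        (Function.support fun i => ρ i x • ((g i x)⁻¹ * D i H x)).Finite := fun H =>
      (ρ.locallyFinite.point_finite x).subset fun i hi h => hi (by simp [h])
    change ∑ᶠ i, ρ i x • ((g i x)⁻¹ * D i (F + G) x) =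
      (∑ᶠ i, ρ i x • ((g i x)⁻¹ * D i F x)) + ∑ᶠ i, ρ i x • ((g i x)⁻¹ * D i G x)
    rw [← finsum_add_distrib (hf F) (hf G)]
    refine finsum_congr fun i => ?_
    rw [map_add, ContMDiffMap.coe_add, Pi.add_apply, mul_add, smul_add]
  map_smul' c F := by
    ext x
    change ∑ᶠ i, ρ i x • ((g i x)⁻¹ * D i (c • F) x) = c • ∑ᶠ i, ρ i x • ((g i x)⁻¹ * D i F x)
    rw [smul_finsum]
    refine finsum_congr fun i => ?_
    rw [map_smul, ContMDiffMap.coe_smul, Pi.smul_apply]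
    simp only [smul_eq_mul]
    ring

theorem glueOp_apply {κ : Type*} (ρ : SmoothPartitionOfUnity κ 𝓘(ℝ, V) 𝓔)
    (g : κ → SmoothFun V 𝓔) (hg : ∀ i, ∀ x ∈ tsupport (ρ i), g i x ≠ 0)
    (D : κ → Module.End ℝ (SmoothFun V 𝓔)) (F : SmoothFun V 𝓔) (x : 𝓔) :
    glueOp ρ g hg D F x = ∑ᶠ i, ρ i x • ((g i x)⁻¹ * D i F x) := rfl

/-- The weights multiply on the left and functions commute, so commuting with a multiplication
passes to each member of the family. -/
theorem nestedComm_glueOp {κ : Type*} (ρ : SmoothPartitionOfUnity κ 𝓘(ℝ, V) 𝓔)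
    (g : κ → SmoothFun V 𝓔) (hg : ∀ i, ∀ x ∈ tsupport (ρ i), g i x ≠ 0)
    (D : κ → Module.End ℝ (SmoothFun V 𝓔)) {n : ℕ} (f : Fin n → SmoothFun V 𝓔) :
    nestedComm (glueOp ρ g hg D) f = glueOp ρ g hg (fun i => nestedComm (D i) f) := by
  induction n generalizing D with
  | zero => simp [nestedComm_zero']
  | succ n ih =>
    simp only [nestedComm_succ]
    rw [← ih]
    congr 1
    ext F x
    have hf : ∀ H : κ → SmoothFun V 𝓔,
        (Function.support fun i => ρ i x • ((g i x)⁻¹ * H i x)).Finite := fun H =>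
      (ρ.locallyFinite.point_finite x).subset fun i hi h => hi (by simp [h])
    have h1 := smul_finsum (f 0 x) (fun i => ρ i x • ((g i x)⁻¹ * D i F x))
    rw [bracket_mulOp_apply]
    change _ - f 0 x • glueOp ρ g hg D F x = _
    simp only [glueOp_apply]
    rw [h1, ← finsum_sub_distrib (hf fun i => D i (f 0 * F))
      ((hf fun i => D i F).subset fun i hi h => hi (by simp only [h, smul_zero]))]
    refine finsum_congr fun i => ?_
    rw [bracket_mulOp_apply, ContMDiffMap.coe_sub, Pi.sub_apply, ContMDiffMap.coe_mul,
      Pi.mul_apply]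
    simp only [smul_eq_mul]
    ring

/-- Every symmetric multivector on a manifold is the symbol of a differential operator. -/
theorem exists_symbol_eq {q : ℕ} {Q : (Fin q → SmoothFun V 𝓔) → SmoothFun V 𝓔}
    (hQ : IsSymMultivector Q) :
    ∃ D : Module.End ℝ (SmoothFun V 𝓔), DOlt (q + 1) D ∧ ∀ f, symbol q D f = Q f := by
  have hloc : ∀ c : 𝓔, ∃ (ψ : SmoothFun V 𝓔) (D : Module.End ℝ (SmoothFun V 𝓔)), ψ c ≠ 0 ∧
      DOlt (q + 1) D ∧ ∀ f, symbol q D f = ψ * Q f := by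
    intro c
    obtain ⟨θ, ψ, hθ, -, hψ, hfr⟩ := exists_isFrame (Module.finBasis ℝ V)
      (IsManifold.chart_mem_maximalAtlas (I := 𝓘(ℝ, V)) (n := ∞) c) (mem_chart_source V c)
    obtain ⟨N, D, hD, hs⟩ := (isLiftClass_DOlt _).lift hfr (fun _ => Or.inl rfl) hQ
    exact ⟨ψ ^ N, D, by rw [SmoothFun.pow_apply]; exact pow_ne_zero _ hψ, hD, hs⟩
  choose ψ D hψ hD hs using hloc
  have : LocallyCompactSpace 𝓔 := ChartedSpace.locallyCompactSpace V 𝓔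
  have : SigmaCompactSpace 𝓔 := sigmaCompactSpace_of_locallyCompact_secondCountable
  obtain ⟨ρ, hρ⟩ := SmoothPartitionOfUnity.exists_isSubordinate 𝓘(ℝ, V) (isClosed_univ (X := 𝓔))
    (fun c => {x | ψ c x ≠ 0})
    (fun c => isOpen_ne_fun (ψ c).contMDiff.continuous continuous_const)
    (fun x _ => mem_iUnion.2 ⟨x, hψ x⟩)
  have hg : ∀ i, ∀ x ∈ tsupport (ρ i), ψ i x ≠ 0 := fun i x hx => hρ i hx
  refine ⟨glueOp ρ ψ hg D, DOlt_iff.2 fun f => ?_, fun f => ?_⟩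
  · rw [nestedComm_glueOp]
    ext F x
    simp only [glueOp_apply, DOlt_iff.1 (hD _) f]
    change ∑ᶠ i, ρ i x • ((ψ i x)⁻¹ * 0) = (0 : ℝ)
    simp
  · rw [symbol, nestedComm_glueOp]
    ext x
    rw [glueOp_apply]
    -- On the support of `ρ i` the inverse weight cancels the factor `ψ i` of the local symbol.
    have h1 : ∀ i, ρ i x • ((ψ i x)⁻¹ * nestedComm (D i) f 1 x) = ρ i x * Q f x := by
      intro i
      have h2 : nestedComm (D i) f 1 x = ψ i x * Q f x := by
        have := hs i f
        rw [symbol] at this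
        rw [this]
        rfl
      by_cases hx : ρ i x = 0
      · simp [hx]
      · rw [h2, inv_mul_cancel_left₀ (hg i x (subset_tsupport _ hx)), smul_eq_mul]
    rw [finsum_congr h1, ← finsum_mul, ρ.sum_eq_one (mem_univ x), one_mul]

end Lift

end Manifold

/-! ### The commutator of linearizable operators -/

section Linearizable

variable {V : Type*} [NormedAddCommGroup V] [NormedSpace ℝ V]
variable {𝓔 : Type*} [TopologicalSpace 𝓔] [ChartedSpace V 𝓔] {M : Set 𝓔} {q : ℕ}

theorem IsTangent.neg {X : Derivation ℝ (SmoothFun V 𝓔) (SmoothFun V 𝓔)}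
    (hX : IsTangent V M X) : IsTangent V M (-X) := fun F hF => by
  rw [Derivation.neg_apply]
  exact (vanishingIdeal V M).neg_mem (hX F hF)

theorem IsTangent.lie {X Y : Derivation ℝ (SmoothFun V 𝓔) (SmoothFun V 𝓔)}
    (hX : IsTangent V M X) (hY : IsTangent V M Y) : IsTangent V M ⁅X, Y⁆ := fun F hF => by
  rw [Derivation.commutator_apply]
  exact (vanishingIdeal V M).sub_mem (hX _ (hY F hF)) (hY _ (hX F hF))

theorem isLinearizableMultivector_zero :
    IsLinearizableMultivector V M (q + 1) (fun _ => (0 : SmoothFun V 𝓔)) :=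
  ⟨0, Fin.elim0, Fin.elim0, fun a => a.elim0, fun a => a.elim0, fun f => by simp⟩

theorem isLinearizableMultivector_vectorProd
    {X : Derivation ℝ (SmoothFun V 𝓔) (SmoothFun V 𝓔)} (hX : IsTangent V M X)
    {Q : (Fin q → SmoothFun V 𝓔) → SmoothFun V 𝓔} (hQ : IsSymMultivector Q) :
    IsLinearizableMultivector V M (q + 1) (vectorProd X Q) :=
  ⟨1, fun _ => X, fun _ => Q, fun _ => hX, fun _ => hQ, fun f => by simp⟩

theorem IsLinearizableMultivector.add {P P' : (Fin (q + 1) → SmoothFun V 𝓔) → SmoothFun V 𝓔}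
    (hP : IsLinearizableMultivector V M (q + 1) P)
    (hP' : IsLinearizableMultivector V M (q + 1) P') :
    IsLinearizableMultivector V M (q + 1) (fun f => P f + P' f) := by
  obtain ⟨N, X, Q, hX, hQ, h⟩ := hP
  obtain ⟨N', X', Q', hX', hQ', h'⟩ := hP'
  refine ⟨N + N', Fin.append X X', Fin.append Q Q', fun a => ?_, fun a => ?_, fun f => ?_⟩
  · refine Fin.addCases (fun i => ?_) (fun i => ?_) a
    · simpa using hX i
    · simpa using hX' i
  · refine Fin.addCases (fun i => ?_) (fun i => ?_) a
    · simpa using hQ i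
    · simpa using hQ' i
  · simp [Fin.sum_univ_add, h, h']

theorem isLinearizableMultivector_sum {κ : Type*} (s : Finset κ)
    {P : κ → (Fin (q + 1) → SmoothFun V 𝓔) → SmoothFun V 𝓔}
    (hP : ∀ k ∈ s, IsLinearizableMultivector V M (q + 1) (P k)) :
    IsLinearizableMultivector V M (q + 1) (fun f => ∑ k ∈ s, P k f) := by
  classical
  induction s using Finset.induction_on with
  | empty => simpa using isLinearizableMultivector_zero
  | insert a s ha ih =>
    simp only [Finset.sum_insert ha]
    exact (hP a (Finset.mem_insert_self _ _)).add
      (ih fun k hk => hP k (Finset.mem_insert_of_mem hk))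

/-- The symbol of a linearizable operator preserves the vanishing ideal. -/
theorem IsLinearizableMultivector.apply_mem {P : (Fin q → SmoothFun V 𝓔) → SmoothFun V 𝓔}
    (hP : IsLinearizableMultivector V M q P) (f : Fin q → SmoothFun V 𝓔)
    (hf : ∀ i, f i ∈ vanishingIdeal V M) : P f ∈ vanishingIdeal V M := by
  cases q with
  | zero =>
    rw [Subsingleton.elim f Fin.elim0]
    exact hP
  | succ q =>
    obtain ⟨N, X, Q, hX, -, h⟩ := hP
    rw [h]
    refine Ideal.sum_mem _ fun a _ => Ideal.sum_mem _ fun j _ => ?_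
    exact Ideal.mul_mem_right _ _ (hX a _ (hf j))

/-- In the expansion `lie_derivation_comp` every term is `X`, `X'` or `⁅X, X'⁆`, all tangent,
composed with an operator of order at most `q + q'`; its symbol is therefore a symmetric product
with a tangent field. -/
theorem symbol_lie_derivation_comp {X X' : Derivation ℝ (SmoothFun V 𝓔) (SmoothFun V 𝓔)}
    (hX : IsTangent V M X) (hX' : IsTangent V M X') {q' : ℕ}
    {D D' : Module.End ℝ (SmoothFun V 𝓔)} (hD : DOlt (q + 1) D) (hD' : DOlt (q' + 1) D') :
    IsLinearizableMultivector V M (q + q' + 1) (symbol (q + q' + 1)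
      ⁅(X : Module.End ℝ (SmoothFun V 𝓔)) * D, (X' : Module.End ℝ (SmoothFun V 𝓔)) * D'⁆) := by
  have o1 : DOlt (q + q' + 1) (⁅D, (X' : Module.End ℝ (SmoothFun V 𝓔))⁆ * D') :=
    ((hD.lie (DOlt_two_derivation X')).comp hD').mono (by omega)
  have o2 : DOlt (q + q' + 1) (⁅D', (X : Module.End ℝ (SmoothFun V 𝓔))⁆ * D) :=
    ((hD'.lie (DOlt_two_derivation X)).comp hD).mono (by omega)
  have o3 : DOlt (q + q' + 1) (D * D') := (hD.comp hD').mono (by omega)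
  have o4 : DOlt (q + q' + 1) ((X : Module.End ℝ (SmoothFun V 𝓔)) * ⁅D, D'⁆) :=
    ((DOlt_two_derivation X).comp (hD.lie hD')).mono (by omega)
  have h := (((isLinearizableMultivector_vectorProd hX (isSymMultivector_symbol o1)).add
    (isLinearizableMultivector_vectorProd hX'.neg (isSymMultivector_symbol o2))).add
    (isLinearizableMultivector_vectorProd (hX.lie hX') (isSymMultivector_symbol o3))).add
    (isLinearizableMultivector_vectorProd hX' (isSymMultivector_symbol o4))
  convert h using 2 with f
  have e : ⁅(X : Module.End ℝ (SmoothFun V 𝓔)), (X' : Module.End ℝ (SmoothFun V 𝓔))⁆ =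
      (⁅X, X'⁆ : Derivation ℝ (SmoothFun V 𝓔) (SmoothFun V 𝓔)) :=
    (Derivation.commutator_coe_linear_map).symm
  have e2 : vectorProd (-X') (symbol (q + q') (⁅D', (X : Module.End ℝ (SmoothFun V 𝓔))⁆ * D)) f =
      -vectorProd X' (symbol (q + q') (⁅D', (X : Module.End ℝ (SmoothFun V 𝓔))⁆ * D)) f := by
    simp [vectorProd]
  rw [lie_derivation_comp, e2, e, symbol_add, symbol_add, symbol_sub, symbol_derivation_comp _ o1,
    symbol_derivation_comp _ o2, symbol_derivation_comp _ o3, symbol_derivation_comp _ o4,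
    sub_eq_add_neg]

variable [FiniteDimensional ℝ V] [T2Space 𝓔] [SecondCountableTopology 𝓔]
  [IsManifold 𝓘(ℝ, V) ∞ 𝓔]

/-- A linearizable operator of positive order is a sum of compositions of operators with tangent
vector fields on the left, up to lower order terms. -/
theorem IsLinearizable.exists_decomposition {Δ : Module.End ℝ (SmoothFun V 𝓔)}
    (h : IsLinearizable V M (q + 1) Δ) :
    ∃ (N : ℕ) (X : Fin N → Derivation ℝ (SmoothFun V 𝓔) (SmoothFun V 𝓔))
      (D : Fin N → Module.End ℝ (SmoothFun V 𝓔)) (R : Module.End ℝ (SmoothFun V 𝓔)),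
      (∀ a, IsTangent V M (X a)) ∧ (∀ a, DOlt (q + 1) (D a)) ∧ DOlt (q + 1) R ∧
        Δ = (∑ a, (X a : Module.End ℝ (SmoothFun V 𝓔)) * D a) + R := by
  obtain ⟨h1, N, X, Q, hX, hQ, hP⟩ := h
  choose D hD hs using fun a => exists_symbol_eq (hQ a)
  refine ⟨N, X, D, Δ - ∑ a, (X a : Module.End ℝ (SmoothFun V 𝓔)) * D a, hX, hD, ?_,
    (add_sub_cancel _ _).symm⟩
  refine DOlt.of_symbol_eq_zero ((isDO_iff.1 h1).sub (DOlt.sum fun a _ =>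
    ((DOlt_two_derivation (X a)).comp (hD a)).mono (by omega))) fun f => ?_
  rw [symbol_sub, symbol_sum, hP, sub_eq_zero]
  refine Finset.sum_congr rfl fun a _ => ?_
  rw [symbol_derivation_comp _ (hD a)]
  simp only [vectorProd, hs]

/-- The remainders of the two decompositions contribute commutators of order at most `q + q'`,
invisible in the symbol; the other terms are covered by `symbol_lie_derivation_comp`. -/
theorem IsLinearizable.lie {q' : ℕ} {Δ Δ' : Module.End ℝ (SmoothFun V 𝓔)}
    (h : IsLinearizable V M (q + 1) Δ) (h' : IsLinearizable V M (q' + 1) Δ') :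
    IsLinearizable V M (q + q' + 1) ⁅Δ, Δ'⁆ := by
  have hO : DOlt (q + q' + 1 + 1) ⁅Δ, Δ'⁆ :=
    ((isDO_iff.1 h.1).lie (isDO_iff.1 h'.1)).mono (by omega)
  refine ⟨isDO_iff.2 hO, ?_⟩
  obtain ⟨N, X, D, R, hX, hD, hR, e⟩ := h.exists_decomposition
  obtain ⟨N', X', D', R', hX', hD', hR', e'⟩ := h'.exists_decomposition
  have h1 : DOlt (q + q' + 1) ⁅∑ a, (X a : Module.End ℝ (SmoothFun V 𝓔)) * D a, R'⁆ :=
    ((DOlt.sum fun a _ => (((DOlt_two_derivation (X a)).comp (hD a)).mono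
      (n := q + 2) (by omega))).lie hR').mono (by omega)
  have h2 : DOlt (q + q' + 1) ⁅R, Δ'⁆ := (hR.lie (isDO_iff.1 h'.1)).mono (by omega)
  have key : ⁅Δ, Δ'⁆ = (∑ a, ∑ b, ⁅(X a : Module.End ℝ (SmoothFun V 𝓔)) * D a,
      (X' b : Module.End ℝ (SmoothFun V 𝓔)) * D' b⁆) +
      (⁅∑ a, (X a : Module.End ℝ (SmoothFun V 𝓔)) * D a, R'⁆ + ⁅R, Δ'⁆) := by
    conv_lhs => rw [e]
    rw [e']
    simp only [Ring.lie_def, Finset.sum_sub_distrib]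
    rw [Finset.sum_comm (f := fun a b => (X' b : Module.End ℝ (SmoothFun V 𝓔)) * D' b *
      ((X a : Module.End ℝ (SmoothFun V 𝓔)) * D a))]
    simp only [← Finset.mul_sum, ← Finset.sum_mul, add_mul, mul_add]
    abel
  have h3 : IsLinearizableMultivector V M (q + q' + 1) (fun f =>
      ∑ a, ∑ b, symbol (q + q' + 1) ⁅(X a : Module.End ℝ (SmoothFun V 𝓔)) * D a,
        (X' b : Module.End ℝ (SmoothFun V 𝓔)) * D' b⁆ f) :=
    isLinearizableMultivector_sum _ fun a _ => isLinearizableMultivector_sum _ fun b _ =>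
      symbol_lie_derivation_comp (hX a) (hX' b) (hD a) (hD' b)
  convert h3 using 2 with f
  rw [key, symbol_add, (h1.add h2).symbol_eq_zero, add_zero, symbol_sum]
  exact Finset.sum_congr rfl fun a _ => symbol_sum _ _ _

end Linearizable

/-! ### Coordinates on the normal bundle -/

section NormalBundleCharts

open Filter Topology

set_option linter.unusedSectionVars false

variable {V : Type*} [NormedAddCommGroup V] [NormedSpace ℝ V]
variable {𝓔 : Type*} [TopologicalSpace 𝓔] [ChartedSpace V 𝓔] {M : Set 𝓔}

/-- The class in the normal bundle of a tangent vector. -/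
def normalMk (p : M) (w : V) : NormalBundle V M :=
  ⟨p, Submodule.Quotient.mk (p := tangentTo V M (p : 𝓔)) w⟩

theorem exists_normalMk (e : NormalBundle V M) : ∃ w : V, e = normalMk e.1 w := by
  obtain ⟨p, u⟩ := e
  obtain ⟨w, rfl⟩ := Submodule.Quotient.mk_surjective _ u
  exact ⟨w, rfl⟩

theorem normalMk_eq {p p' : M} (h : p = p') {w w' : V}
    (hw : w - w' ∈ tangentTo V M (p : 𝓔)) : normalMk p w = normalMk p' w' := by
  subst h
  exact congrArg (Sigma.mk p) ((Submodule.Quotient.eq _).2 hw)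

variable (V M) in
/-- An adapted chart, with a projection of the model space whose kernel is the model of `M`. -/
structure NormalChart where
  /-- the model of the submanifold -/
  S : Submodule ℝ V
  /-- the chart -/
  φ : OpenPartialHomeomorph 𝓔 V
  adapted : IsAdaptedChart V M S φ
  /-- the projection with kernel `S` -/
  P : V →L[ℝ] V
  P_eq_zero : ∀ v ∈ S, P v = 0
  sub_mem : ∀ v, v - P v ∈ S

theorem exists_normalChart [FiniteDimensional ℝ V] {m : ℕ} (hM : IsSubmanifold V m M) {p : 𝓔}
    (hp : p ∈ M) : ∃ c : NormalChart V M, p ∈ c.φ.source ∧ Module.finrank ℝ c.S = m := by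
  obtain ⟨S, φ, hS, hφ, hpφ⟩ := hM p hp
  obtain ⟨W, hW⟩ := S.exists_isCompl
  refine ⟨⟨S, φ, hφ, (W.projection S hW.symm).toContinuousLinearMap, fun v hv => ?_,
    fun v => ?_⟩, hpφ, hS⟩
  · have := (Submodule.projection_apply_eq_zero_iff hW.symm (x := v)).2 hv
    exact this
  · change v - W.projection S hW.symm v ∈ S
    exact Submodule.sub_projection_mem hW.symm v

namespace NormalChart

variable (c : NormalChart V M)

/-- The differential of the chart. -/
def diff (p : 𝓔) : V →L[ℝ] V := mfderiv 𝓘(ℝ, V) 𝓘(ℝ, V) c.φ p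

/-- The differential of the inverse chart. -/
def symmDiff (x : V) : V →L[ℝ] V := mfderiv 𝓘(ℝ, V) 𝓘(ℝ, V) c.φ.symm x

/-- The base point of the coordinates `x`, on the submanifold. -/
def base (x : V) : V := x - c.P x

/-- The set of coordinates. -/
def dom : Set (V × V) := {y | c.base y.1 ∈ c.φ.target}

theorem contDiff_base : ContDiff ℝ ∞ c.base := contDiff_id.sub c.P.contDiff

theorem isOpen_dom : IsOpen c.dom :=
  c.φ.open_target.preimage (c.contDiff_base.continuous.comp continuous_fst)

theorem base_mem (x : V) : c.base x ∈ c.S := c.sub_mem x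

theorem base_of_mem {x : V} (hx : x ∈ c.S) : c.base x = x := by
  rw [base, c.P_eq_zero x hx, sub_zero]

theorem P_P (v : V) : c.P (c.P v) = c.P v := by
  have h := c.P_eq_zero _ (c.sub_mem v)
  rw [map_sub, sub_eq_zero] at h
  exact h.symm

theorem chart_mem {p : 𝓔} (hp : p ∈ M) (hps : p ∈ c.φ.source) : c.φ p ∈ c.S :=
  (c.adapted.2 p hps).1 hp

theorem symm_mem {x : V} (hx : x ∈ c.φ.target) (hxS : x ∈ c.S) : c.φ.symm x ∈ M :=
  (c.adapted.2 _ (c.φ.map_target hx)).2 (by rwa [c.φ.right_inv hx])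

theorem base_chart {p : 𝓔} (hp : p ∈ M) (hps : p ∈ c.φ.source) : c.base (c.φ p) = c.φ p :=
  c.base_of_mem (c.chart_mem hp hps)

theorem mem_dom {p : 𝓔} (hp : p ∈ M) (hps : p ∈ c.φ.source) (v : V) : (c.φ p, v) ∈ c.dom := by
  change c.base (c.φ p) ∈ c.φ.target
  rw [c.base_chart hp hps]
  exact c.φ.map_source hps

variable [IsManifold 𝓘(ℝ, V) ∞ 𝓔]

theorem mdifferentiable : c.φ.MDifferentiable 𝓘(ℝ, V) 𝓘(ℝ, V) :=
  ⟨(contMDiffOn_of_mem_maximalAtlas c.adapted.1).mdifferentiableOn (by simp),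
    (contMDiffOn_symm_of_mem_maximalAtlas c.adapted.1).mdifferentiableOn (by simp)⟩

theorem diff_symmDiff {x : V} (hx : x ∈ c.φ.target) (v : V) :
    c.diff (c.φ.symm x) (c.symmDiff x v) = v := by
  have h := c.mdifferentiable.comp_symm_deriv hx
  exact congrArg (fun L : V →L[ℝ] V => L v) h

theorem mfderiv_apply (F : SmoothFun V 𝓔) {p : 𝓔} (hp : p ∈ c.φ.source) (w : V) :
    (mfderiv 𝓘(ℝ, V) 𝓘(ℝ, ℝ) F p : V →L[ℝ] ℝ) w =
      fderiv ℝ (F ∘ c.φ.symm) (c.φ p) (c.diff p w) :=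
  mfderiv_eq_fderiv_chart F c.adapted.1 hp w

/-- Functions vanishing on the submanifold have no derivative along it. -/
theorem fderiv_eq_zero {F : SmoothFun V 𝓔} (hF : F ∈ vanishingIdeal V M) {x : V}
    (hx : x ∈ c.φ.target) (hxS : x ∈ c.S) {a : V} (ha : a ∈ c.S) :
    fderiv ℝ (F ∘ c.φ.symm) x a = 0 := by
  have h1 : HasFDerivAt (F ∘ c.φ.symm) (fderiv ℝ (F ∘ c.φ.symm) x) (x + (0 : ℝ) • a) := by
    rw [zero_smul, add_zero]
    exact ((contDiffAt_chart F c.adapted.1 hx).differentiableAt (by simp)).hasFDerivAt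
  have h2 : HasDerivAt (fun t : ℝ => x + t • a) a 0 := by
    simpa using ((hasDerivAt_id (0 : ℝ)).smul_const a).const_add x
  have h3 := h1.comp_hasDerivAt (0 : ℝ) h2
  have h4 : (F ∘ c.φ.symm) ∘ (fun t : ℝ => x + t • a) =ᶠ[𝓝 0] fun _ => (0 : ℝ) := by
    have : ∀ᶠ t : ℝ in 𝓝 0, x + t • a ∈ c.φ.target := by
      refine h2.continuousAt.eventually_mem ?_
      rw [zero_smul, add_zero]
      exact c.φ.open_target.mem_nhds hx
    filter_upwards [this] with t ht
    exact hF _ (c.symm_mem ht (c.S.add_mem hxS (c.S.smul_mem t ha)))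
  exact h3.unique ((hasDerivAt_const (0 : ℝ) (0 : ℝ)).congr_of_eventuallyEq h4)

variable [FiniteDimensional ℝ V] [T2Space 𝓔]

theorem chartCoord_mem {θ : SmoothFun V 𝓔} (hθ : tsupport θ ⊆ c.φ.source) {l : V →L[ℝ] ℝ}
    (hl : ∀ v ∈ c.S, l v = 0) : chartCoord θ c.adapted.1 hθ l ∈ vanishingIdeal V M := by
  intro p hp
  change θ p * l (c.φ p) = 0
  by_cases hps : p ∈ c.φ.source
  · rw [hl _ (c.chart_mem hp hps), mul_zero]
  · rw [image_eq_zero_of_notMem_tsupport fun h => hps (hθ h), zero_mul]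

theorem fderiv_chartCoord {θ : SmoothFun V 𝓔} (hθ : tsupport θ ⊆ c.φ.source) (l : V →L[ℝ] ℝ)
    {p : 𝓔} (hp : p ∈ c.φ.source) (h1 : ∀ᶠ x in 𝓝 p, θ x = 1) :
    fderiv ℝ (chartCoord θ c.adapted.1 hθ l ∘ c.φ.symm) (c.φ p) = l := by
  have h : chartCoord θ c.adapted.1 hθ l ∘ c.φ.symm =ᶠ[𝓝 (c.φ p)] l := by
    have h2 : Tendsto c.φ.symm (𝓝 (c.φ p)) (𝓝 p) := by
      have := c.φ.continuousAt_symm (c.φ.map_source hp)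
      rwa [ContinuousAt, c.φ.left_inv hp] at this
    filter_upwards [h2.eventually h1, c.φ.open_target.mem_nhds (c.φ.map_source hp)] with x hx hxt
    change θ (c.φ.symm x) * l (c.φ (c.φ.symm x)) = l x
    rw [hx, c.φ.right_inv hxt, one_mul]
  rw [h.fderiv_eq]
  exact l.fderiv

/-- Cut-off linear forms killing `S` vanish on `M` and detect everything outside `S`; conversely,
functions vanishing on `M` have no derivative along `S`. -/
theorem mem_tangentTo_iff {p : 𝓔} (hp : p ∈ M) (hps : p ∈ c.φ.source) (w : V) :
    w ∈ tangentTo V M p ↔ c.diff p w ∈ c.S := by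
  constructor
  · intro hw
    obtain ⟨θ, hθ1, hθ⟩ := exists_bump (V := V) (c.φ.open_source.mem_nhds hps)
    have h0 : c.P (c.diff p w) = 0 := by
      refine (Module.forall_dual_apply_eq_zero_iff ℝ _).1 fun l => ?_
      let l' : V →L[ℝ] ℝ := l.toContinuousLinearMap ∘L c.P
      have hl' : ∀ v ∈ c.S, l' v = 0 := fun v hv => by
        simp [l', c.P_eq_zero v hv]
      have h1 := hw _ (c.chartCoord_mem hθ hl')
      have h2 := c.mfderiv_apply (chartCoord θ c.adapted.1 hθ l') hps w
      rw [c.fderiv_chartCoord hθ l' hps hθ1] at h2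
      exact h2.symm.trans h1
    have h3 := c.sub_mem (c.diff p w)
    rwa [h0, sub_zero] at h3
  · intro hw F hF
    exact (c.mfderiv_apply F hps w).trans
      (c.fderiv_eq_zero hF (c.φ.map_source hps) (c.chart_mem hp hps) hw)

/-- The coordinates of a point of the normal bundle. -/
def coords (e : NormalBundle V M) : V × V :=
  (c.φ e.1, c.P (c.diff e.1 (Function.surjInv (Submodule.Quotient.mk_surjective _) e.2)))

theorem coords_normalMk {p : M} (hp : (p : 𝓔) ∈ c.φ.source) (w : V) :
    c.coords (normalMk p w) = (c.φ p, c.P (c.diff p w)) := by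
  refine Prod.ext rfl ?_
  change c.P (c.diff p _) = c.P (c.diff p w)
  rw [← sub_eq_zero, ← map_sub, ← map_sub]
  refine c.P_eq_zero _ ((c.mem_tangentTo_iff p.2 hp _).1 ?_)
  exact (Submodule.Quotient.eq _).1 (Function.surjInv_eq
    (Submodule.Quotient.mk_surjective (tangentTo V M (p : 𝓔))) _)

theorem coords_fst (e : NormalBundle V M) : (c.coords e).1 = c.φ e.1 := rfl

theorem P_coords_snd (e : NormalBundle V M) : c.P (c.coords e).2 = (c.coords e).2 := c.P_P _

theorem coords_mem_dom {e : NormalBundle V M} (he : (e.1 : 𝓔) ∈ c.φ.source) :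
    c.coords e ∈ c.dom := c.mem_dom e.1.2 he _

/-- The point of the normal bundle with given coordinates. -/
def point {x : V} (hx : c.base x ∈ c.φ.target) (v : V) : NormalBundle V M :=
  normalMk ⟨c.φ.symm (c.base x), c.symm_mem hx (c.base_mem x)⟩ (c.symmDiff (c.base x) v)

open Classical in
/-- The expression in coordinates of a function on the normal bundle. -/
def coordFun (g : NormalBundle V M → ℝ) (y : V × V) : ℝ :=
  if h : c.base y.1 ∈ c.φ.target then g (c.point h y.2) else 0

theorem coordFun_of_mem (g : NormalBundle V M → ℝ) {y : V × V} (hy : y ∈ c.dom) :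
    c.coordFun g y = g (c.point hy y.2) := dif_pos hy

theorem coordFun_eq_normalMk (g : NormalBundle V M → ℝ) {y : V × V} (hy : y ∈ c.dom) :
    c.coordFun g y = g (normalMk ⟨c.φ.symm (c.base y.1), c.symm_mem hy (c.base_mem _)⟩
      (c.symmDiff (c.base y.1) y.2)) := dif_pos hy

theorem coordFun_of_notMem (g : NormalBundle V M → ℝ) {y : V × V} (hy : y ∉ c.dom) :
    c.coordFun g y = 0 := dif_neg hy

/-- Actual coordinates fill only `S × range P`, whereas `dom` is open in `V × V`: `point` retracts
the base by `base` and depends on the vector only modulo `S`. Functions on `E` thus extend to an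
open set of a vector space, where ordinary derivatives apply. -/
theorem point_coords {e : NormalBundle V M} (he : (e.1 : 𝓔) ∈ c.φ.source) :
    c.point (c.coords_mem_dom he) (c.coords e).2 = e := by
  obtain ⟨w, hw⟩ := exists_normalMk e
  conv_rhs => rw [hw]
  have hb : c.base (c.φ e.1) = c.φ e.1 := c.base_chart e.1.2 he
  have h1 : c.φ.symm (c.base (c.φ e.1)) = e.1 := by rw [hb, c.φ.left_inv he]
  refine normalMk_eq (Subtype.ext h1) ?_
  have h2 : (c.coords e).2 = c.P (c.diff e.1 w) := by
    conv_lhs => rw [hw]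
    rw [c.coords_normalMk he]
  rw [c.mem_tangentTo_iff (c.symm_mem (c.coords_mem_dom he) (c.base_mem _))
    (c.φ.map_target (c.coords_mem_dom he)), map_sub, c.diff_symmDiff (c.coords_mem_dom he), h2]
  change c.P (c.diff e.1 w) - c.diff (c.φ.symm (c.base (c.φ e.1))) w ∈ c.S
  rw [h1, ← neg_sub]
  exact c.S.neg_mem (c.sub_mem _)

theorem coordFun_coords (g : NormalBundle V M → ℝ) {e : NormalBundle V M}
    (he : (e.1 : 𝓔) ∈ c.φ.source) : c.coordFun g (c.coords e) = g e := by
  rw [c.coordFun_of_mem g (c.coords_mem_dom he), c.point_coords he]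

theorem contDiffOn_coordFun (g : NormalFun V M) : ContDiffOn ℝ ∞ (c.coordFun g.1) c.dom := by
  obtain ⟨G, hG, h⟩ := g.2 c.S c.φ c.adapted
  let T : V × V →L[ℝ] c.S × V :=
    (((ContinuousLinearMap.id ℝ V - c.P).codRestrict c.S c.base_mem).comp
      (ContinuousLinearMap.fst ℝ V V)).prod (ContinuousLinearMap.snd ℝ V V)
  have h1 : ContDiffOn ℝ ∞ (G ∘ T) c.dom := hG.comp T.contDiff.contDiffOn fun y hy => hy
  refine h1.congr fun y hy => ?_
  rw [c.coordFun_of_mem _ hy]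
  have h2 := h ⟨c.φ.symm (c.base y.1), c.symm_mem hy (c.base_mem _)⟩ (c.φ.map_target hy)
    (c.symmDiff (c.base y.1) y.2)
  refine h2.trans (congrArg G (Prod.ext (Subtype.ext (c.φ.right_inv hy)) ?_))
  exact c.diff_symmDiff hy y.2

theorem contDiffAt_coordFun (g : NormalFun V M) {y : V × V} (hy : y ∈ c.dom) :
    ContDiffAt ℝ ∞ (c.coordFun g.1) y :=
  (c.contDiffOn_coordFun g).contDiffAt (c.isOpen_dom.mem_nhds hy)

end NormalChart

variable [IsManifold 𝓘(ℝ, V) ∞ 𝓔] [FiniteDimensional ℝ V] [T2Space 𝓔]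

/-- Smoothness on the normal bundle can be checked in one chart around each point. -/
theorem isSmoothOnNormalBundle_of_charts {g : NormalBundle V M → ℝ}
    (h : ∀ p : M, ∃ (c : NormalChart V M) (G : V × V → ℝ), (p : 𝓔) ∈ c.φ.source ∧
      (∀ v, ContDiffAt ℝ ∞ G (c.φ p, v)) ∧
      ∀ᶠ x in 𝓝 (p : 𝓔), ∀ e : NormalBundle V M, (e.1 : 𝓔) = x → g e = G (c.coords e)) :
    IsSmoothOnNormalBundle V g := by
  classical
  intro S ψ hψ
  let dψ : V → V →L[ℝ] V := fun x => mfderiv 𝓘(ℝ, V) 𝓘(ℝ, V) ψ.symm x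
  have hmd : ψ.MDifferentiable 𝓘(ℝ, V) 𝓘(ℝ, V) :=
    ⟨(contMDiffOn_of_mem_maximalAtlas hψ.1).mdifferentiableOn (by simp),
      (contMDiffOn_symm_of_mem_maximalAtlas hψ.1).mdifferentiableOn (by simp)⟩
  have hmem : ∀ s : S, (s : V) ∈ ψ.target → ψ.symm s ∈ M := fun s hs =>
    (hψ.2 _ (ψ.map_target hs)).2 (by rw [ψ.right_inv hs]; exact s.2)
  let G' : S × V → ℝ := fun y =>
    if h : (y.1 : V) ∈ ψ.target then g (normalMk ⟨ψ.symm y.1, hmem y.1 h⟩ (dψ y.1 y.2)) else 0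
  refine ⟨G', ?_, ?_⟩
  · rintro ⟨s, v⟩ hs
    have hs : (s : V) ∈ ψ.target := hs
    refine ContDiffAt.contDiffWithinAt ?_
    obtain ⟨c, G, hp, hG, hev⟩ := h ⟨ψ.symm s, hmem s hs⟩
    let τ : V → V := c.φ ∘ ψ.symm
    have hsym : ContinuousAt ψ.symm (s : V) := ψ.continuousAt_symm hs
    have hτ : ∀ x ∈ ψ.target, ψ.symm x ∈ c.φ.source → ContDiffAt ℝ ∞ τ x := fun x hx hxc =>
      contMDiffAt_iff_contDiffAt.1 ((contMDiffAt_of_mem_maximalAtlas c.adapted.1 hxc).comp x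
        (contMDiffAt_symm_of_mem_maximalAtlas hψ.1 hx))
    have hdτ : ∀ x ∈ ψ.target, ψ.symm x ∈ c.φ.source → ∀ u : V,
        fderiv ℝ τ x u = c.diff (ψ.symm x) (dψ x u) := by
      intro x hx hxc u
      have h1 : MDifferentiableAt 𝓘(ℝ, V) 𝓘(ℝ, V) c.φ (ψ.symm x) :=
        (contMDiffAt_of_mem_maximalAtlas c.adapted.1 hxc).mdifferentiableAt (by simp)
      have h2 : MDifferentiableAt 𝓘(ℝ, V) 𝓘(ℝ, V) ψ.symm x :=
        (contMDiffAt_symm_of_mem_maximalAtlas hψ.1 hx).mdifferentiableAt (by simp)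
      have h3 := mfderiv_comp x h1 h2
      rw [mfderiv_eq_fderiv] at h3
      exact congrArg (fun L : V →L[ℝ] V => L u) h3
    -- The change of vector bundle coordinates: the transition map `τ` on the base and its
    -- differential on vectors.
    have e : G' =ᶠ[𝓝 (s, v)] fun y => G (τ y.1, c.P (fderiv ℝ τ y.1 y.2)) := by
      have c1 : ContinuousAt (fun y : S × V => (y.1 : V)) (s, v) := by fun_prop
      have c2 : ContinuousAt (fun y : S × V => ψ.symm y.1) (s, v) :=
        ContinuousAt.comp (f := fun y : S × V => (y.1 : V)) (g := ψ.symm) hsym c1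
      filter_upwards [c1.eventually_mem (ψ.open_target.mem_nhds hs),
        c2.eventually_mem (c.φ.open_source.mem_nhds hp), c2.eventually hev] with y h1 h2 h3
      have h4 : G' y = _ := dif_pos h1
      rw [h4, h3 _ rfl, c.coords_normalMk h2, hdτ _ h1 h2]
      rfl
    refine ContDiffAt.congr_of_eventuallyEq ?_ e
    have d1 : ContDiffAt ℝ ∞ (fun y : S × V => (y.1 : V)) (s, v) :=
      (S.subtypeL.contDiff.comp contDiff_fst).contDiffAt
    have d2 : ContDiffAt ℝ ∞ (fun y : S × V => τ y.1) (s, v) :=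
      ContDiffAt.comp (g := τ) (f := fun y : S × V => (y.1 : V)) (s, v) (hτ s hs hp) d1
    have d3 : ContDiffAt ℝ ∞ (fun y : S × V => fderiv ℝ τ y.1) (s, v) :=
      ContDiffAt.comp (g := fderiv ℝ τ) (f := fun y : S × V => (y.1 : V)) (s, v)
        ((hτ s hs hp).fderiv_right (m := ∞) (by simp)) d1
    have d4 : ContDiffAt ℝ ∞ (fun y : S × V => c.P (fderiv ℝ τ y.1 y.2)) (s, v) :=
      c.P.contDiff.contDiffAt.comp _ (d3.clm_apply contDiffAt_snd)
    exact ContDiffAt.comp (g := G) (f := fun y : S × V => (τ y.1, c.P (fderiv ℝ τ y.1 y.2)))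
      (s, v) (hG _) (d2.prodMk d4)
  · intro p hp w
    have h1 : ψ p ∈ ψ.target := ψ.map_source hp
    refine Eq.trans ?_ (dif_pos h1).symm
    refine congrArg g (normalMk_eq (V := V) (p := p) (w := w) (Subtype.ext (ψ.left_inv hp).symm) ?_)
    have h3 : ∀ u : V, dψ (ψ p) ((mfderiv 𝓘(ℝ, V) 𝓘(ℝ, V) ψ (p : 𝓔) : V →L[ℝ] V) u) = u :=
      fun u => congrArg (fun L : V →L[ℝ] V => L u) (hmd.symm_comp_deriv hp)
    have h4 : ∀ u : V,
        u - dψ (ψ p) ((mfderiv 𝓘(ℝ, V) 𝓘(ℝ, V) ψ (p : 𝓔) : V →L[ℝ] V) u) = 0 := fun u => by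
      rw [h3, sub_self]
    exact (congrArg (· ∈ tangentTo V M (p : 𝓔)) (h4 w)).mpr (tangentTo V M (p : 𝓔)).zero_mem

end NormalBundleCharts

/-! ### Functions and vector fields on the normal bundle -/

section NormalFunctions

open Filter Topology

set_option linter.unusedSectionVars false

variable {V : Type*} [NormedAddCommGroup V] [NormedSpace ℝ V]
variable {𝓔 : Type*} [TopologicalSpace 𝓔] [ChartedSpace V 𝓔] {M : Set 𝓔} {m : ℕ}
variable [IsManifold 𝓘(ℝ, V) ∞ 𝓔]

variable (M) in
/-- The pull-back to the normal bundle of the restriction to `M` of a function. -/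
def pullBase : SmoothFun V 𝓔 →ₐ[ℝ] NormalFun V M where
  toFun f := ⟨fun e => f e.1, fun S φ hφ => ⟨fun y => (f ∘ φ.symm) y.1,
    (contDiffOn_chart f hφ.1).comp (S.subtypeL.contDiff.comp contDiff_fst).contDiffOn
      (fun _ hy => hy),
    fun _ hp _ => congrArg f (φ.left_inv hp).symm⟩⟩
  map_one' := rfl
  map_mul' _ _ := rfl
  map_zero' := rfl
  map_add' _ _ := rfl
  commutes' _ := rfl

theorem pullBase_apply (f : SmoothFun V 𝓔) (e : NormalBundle V M) :
    (pullBase M f).1 e = f e.1 := rfl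

theorem linFun_normalMk (F : vanishingIdeal V M) (p : M) (w : V) :
    (linFun V F).1 (normalMk p w) = (mfderiv 𝓘(ℝ, V) 𝓘(ℝ, ℝ) F.1 (p : 𝓔) : V →L[ℝ] ℝ) w := rfl

variable [FiniteDimensional ℝ V] [T2Space 𝓔]

/-- A function on the normal bundle is smooth if its products with enough functions of the base
are. -/
theorem mem_normalFun_of_mul (hM : IsSubmanifold V m M) {g : NormalBundle V M → ℝ}
    (h : ∀ p : M, ∃ (χ : SmoothFun V 𝓔) (g' : NormalFun V M), χ p ≠ 0 ∧
      ∀ e, χ e.1 * g e = g'.1 e) : g ∈ NormalFun V M := by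
  refine isSmoothOnNormalBundle_of_charts fun p => ?_
  obtain ⟨χ, g', hχ, hg'⟩ := h p
  obtain ⟨c, hp, -⟩ := exists_normalChart hM p.2
  refine ⟨c, fun y => (χ (c.φ.symm y.1))⁻¹ * c.coordFun g'.1 y, hp, fun v => ?_, ?_⟩
  · have h1 : ContDiffAt ℝ ∞ (fun y : V × V => (χ ∘ c.φ.symm) y.1) (c.φ p, v) :=
      ContDiffAt.comp (g := χ ∘ c.φ.symm) (f := Prod.fst) _
        (contDiffAt_chart χ c.adapted.1 (c.φ.map_source hp)) contDiffAt_fst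
    refine (h1.inv ?_).mul (c.contDiffAt_coordFun g' (c.mem_dom p.2 hp v))
    simpa [c.φ.left_inv hp] using hχ
  · filter_upwards [c.φ.open_source.mem_nhds hp,
      χ.contMDiff.continuous.continuousAt.eventually_ne hχ] with x hx hx' e he
    subst he
    rw [c.coordFun_coords _ hx, ← hg', c.coords_fst, c.φ.left_inv hx, inv_mul_cancel_left₀ hx']

/-- The product of a cutoff function of the base with a function of the coordinates. -/
def normalChartMul (hM : IsSubmanifold V m M) (θ : SmoothFun V 𝓔) (c : NormalChart V M)
    (hθ : tsupport θ ⊆ c.φ.source) (G : V × V → ℝ)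
    (hG : ∀ p ∈ M, p ∈ tsupport θ → ∀ v, ContDiffAt ℝ ∞ G (c.φ p, v)) : NormalFun V M :=
  ⟨fun e => θ e.1 * G (c.coords e), by
    change IsSmoothOnNormalBundle V (fun e : NormalBundle V M => θ e.1 * G (c.coords e))
    refine isSmoothOnNormalBundle_of_charts fun p => ?_
    by_cases hp : (p : 𝓔) ∈ tsupport θ
    · refine ⟨c, fun y => (θ ∘ c.φ.symm) y.1 * G y, hθ hp, fun v => ?_, ?_⟩
      · have h1 : ContDiffAt ℝ ∞ (fun y : V × V => (θ ∘ c.φ.symm) y.1) (c.φ p, v) :=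
          ContDiffAt.comp (g := θ ∘ c.φ.symm) (f := Prod.fst) _
            (contDiffAt_chart θ c.adapted.1 (c.φ.map_source (hθ hp))) contDiffAt_fst
        exact h1.mul (hG p p.2 hp v)
      · filter_upwards [c.φ.open_source.mem_nhds (hθ hp)] with x hx e he
        subst he
        rw [c.coords_fst, Function.comp_apply, c.φ.left_inv hx]
    · obtain ⟨c', hp', -⟩ := exists_normalChart hM p.2
      refine ⟨c', fun _ => 0, hp', fun v => contDiffAt_const, ?_⟩
      filter_upwards [(isClosed_tsupport θ).isOpen_compl.mem_nhds hp] with x hx e he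
      subst he
      rw [image_eq_zero_of_notMem_tsupport hx, zero_mul]⟩

namespace NormalChart

variable (c : NormalChart V M)

theorem coordFun_add (g h : NormalFun V M) :
    c.coordFun (g + h).1 = c.coordFun g.1 + c.coordFun h.1 := by
  funext y
  by_cases hy : y ∈ c.dom
  · simp only [Pi.add_apply, c.coordFun_of_mem _ hy]
    rfl
  · simp only [Pi.add_apply, c.coordFun_of_notMem _ hy, add_zero]

theorem coordFun_mul (g h : NormalFun V M) :
    c.coordFun (g * h).1 = c.coordFun g.1 * c.coordFun h.1 := by
  funext y
  by_cases hy : y ∈ c.dom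
  · simp only [Pi.mul_apply, c.coordFun_of_mem _ hy]
    rfl
  · simp only [Pi.mul_apply, c.coordFun_of_notMem _ hy, mul_zero]

theorem coordFun_smul (r : ℝ) (g : NormalFun V M) :
    c.coordFun (r • g).1 = r • c.coordFun g.1 := by
  funext y
  by_cases hy : y ∈ c.dom
  · simp only [Pi.smul_apply, c.coordFun_of_mem _ hy]
    rfl
  · simp only [Pi.smul_apply, c.coordFun_of_notMem _ hy, smul_zero]

theorem differentiableAt_coordFun (g : NormalFun V M) {e : NormalBundle V M}
    (he : (e.1 : 𝓔) ∈ c.φ.source) : DifferentiableAt ℝ (c.coordFun g.1) (c.coords e) :=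
  (c.contDiffAt_coordFun g (c.coords_mem_dom he)).differentiableAt (by simp)

theorem coordFun_pullBase (f : SmoothFun V 𝓔) {y : V × V} (hy : y ∈ c.dom) :
    c.coordFun (pullBase M f).1 y = (f ∘ c.φ.symm) (c.base y.1) := c.coordFun_of_mem _ hy

theorem coordFun_linFun (F : vanishingIdeal V M) {y : V × V} (hy : y ∈ c.dom) :
    c.coordFun (linFun V F).1 y = fderiv ℝ (F.1 ∘ c.φ.symm) (c.base y.1) y.2 := by
  rw [c.coordFun_eq_normalMk _ hy, linFun_normalMk, c.mfderiv_apply _ (c.φ.map_target hy),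
    c.diff_symmDiff hy, c.φ.right_inv hy]

theorem linFun_apply (F : vanishingIdeal V M) {e : NormalBundle V M}
    (he : (e.1 : 𝓔) ∈ c.φ.source) :
    (linFun V F).1 e = fderiv ℝ (F.1 ∘ c.φ.symm) (c.φ e.1) (c.coords e).2 := by
  rw [← c.coordFun_coords (linFun V F).1 he, c.coordFun_linFun F (c.coords_mem_dom he), c.coords_fst,
    c.base_chart e.1.2 he]

theorem coords_fiberScale {e : NormalBundle V M} (he : (e.1 : 𝓔) ∈ c.φ.source) (t : ℝ) :
    c.coords (fiberScale V t e) = ((c.coords e).1, t • (c.coords e).2) := by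
  obtain ⟨w, hw⟩ := exists_normalMk e
  have h1 : fiberScale V t e = normalMk e.1 (t • w) := by
    conv_lhs => rw [hw]
    rfl
  have h2 : c.coords e = _ := (congrArg c.coords hw).trans (c.coords_normalMk he w)
  rw [h1, c.coords_normalMk he, h2, map_smul, map_smul]

theorem coordFun_pullScale (t : ℝ) (g : NormalFun V M) (y : V × V) :
    c.coordFun (pullScale V t g).1 y = c.coordFun g.1 (y.1, t • y.2) := by
  by_cases hy : y ∈ c.dom
  · have hy' : (y.1, t • y.2) ∈ c.dom := hy
    rw [c.coordFun_eq_normalMk _ hy, c.coordFun_eq_normalMk _ hy', map_smul]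
    rfl
  · have hy' : (y.1, t • y.2) ∉ c.dom := hy
    rw [c.coordFun_of_notMem _ hy, c.coordFun_of_notMem _ hy']

end NormalChart

/-- The vector field `θ ∂_d` in the coordinates of the normal bundle. -/
def normalDeriv (hM : IsSubmanifold V m M) (θ : SmoothFun V 𝓔) (c : NormalChart V M)
    (hθ : tsupport θ ⊆ c.φ.source) (d : V × V) :
    Derivation ℝ (NormalFun V M) (NormalFun V M) :=
  Derivation.mk'
    { toFun := fun g => normalChartMul hM θ c hθ (fun y => fderiv ℝ (c.coordFun g.1) y d)
        (fun p hp hpθ v => ((c.contDiffAt_coordFun g (c.mem_dom hp (hθ hpθ) v)).fderiv_right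
          (m := ∞) (by simp)).clm_apply contDiffAt_const)
      map_add' := fun g h => by
        refine Subtype.ext (funext fun e => ?_)
        change θ e.1 * fderiv ℝ (c.coordFun (g + h).1) (c.coords e) d =
          θ e.1 * fderiv ℝ (c.coordFun g.1) (c.coords e) d +
            θ e.1 * fderiv ℝ (c.coordFun h.1) (c.coords e) d
        by_cases he : (e.1 : 𝓔) ∈ c.φ.source
        · rw [c.coordFun_add, fderiv_add (c.differentiableAt_coordFun g he)
            (c.differentiableAt_coordFun h he), _root_.add_apply, mul_add]
        · rw [image_eq_zero_of_notMem_tsupport fun h => he (hθ h)]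
          simp
      map_smul' := fun r g => by
        refine Subtype.ext (funext fun e => ?_)
        change θ e.1 * fderiv ℝ (c.coordFun (r • g).1) (c.coords e) d =
          r * (θ e.1 * fderiv ℝ (c.coordFun g.1) (c.coords e) d)
        by_cases he : (e.1 : 𝓔) ∈ c.φ.source
        · rw [c.coordFun_smul, fderiv_const_smul (c.differentiableAt_coordFun g he),
            _root_.smul_apply, smul_eq_mul]
          ring
        · rw [image_eq_zero_of_notMem_tsupport fun h => he (hθ h)]
          simp }
    (fun g h => by
      refine Subtype.ext (funext fun e => ?_)
      change θ e.1 * fderiv ℝ (c.coordFun (g * h).1) (c.coords e) d =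
        g.1 e * (θ e.1 * fderiv ℝ (c.coordFun h.1) (c.coords e) d) +
          h.1 e * (θ e.1 * fderiv ℝ (c.coordFun g.1) (c.coords e) d)
      by_cases he : (e.1 : 𝓔) ∈ c.φ.source
      · rw [c.coordFun_mul, fderiv_mul (c.differentiableAt_coordFun g he)
          (c.differentiableAt_coordFun h he)]
        simp only [_root_.add_apply, _root_.smul_apply, smul_eq_mul, c.coordFun_coords _ he]
        ring
      · rw [image_eq_zero_of_notMem_tsupport fun h => he (hθ h)]
        simp)

/-! ### Action of coordinate fields on base functions and linearizations -/

section NormalDeriv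

variable (hM : IsSubmanifold V m M) {θ : SmoothFun V 𝓔} (c : NormalChart V M)
    (hθ : tsupport θ ⊆ c.φ.source)

theorem normalDeriv_apply (d : V × V) (g : NormalFun V M) (e : NormalBundle V M) :
    (normalDeriv hM θ c hθ d g).1 e = θ e.1 * fderiv ℝ (c.coordFun g.1) (c.coords e) d := rfl

/-- The chain rule for fiber scaling; it gives tangent directions weight `0` and fiber directions
weight `1`. -/
theorem pullScale_normalDeriv {t : ℝ} (ht : t ≠ 0) (d : V × V) (g : NormalFun V M) :
    pullScale V t (normalDeriv hM θ c hθ d g) =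
      normalDeriv hM θ c hθ (d.1, t⁻¹ • d.2) (pullScale V t g) := by
  refine Subtype.ext (funext fun e => ?_)
  change θ e.1 * fderiv ℝ (c.coordFun g.1) (c.coords (fiberScale V t e)) d =
    θ e.1 * fderiv ℝ (c.coordFun (pullScale V t g).1) (c.coords e) (d.1, t⁻¹ • d.2)
  by_cases he : (e.1 : 𝓔) ∈ c.φ.source
  · let T : V × V →L[ℝ] V × V := (ContinuousLinearMap.fst ℝ V V).prod
      (t • ContinuousLinearMap.snd ℝ V V)
    have h1 : c.coordFun (pullScale V t g).1 = c.coordFun g.1 ∘ T :=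
      funext fun y => c.coordFun_pullScale t g y
    have h2 : DifferentiableAt ℝ (c.coordFun g.1) (T (c.coords e)) :=
      (c.contDiffAt_coordFun g (y := T (c.coords e)) (c.coords_mem_dom he :
        c.base (c.coords e).1 ∈ c.φ.target)).differentiableAt (by simp)
    have h3 : T (d.1, t⁻¹ • d.2) = d := Prod.ext rfl (smul_inv_smul₀ ht _)
    rw [h1, fderiv_comp _ h2 T.differentiableAt, T.fderiv, ContinuousLinearMap.comp_apply, h3,
      c.coords_fiberScale he]
    rfl
  · rw [image_eq_zero_of_notMem_tsupport fun h => he (hθ h)]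
    simp

theorem hasFDerivAt_base (y : V × V) : HasFDerivAt (fun y : V × V => c.base y.1)
    ((ContinuousLinearMap.id ℝ V - c.P).comp (ContinuousLinearMap.fst ℝ V V)) y :=
  ((ContinuousLinearMap.id ℝ V - c.P).comp (ContinuousLinearMap.fst ℝ V V)).hasFDerivAt

theorem fderiv_coordFun_pullBase (f : SmoothFun V 𝓔) {e : NormalBundle V M}
    (he : (e.1 : 𝓔) ∈ c.φ.source) (d : V × V) :
    fderiv ℝ (c.coordFun (pullBase M f).1) (c.coords e) d =
      fderiv ℝ (f ∘ c.φ.symm) (c.φ e.1) (c.base d.1) := by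
  have h1 : c.coordFun (pullBase M f).1 =ᶠ[𝓝 (c.coords e)]
      (f ∘ c.φ.symm) ∘ fun y : V × V => c.base y.1 := by
    filter_upwards [c.isOpen_dom.mem_nhds (c.coords_mem_dom he)] with y hy
    exact c.coordFun_pullBase f hy
  have h2 : HasFDerivAt (f ∘ c.φ.symm) (fderiv ℝ (f ∘ c.φ.symm) (c.φ e.1))
      (c.base (c.coords e).1) := by
    rw [c.coords_fst, c.base_chart e.1.2 he]
    exact ((contDiffAt_chart f c.adapted.1 (c.φ.map_source he)).differentiableAt
      (by simp)).hasFDerivAt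
  rw [h1.fderiv_eq, (h2.comp (c.coords e) (hasFDerivAt_base c _)).fderiv]
  rfl

theorem fderiv_coordFun_linFun (F : vanishingIdeal V M) {e : NormalBundle V M}
    (he : (e.1 : 𝓔) ∈ c.φ.source) (d : V × V) :
    fderiv ℝ (c.coordFun (linFun V F).1) (c.coords e) d =
      fderiv ℝ (fderiv ℝ (F.1 ∘ c.φ.symm)) (c.φ e.1) (c.base d.1) (c.coords e).2 +
        fderiv ℝ (F.1 ∘ c.φ.symm) (c.φ e.1) d.2 := by
  have h1 : c.coordFun (linFun V F).1 =ᶠ[𝓝 (c.coords e)]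
      fun y : V × V => (fderiv ℝ (F.1 ∘ c.φ.symm) ∘ fun y : V × V => c.base y.1) y y.2 := by
    filter_upwards [c.isOpen_dom.mem_nhds (c.coords_mem_dom he)] with y hy
    exact c.coordFun_linFun F hy
  have h2 : HasFDerivAt (fderiv ℝ (F.1 ∘ c.φ.symm))
      (fderiv ℝ (fderiv ℝ (F.1 ∘ c.φ.symm)) (c.φ e.1)) (c.base (c.coords e).1) := by
    rw [c.coords_fst, c.base_chart e.1.2 he]
    exact (((contDiffAt_chart F.1 c.adapted.1 (c.φ.map_source he)).fderiv_right (m := ∞)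
      (by simp)).differentiableAt (by simp)).hasFDerivAt
  have h3 : HasFDerivAt (fun y : V × V => y.2) (ContinuousLinearMap.snd ℝ V V) (c.coords e) :=
    (ContinuousLinearMap.snd ℝ V V).hasFDerivAt
  rw [h1.fderiv_eq, ((h2.comp (c.coords e) (hasFDerivAt_base c _)).clm_apply h3).fderiv]
  have h4 : c.base (c.coords e).1 = c.φ e.1 := c.base_chart e.1.2 he
  simp only [_root_.add_apply, ContinuousLinearMap.comp_apply, ContinuousLinearMap.flip_apply,
    Function.comp_apply, h4]
  rw [add_comm]
  rfl

/-- With `normalDeriv_normal_pullBase`, `normalDeriv_normal_linFun` and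
`normalDeriv_tangent_linFun`, this identifies the coordinate fields of `E` as leading parts of those
of `𝓔`; base functions and linearizations suffice by `HasLead.derivation`. -/
theorem normalDeriv_tangent_pullBase {a : V} (ha : a ∈ c.S) (f : SmoothFun V 𝓔) :
    normalDeriv hM θ c hθ (a, 0) (pullBase M f) =
      pullBase M (chartDeriv θ c.adapted.1 hθ a f) := by
  refine Subtype.ext (funext fun e => ?_)
  rw [normalDeriv_apply, pullBase_apply, chartDeriv_apply]
  by_cases he : (e.1 : 𝓔) ∈ c.φ.source
  · rw [fderiv_coordFun_pullBase c f he, c.base_of_mem ha]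
  · rw [image_eq_zero_of_notMem_tsupport fun h => he (hθ h), zero_mul, zero_mul]

theorem normalDeriv_normal_pullBase (v : V) (f : SmoothFun V 𝓔) :
    normalDeriv hM θ c hθ (0, v) (pullBase M f) = 0 := by
  refine Subtype.ext (funext fun e => ?_)
  rw [normalDeriv_apply]
  change _ = (0 : ℝ)
  by_cases he : (e.1 : 𝓔) ∈ c.φ.source
  · rw [fderiv_coordFun_pullBase c f he, c.base_of_mem c.S.zero_mem, map_zero, mul_zero]
  · rw [image_eq_zero_of_notMem_tsupport fun h => he (hθ h), zero_mul]

theorem normalDeriv_normal_linFun (v : V) (F : vanishingIdeal V M) :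
    normalDeriv hM θ c hθ (0, v) (linFun V F) =
      pullBase M (chartDeriv θ c.adapted.1 hθ v F.1) := by
  refine Subtype.ext (funext fun e => ?_)
  rw [normalDeriv_apply, pullBase_apply, chartDeriv_apply]
  by_cases he : (e.1 : 𝓔) ∈ c.φ.source
  · rw [fderiv_coordFun_linFun c F he, c.base_of_mem c.S.zero_mem, map_zero]
    simp
  · rw [image_eq_zero_of_notMem_tsupport fun h => he (hθ h), zero_mul, zero_mul]

theorem isTangent_chartDeriv {a : V} (ha : a ∈ c.S) :
    IsTangent V M (chartDeriv θ c.adapted.1 hθ a) := by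
  intro F hF p hp
  rw [chartDeriv_apply]
  by_cases hps : p ∈ c.φ.source
  · rw [c.fderiv_eq_zero hF (c.φ.map_source hps) (c.chart_mem hp hps) ha, mul_zero]
  · rw [image_eq_zero_of_notMem_tsupport fun h => hps (hθ h), zero_mul]

/-- Both sides are `θ` times a mixed second derivative of `F`, taken in opposite orders. The
derivative of `θ` does not contribute because `∂_a F = 0` on `M`. -/
theorem normalDeriv_tangent_linFun {a : V} (ha : a ∈ c.S) (F : vanishingIdeal V M) :
    normalDeriv hM θ c hθ (a, 0) (linFun V F) =
      linFun V ⟨chartDeriv θ c.adapted.1 hθ a F.1, isTangent_chartDeriv c hθ ha F.1 F.2⟩ := by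
  have key : ∀ e : NormalBundle V M, (e.1 : 𝓔) ∈ c.φ.source →
      (linFun V ⟨chartDeriv θ c.adapted.1 hθ a F.1, isTangent_chartDeriv c hθ ha F.1 F.2⟩).1 e =
        θ e.1 * fderiv ℝ (fderiv ℝ (F.1 ∘ c.φ.symm)) (c.φ e.1) a (c.coords e).2 := by
    intro e he
    have hx := c.φ.map_source he
    have h1 : ((chartDeriv θ c.adapted.1 hθ a F.1 : SmoothFun V 𝓔) : 𝓔 → ℝ) ∘ c.φ.symm
        =ᶠ[𝓝 (c.φ e.1)] (θ ∘ c.φ.symm) * fun x => fderiv ℝ (F.1 ∘ c.φ.symm) x a := by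
      filter_upwards [c.φ.open_target.mem_nhds hx] with x hx
      change θ (c.φ.symm x) * fderiv ℝ (F.1 ∘ c.φ.symm) (c.φ (c.φ.symm x)) a = _
      rw [c.φ.right_inv hx]
      rfl
    have hF := contDiffAt_chart F.1 c.adapted.1 hx
    have h2 : HasFDerivAt (fderiv ℝ (F.1 ∘ c.φ.symm))
        (fderiv ℝ (fderiv ℝ (F.1 ∘ c.φ.symm)) (c.φ e.1)) (c.φ e.1) :=
      ((hF.fderiv_right (m := ∞) (by simp)).differentiableAt (by simp)).hasFDerivAt
    have h3 := h2.clm_apply (hasFDerivAt_const a (c.φ e.1))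
    have h4 := ((contDiffAt_chart θ c.adapted.1 hx).differentiableAt (by simp)).hasFDerivAt
    have h5 := hF.isSymmSndFDerivAt (by
      simp only [minSmoothness_of_isRCLikeNormedField]
      exact WithTop.coe_le_coe.2 (le_top : (2 : ℕ∞) ≤ ⊤))
    rw [c.linFun_apply _ he, h1.fderiv_eq, (h4.mul h3).fderiv]
    simp only [_root_.add_apply, _root_.smul_apply, ContinuousLinearMap.comp_apply,
      ContinuousLinearMap.flip_apply, smul_eq_mul, Function.comp_apply, c.φ.left_inv he,
      c.fderiv_eq_zero F.2 hx (c.chart_mem e.1.2 he) ha]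
    rw [h5.eq a]
    simp
  refine Subtype.ext (funext fun e => ?_)
  by_cases he : (e.1 : 𝓔) ∈ c.φ.source
  · rw [key e he, normalDeriv_apply, fderiv_coordFun_linFun c F he, c.base_of_mem ha, map_zero,
      add_zero]
  -- Outside the chart `θ` vanishes near the base point; the linearization is computed in another
  -- chart there.
  · have h0 : ∀ᶠ x in 𝓝 (e.1 : 𝓔), θ x = 0 := by
      filter_upwards [(isClosed_tsupport θ).isOpen_compl.mem_nhds fun h => he (hθ h)] with x hx
      exact image_eq_zero_of_notMem_tsupport hx
    obtain ⟨c', hc', -⟩ := exists_normalChart hM e.1.2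
    rw [normalDeriv_apply, h0.self_of_nhds, zero_mul, c'.linFun_apply _ hc']
    have h1 : ((chartDeriv θ c.adapted.1 hθ a F.1 : SmoothFun V 𝓔) : 𝓔 → ℝ) ∘ c'.φ.symm
        =ᶠ[𝓝 (c'.φ e.1)] fun _ => 0 := by
      have h2 : Tendsto c'.φ.symm (𝓝 (c'.φ e.1)) (𝓝 (e.1 : 𝓔)) := by
        have := c'.φ.continuousAt_symm (c'.φ.map_source hc')
        rwa [ContinuousAt, c'.φ.left_inv hc'] at this
      filter_upwards [h2.eventually h0] with x hx
      rw [Function.comp_apply, chartDeriv_apply, hx, zero_mul]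
    rw [h1.fderiv_eq]
    simp

end NormalDeriv

end NormalFunctions

/-! ### Leading terms along the submanifold -/

section Leading

open Filter Topology

set_option linter.unusedSectionVars false

variable {V : Type*} [NormedAddCommGroup V] [NormedSpace ℝ V]
variable {𝓔 : Type*} [TopologicalSpace 𝓔] [ChartedSpace V 𝓔] {M : Set 𝓔} {m : ℕ}
variable [IsManifold 𝓘(ℝ, V) ∞ 𝓔]

/-- `HasLead k G g`: the function `G` vanishes to order `k` along `M`, and `g` is its leading
term, a function on the normal bundle which is homogeneous of degree `k` along the fibers. -/
inductive HasLead : ℤ → SmoothFun V 𝓔 → NormalFun V M → Prop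
  | zero (k : ℤ) : HasLead k 0 0
  | add {k : ℤ} {G H : SmoothFun V 𝓔} {g h : NormalFun V M} :
      HasLead k G g → HasLead k H h → HasLead k (G + H) (g + h)
  | base (f : SmoothFun V 𝓔) : HasLead 0 f (pullBase M f)
  | lin (F : vanishingIdeal V M) : HasLead 1 F.1 (linFun V F)
  | mul {k l : ℤ} {G H : SmoothFun V 𝓔} {g h : NormalFun V M} :
      HasLead k G g → HasLead l H h → HasLead (k + l) (G * H) (g * h)
  | lower {k : ℤ} {G : SmoothFun V 𝓔} {g : NormalFun V M} : HasLead k G g → HasLead (k - 1) G 0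
  -- Leading terms may be checked locally on `M`; this is what allows leading parts of operators to
  -- be glued.
  | loc {k : ℤ} {G : SmoothFun V 𝓔} {g : NormalFun V M} (χ : M → SmoothFun V 𝓔)
      (hχ : ∀ p : M, χ p p ≠ 0) (h : ∀ p : M, HasLead k (χ p * G) (pullBase M (χ p) * g)) :
      HasLead k G g

theorem HasLead.base_mul {k : ℤ} {G : SmoothFun V 𝓔} {g : NormalFun V M} (h : HasLead k G g)
    (f : SmoothFun V 𝓔) : HasLead k (f * G) (pullBase M f * g) := by
  have := (HasLead.base (M := M) f).mul h
  rwa [zero_add] at this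

theorem HasLead.sub {k : ℤ} {G H : SmoothFun V 𝓔} {g h : NormalFun V M} (hG : HasLead k G g)
    (hH : HasLead k H h) : HasLead k (G - H) (g - h) := by
  have h1 := hG.add (hH.base_mul (-1))
  have e1 : G + -1 * H = G - H := by ring
  have e2 : g + pullBase M (-1) * h = g - h := Subtype.ext (funext fun e => by
    change g.1 e + -1 * h.1 e = g.1 e - h.1 e
    ring)
  rwa [e1, e2] at h1

theorem HasLead.congr {k l : ℤ} {G : SmoothFun V 𝓔} {g : NormalFun V M} (h : HasLead k G g)
    (e : k = l) : HasLead l G g := e ▸ h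

/-- `HasLead` is generated by formal rules; this gives it analytic content. Along a curve leaving
`M` in the normal direction `e`, the leading term is the limit of the rescaled function, hence is
determined by it. -/
theorem exists_lead_curve [FiniteDimensional ℝ V] [T2Space 𝓔] (hM : IsSubmanifold V m M)
    (e : NormalBundle V M) :
    ∃ γ : ℝ → 𝓔, Tendsto γ (𝓝[≠] 0) (𝓝 (e.1 : 𝓔)) ∧
      ∀ (k : ℤ) (G : SmoothFun V 𝓔) (g : NormalFun V M), HasLead k G g →
        Tendsto (fun ε : ℝ => ε ^ (-k) * G (γ ε)) (𝓝[≠] 0) (𝓝 (g.1 e)) := by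
  obtain ⟨c, hp, -⟩ := exists_normalChart hM e.1.2
  have hx := c.φ.map_source hp
  set γ : ℝ → 𝓔 := fun ε => c.φ.symm (c.φ e.1 + ε • (c.coords e).2) with hγdef
  have hline : HasDerivAt (fun ε : ℝ => c.φ e.1 + ε • (c.coords e).2) (c.coords e).2 0 := by
    simpa using ((hasDerivAt_id (0 : ℝ)).smul_const (c.coords e).2).const_add (c.φ e.1)
  have hγ0 : γ 0 = e.1 := by simp [hγdef, c.φ.left_inv hp]
  have hγ : Tendsto γ (𝓝[≠] 0) (𝓝 (e.1 : 𝓔)) := by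
    have h1 : ContinuousAt c.φ.symm (c.φ e.1 + (0 : ℝ) • (c.coords e).2) := by
      rw [zero_smul, add_zero]
      exact c.φ.continuousAt_symm hx
    have h2 : ContinuousAt γ 0 :=
      ContinuousAt.comp (f := fun ε : ℝ => c.φ e.1 + ε • (c.coords e).2) h1 hline.continuousAt
    have h3 := h2.tendsto
    rw [hγ0] at h3
    exact h3.mono_left nhdsWithin_le_nhds
  have hfun : ∀ f : SmoothFun V 𝓔, Tendsto (fun ε => f (γ ε)) (𝓝[≠] 0) (𝓝 (f e.1)) := fun f =>
    (f.contMDiff.continuous.tendsto _).comp hγ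
  have hne : ∀ᶠ ε : ℝ in 𝓝[≠] 0, ε ≠ 0 := eventually_mem_nhdsWithin
  refine ⟨γ, hγ, fun k G g h => ?_⟩
  induction h with
  | zero k => simp
  | add _ _ ihG ihH =>
    refine (ihG.add ihH).congr fun ε => ?_
    rw [ContMDiffMap.coe_add, Pi.add_apply, mul_add]
  | base f =>
    rw [pullBase_apply]
    simpa using hfun f
  | lin F =>
    rw [c.linFun_apply F hp]
    have h1 : HasFDerivAt (F.1 ∘ c.φ.symm) (fderiv ℝ (F.1 ∘ c.φ.symm) (c.φ e.1))
        (c.φ e.1 + (0 : ℝ) • (c.coords e).2) := by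
      rw [zero_smul, add_zero]
      exact ((contDiffAt_chart F.1 c.adapted.1 hx).differentiableAt (by simp)).hasFDerivAt
    have h2 := (h1.comp_hasDerivAt (0 : ℝ) hline).tendsto_slope_zero
    refine h2.congr fun ε => ?_
    have h3 : F.1 (γ 0) = 0 := by
      rw [hγ0]
      exact F.2 _ e.1.2
    change ε⁻¹ • (F.1 (γ (0 + ε)) - F.1 (γ 0)) = _
    rw [h3, zero_add, sub_zero, zpow_neg_one, smul_eq_mul]
  | mul _ _ ihG ihH =>
    refine (ihG.mul ihH).congr' ?_
    filter_upwards [hne] with ε hε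
    rw [neg_add, zpow_add₀ hε, ContMDiffMap.coe_mul, Pi.mul_apply]
    ring
  | @lower k G g _ ih =>
    have h1 : Tendsto (fun ε : ℝ => ε) (𝓝[≠] 0) (𝓝 0) :=
      tendsto_id.mono_left nhdsWithin_le_nhds
    have h2 := h1.mul ih
    rw [zero_mul] at h2
    refine h2.congr' ?_
    filter_upwards [hne] with ε hε
    rw [← mul_assoc, ← zpow_one_add₀ hε]
    congr 2
    ring
  | @loc k G g χ hχ _ ih =>
    have h1 := ((hfun (χ e.1)).inv₀ (hχ e.1)).mul (ih e.1)
    have h2 : (χ e.1 e.1)⁻¹ * (pullBase M (χ e.1) * g).1 e = g.1 e :=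
      inv_mul_cancel_left₀ (hχ e.1) _
    rw [h2] at h1
    refine h1.congr' ?_
    filter_upwards [(hfun (χ e.1)).eventually_ne (hχ e.1)] with ε hε
    rw [ContMDiffMap.coe_mul, Pi.mul_apply, mul_left_comm, inv_mul_cancel_left₀ hε]

section

variable [FiniteDimensional ℝ V] [T2Space 𝓔]

theorem HasLead.unique (hM : IsSubmanifold V m M) {k : ℤ} {G : SmoothFun V 𝓔}
    {g h : NormalFun V M} (hg : HasLead k G g) (hh : HasLead k G h) : g = h := by
  refine Subtype.ext (funext fun e => ?_)
  obtain ⟨γ, -, hγ⟩ := exists_lead_curve hM e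
  exact tendsto_nhds_unique (hγ k G g hg) (hγ k G h hh)

theorem HasLead.eq_pullBase (hM : IsSubmanifold V m M) {f : SmoothFun V 𝓔} {g : NormalFun V M}
    (h : HasLead 0 f g) : g = pullBase M f :=
  h.unique hM (HasLead.base f)

theorem HasLead.mem_vanishingIdeal (hM : IsSubmanifold V m M) {F : SmoothFun V 𝓔}
    {g : NormalFun V M} (h : HasLead 1 F g) : F ∈ vanishingIdeal V M := by
  intro p hp
  obtain ⟨γ, hγp, hγ⟩ := exists_lead_curve hM (normalMk ⟨p, hp⟩ (0 : V))
  have h1 : Tendsto (fun ε : ℝ => ε) (𝓝[≠] 0) (𝓝 0) := tendsto_id.mono_left nhdsWithin_le_nhds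
  have h2 := h1.mul (hγ 1 F g h)
  rw [zero_mul] at h2
  have h3 : Tendsto (fun ε => F (γ ε)) (𝓝[≠] 0) (𝓝 (F p)) :=
    (F.contMDiff.continuous.tendsto _).comp hγp
  refine tendsto_nhds_unique h3 (h2.congr' ?_)
  filter_upwards [eventually_mem_nhdsWithin] with ε hε
  rw [zpow_neg_one, mul_inv_cancel_left₀ hε]

end

/-- A vector field on `E` which is compatible with a vector field on the manifold in degrees
`0` and `1` is compatible with it on all the leading terms. -/
theorem HasLead.derivation {Z : Derivation ℝ (SmoothFun V 𝓔) (SmoothFun V 𝓔)}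
    {Z' : Derivation ℝ (NormalFun V M) (NormalFun V M)} {w : ℤ}
    (hb : ∀ f, HasLead (0 - w) (Z f) (Z' (pullBase M f)))
    (hl : ∀ F : vanishingIdeal V M, HasLead (1 - w) (Z F.1) (Z' (linFun V F))) {k : ℤ}
    {G : SmoothFun V 𝓔} {g : NormalFun V M} (h : HasLead k G g) :
    HasLead (k - w) (Z G) (Z' g) := by
  induction h with
  | zero k =>
    rw [map_zero, map_zero]
    exact HasLead.zero _
  | add _ _ ihG ihH =>
    rw [map_add, map_add]
    exact ihG.add ihH
  | base f => exact hb f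
  | lin F => exact hl F
  | mul hG hH ihG ihH =>
    rw [Derivation.leibniz, Derivation.leibniz]
    exact ((hG.mul ihH).congr (by ring)).add ((hH.mul ihG).congr (by ring))
  | lower _ ih =>
    rw [map_zero]
    exact ih.lower.congr (by ring)
  | @loc k G g χ hχ h ih =>
    -- The square is needed because `χ² Z G = χ Z(χ G) - Z(χ) (χ G)` involves `G` only through `χ
    -- G`.
    refine HasLead.loc (fun p => χ p * χ p) (fun p => mul_ne_zero (hχ p) (hχ p)) fun p => ?_
    have h1 := ((ih p).base_mul (χ p)).sub (((hb (χ p)).mul (h p)).congr (by ring))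
    have e1 : χ p * χ p * Z G = χ p * Z (χ p * G) - Z (χ p) * (χ p * G) := by
      rw [Derivation.leibniz, smul_eq_mul, smul_eq_mul]
      ring
    have e2 : pullBase M (χ p * χ p) * Z' g = pullBase M (χ p) * Z' (pullBase M (χ p) * g) -
        Z' (pullBase M (χ p)) * (pullBase M (χ p) * g) := by
      rw [Derivation.leibniz, smul_eq_mul, smul_eq_mul, map_mul]
      ring
    rw [e1, e2]
    exact h1

/-- `D'` is the leading part of `D`, which lowers the order of vanishing along `M` by `d`. -/
def IsLead (d : ℤ) (D : Module.End ℝ (SmoothFun V 𝓔)) (D' : Module.End ℝ (NormalFun V M)) : Prop :=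
  ∀ (k : ℤ) (G : SmoothFun V 𝓔) (g : NormalFun V M), HasLead k G g → HasLead (k - d) (D G) (D' g)

/-- Operators on the normal bundle which are homogeneous of weight `-d`. -/
def IsWeighted (d : ℤ) (D : Module.End ℝ (NormalFun V M)) : Prop :=
  ∀ t : ℝ, t ≠ 0 → ∀ g, pullScale V t (D g) = t ^ (-d) • D (pullScale V t g)

/-! ### Calculus of leading parts and weights -/

section Operators

variable {d d' : ℤ} {D E : Module.End ℝ (SmoothFun V 𝓔)} {D' E' : Module.End ℝ (NormalFun V M)}

theorem IsLead.zero (d : ℤ) : IsLead d (0 : Module.End ℝ (SmoothFun V 𝓔))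
    (0 : Module.End ℝ (NormalFun V M)) := fun _ _ _ _ => HasLead.zero _

theorem IsLead.add (hD : IsLead d D D') (hE : IsLead d E E') : IsLead d (D + E) (D' + E') :=
  fun k G g h => (hD k G g h).add (hE k G g h)

theorem IsLead.sub (hD : IsLead d D D') (hE : IsLead d E E') : IsLead d (D - E) (D' - E') :=
  fun k G g h => (hD k G g h).sub (hE k G g h)

theorem IsLead.comp (hD : IsLead d D D') (hE : IsLead d' E E') :
    IsLead (d + d') (D * E) (D' * E') := fun k G g h =>
  (hD _ _ _ (hE k G g h)).congr (by ring)

theorem IsLead.congr (h : IsLead d D D') (e : d = d') : IsLead d' D D' := e ▸ h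

theorem IsLead.lie (hD : IsLead d D D') (hE : IsLead d' E E') :
    IsLead (d + d') ⁅D, E⁆ ⁅D', E'⁆ := by
  rw [Ring.lie_def, Ring.lie_def]
  exact (hD.comp hE).sub ((hE.comp hD).congr (add_comm _ _))

/-- If a larger drop is allowed than the one that occurs, nothing is left in the top degree. -/
theorem IsLead.raise (hD : IsLead d D D') : IsLead (d + 1) D (0 : Module.End ℝ (NormalFun V M)) :=
  fun k G g h => (hD k G g h).lower.congr (by ring)

theorem HasLead.isLead_mulOp {k : ℤ} {G : SmoothFun V 𝓔} {g : NormalFun V M} (h : HasLead k G g) :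
    IsLead (-k) (mulOp G) (mulOp g) := fun l H h' hH => (h.mul hH).congr (by ring)

theorem isLead_mulOp_pullBase (f : SmoothFun V 𝓔) :
    IsLead 0 (mulOp f) (mulOp (pullBase M f)) := (HasLead.base f).isLead_mulOp

theorem IsLead.mulOp_comp (hD : IsLead d D D') (f : SmoothFun V 𝓔) :
    IsLead d (mulOp f * D) (mulOp (pullBase M f) * D') :=
  ((isLead_mulOp_pullBase f).comp hD).congr (zero_add d)

theorem IsLead.nestedComm (hD : IsLead d D D') {n : ℕ} (F : Fin n → vanishingIdeal V M) :
    IsLead (d - n) (nestedComm D (fun i => (F i).1)) (nestedComm D' (fun i => linFun V (F i))) := by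
  induction n generalizing d D D' with
  | zero => simpa [nestedComm_zero'] using hD
  | succ n ih =>
    rw [nestedComm_succ, nestedComm_succ]
    refine (ih (hD.lie (HasLead.lin (F 0)).isLead_mulOp) fun i => F i.succ).congr ?_
    push_cast
    ring

theorem pullScale_mul (t : ℝ) (g h : NormalFun V M) :
    pullScale V t (g * h) = pullScale V t g * pullScale V t h := rfl

theorem pullScale_add (t : ℝ) (g h : NormalFun V M) :
    pullScale V t (g + h) = pullScale V t g + pullScale V t h := rfl

theorem pullScale_sub (t : ℝ) (g h : NormalFun V M) :
    pullScale V t (g - h) = pullScale V t g - pullScale V t h := rfl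

theorem pullScale_linFun (t : ℝ) (F : vanishingIdeal V M) :
    pullScale V t (linFun V F) = t • linFun V F :=
  Subtype.ext (funext fun _ => map_smul _ t _)

theorem pullScale_pullScale_inv {t : ℝ} (ht : t ≠ 0) (g : NormalFun V M) :
    pullScale V t (pullScale V t⁻¹ g) = g := by
  refine Subtype.ext (funext fun e => ?_)
  change g.1 ⟨e.1, t⁻¹ • t • e.2⟩ = g.1 e
  rw [smul_smul, inv_mul_cancel₀ ht, one_smul]

theorem IsWeighted.zero (d : ℤ) : IsWeighted d (0 : Module.End ℝ (NormalFun V M)) :=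
  fun t _ g => by
    change (0 : NormalFun V M) = t ^ (-d) • 0
    rw [smul_zero]

theorem IsWeighted.add (hD : IsWeighted d D') (hE : IsWeighted d E') :
    IsWeighted d (D' + E') := fun t ht g => by
  rw [LinearMap.add_apply, pullScale_add, hD t ht, hE t ht, LinearMap.add_apply, smul_add]

theorem IsWeighted.sub (hD : IsWeighted d D') (hE : IsWeighted d E') :
    IsWeighted d (D' - E') := fun t ht g => by
  rw [LinearMap.sub_apply, pullScale_sub, hD t ht, hE t ht, LinearMap.sub_apply, smul_sub]

theorem IsWeighted.comp (hD : IsWeighted d D') (hE : IsWeighted d' E') :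
    IsWeighted (d + d') (D' * E') := fun t ht g => by
  rw [Module.End.mul_apply, hD t ht, hE t ht, map_smul, smul_smul, ← zpow_add₀ ht, neg_add]
  rfl

theorem IsWeighted.congr (h : IsWeighted d D') (e : d = d') : IsWeighted d' D' := e ▸ h

theorem IsWeighted.lie (hD : IsWeighted d D') (hE : IsWeighted d' E') :
    IsWeighted (d + d') ⁅D', E'⁆ := by
  rw [Ring.lie_def]
  exact (hD.comp hE).sub ((hE.comp hD).congr (add_comm _ _))

theorem isWeighted_mulOp_pullBase (f : SmoothFun V 𝓔) :
    IsWeighted 0 (mulOp (pullBase M f)) := fun t _ g => by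
  rw [neg_zero, zpow_zero, one_smul]
  rfl

theorem isWeighted_mulOp_linFun (F : vanishingIdeal V M) :
    IsWeighted (-1) (mulOp (linFun V F)) := fun t _ g => by
  rw [neg_neg, zpow_one, LinearMap.mulLeft_apply, pullScale_mul, pullScale_linFun,
    LinearMap.mulLeft_apply, smul_mul_assoc]

theorem IsWeighted.nestedComm (hD : IsWeighted d D') {n : ℕ} (F : Fin n → vanishingIdeal V M) :
    IsWeighted (d - n) (nestedComm D' (fun i => linFun V (F i))) := by
  induction n generalizing d D' with
  | zero => simpa [nestedComm_zero'] using hD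
  | succ n ih =>
    rw [nestedComm_succ]
    refine (ih (hD.lie (isWeighted_mulOp_linFun (F 0))) fun i => F i.succ).congr ?_
    push_cast
    ring

theorem pullScale_nestedComm {t s : ℝ}
    (h : ∀ g, pullScale V t (D' g) = s • E' (pullScale V t g)) {n : ℕ}
    (f : Fin n → NormalFun V M) (g : NormalFun V M) :
    pullScale V t (_root_.nestedComm D' f g) =
      s • _root_.nestedComm E' (fun i => pullScale V t (f i)) (pullScale V t g) := by
  induction n generalizing D' E' g with
  | zero => simpa [nestedComm_zero'] using h g
  | succ n ih =>
    rw [nestedComm_succ, nestedComm_succ E']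
    refine ih (fun x => ?_) (fun i => f i.succ) g
    rw [bracket_mulOp_apply, bracket_mulOp_apply, pullScale_sub, h, pullScale_mul, pullScale_mul,
      h, mul_smul_comm, smul_sub]

end Operators

end Leading

/-! ### Operators on the normal bundle are determined by the base and linear functions -/

section Jets

open Filter Topology

set_option linter.unusedSectionVars false

variable {V : Type*} [NormedAddCommGroup V] [NormedSpace ℝ V]
variable {𝓔 : Type*} [TopologicalSpace 𝓔] [ChartedSpace V 𝓔] {M : Set 𝓔} {m : ℕ}
variable [IsManifold 𝓘(ℝ, V) ∞ 𝓔]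

/-- The functions on the normal bundle vanishing at a point. -/
def evalIdeal (e : NormalBundle V M) : Ideal (NormalFun V M) where
  carrier := {g | g.1 e = 0}
  add_mem' {g h} hg hh := by
    change g.1 e + h.1 e = 0
    rw [show g.1 e = 0 from hg, show h.1 e = 0 from hh, add_zero]
  zero_mem' := rfl
  smul_mem' c g hg := by
    change c.1 e * g.1 e = 0
    rw [show g.1 e = 0 from hg, mul_zero]

theorem sub_algebraMap_mem_evalIdeal (e : NormalBundle V M) (g : NormalFun V M) :
    g - algebraMap ℝ _ (g.1 e) ∈ evalIdeal e := sub_self (g.1 e)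

variable (M) in
/-- The functions generated by the functions of the base and the linearizations; these are
polynomial along the fibers. -/
def polySub : Subalgebra ℝ (NormalFun V M) :=
  Algebra.adjoin ℝ (range (pullBase M) ∪ range (linFun V))

theorem pullBase_mem_polySub (f : SmoothFun V 𝓔) : pullBase M f ∈ polySub M :=
  Algebra.subset_adjoin (Or.inl ⟨f, rfl⟩)

theorem linFun_mem_polySub (F : vanishingIdeal V M) : linFun V F ∈ polySub M :=
  Algebra.subset_adjoin (Or.inr ⟨F, rfl⟩)

variable [FiniteDimensional ℝ V] [T2Space 𝓔]

theorem NormalFun.sum_apply {κ : Type*} (s : Finset κ) (f : κ → NormalFun V M)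
    (e : NormalBundle V M) : (∑ k ∈ s, f k).1 e = ∑ k ∈ s, (f k).1 e := by
  classical
  induction s using Finset.induction_on with
  | empty => rfl
  | insert a s ha ih => rw [Finset.sum_insert ha, Finset.sum_insert ha, ← ih]; rfl

/-- The coordinates of the normal bundle are locally functions of the base and linearizations. -/
theorem NormalChart.exists_polySub_coord (c : NormalChart V M) {θ : SmoothFun V 𝓔}
    (hθ : tsupport θ ⊆ c.φ.source) {ι : Type*} (b : Module.Basis ι ℝ V) (j : ι ⊕ ι) :
    ∃ W ∈ polySub M, ∀ e : NormalBundle V M, (e.1 : 𝓔) ∈ c.φ.source →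
      (∀ᶠ x in 𝓝 (e.1 : 𝓔), θ x = 1) → W.1 e = (b.prod b).repr (c.coords e) j := by
  rcases j with i | i
  · refine ⟨_, pullBase_mem_polySub
      (chartCoord θ c.adapted.1 hθ (b.coord i).toContinuousLinearMap), fun e he h1 => ?_⟩
    change θ e.1 * b.coord i (c.φ e.1) = _
    rw [h1.self_of_nhds, one_mul, Module.Basis.prod_repr_inl]
    rfl
  · have hl : ∀ v ∈ c.S, ((b.coord i).toContinuousLinearMap ∘L c.P) v = 0 := fun v hv => by
      rw [ContinuousLinearMap.comp_apply, c.P_eq_zero v hv, map_zero]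
    refine ⟨_, linFun_mem_polySub ⟨_, c.chartCoord_mem hθ hl⟩, fun e he h1 => ?_⟩
    rw [c.linFun_apply _ he, c.fderiv_chartCoord hθ _ he h1, ContinuousLinearMap.comp_apply,
      c.P_coords_snd, Module.Basis.prod_repr_inr]
    rfl

/-- First order jets of functions on the normal bundle are those of polynomial functions. -/
theorem exists_polySub_sub_mem_sq (hM : IsSubmanifold V m M) (e : NormalBundle V M)
    (g : NormalFun V M) : ∃ r ∈ polySub M, g - r ∈ evalIdeal e ^ 2 := by
  obtain ⟨c, hp, -⟩ := exists_normalChart hM e.1.2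
  obtain ⟨θ, hθ1, hθ⟩ := exists_bump (V := V) (c.φ.open_source.mem_nhds hp)
  let b := Module.finBasis ℝ V
  choose W hW hWe using c.exists_polySub_coord hθ b
  have hopen : IsOpen {x | c.base x ∈ c.φ.target} :=
    c.φ.open_target.preimage c.contDiff_base.continuous
  obtain ⟨ρ, hρ, hball⟩ := Metric.isOpen_iff.1 hopen (c.coords e).1 (c.coords_mem_dom hp)
  -- The fiber variable is unrestricted since the available cutoffs come from the base.
  set O : Set (V × V) := Metric.ball (c.coords e).1 ρ ×ˢ univ
  set s : Set (V × V) := Metric.ball (c.coords e).1 (ρ / 2) ×ˢ univ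
  have hO : IsOpen O := Metric.isOpen_ball.prod isOpen_univ
  have hs : IsOpen s := Metric.isOpen_ball.prod isOpen_univ
  have hst : ∀ x ∈ s, ∀ t : ℝ, |t| < 2 → c.coords e + t • (x - c.coords e) ∈ O := by
    rintro x ⟨hx, -⟩ t ht
    refine ⟨?_, mem_univ _⟩
    rw [Metric.mem_ball, dist_eq_norm] at hx ⊢
    rw [Prod.fst_add, Prod.smul_fst, Prod.fst_sub, add_sub_cancel_left, norm_smul,
      Real.norm_eq_abs]
    nlinarith [abs_nonneg t, norm_nonneg (x.1 - (c.coords e).1)]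
  have hG : ContDiffOn ℝ ∞ (c.coordFun g.1) O :=
    (c.contDiffOn_coordFun g).mono fun y hy => hball hy.1
  have hU : {x | ∀ᶠ y in 𝓝 x, θ y = 1} ∩
      (c.φ.source ∩ c.φ ⁻¹' Metric.ball (c.coords e).1 (ρ / 2)) ∈ 𝓝 (e.1 : 𝓔) :=
    inter_mem hθ1.eventually_nhds ((c.φ.isOpen_inter_preimage Metric.isOpen_ball).mem_nhds
      ⟨hp, Metric.mem_ball_self (by positivity)⟩)
  obtain ⟨χ, hχ1, hχ⟩ := exists_bump (V := V) hU
  have hmean := contDiffOn_meanDeriv hO hs hst hG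
  let h : Fin (Module.finrank ℝ V) ⊕ Fin (Module.finrank ℝ V) → NormalFun V M := fun j =>
    normalChartMul hM χ c (fun p hp => (hχ hp).2.1)
      (fun x => meanDeriv (c.coordFun g.1) (c.coords e) x (b.prod b j)) (fun p _ hp v =>
        (hmean.contDiffAt (hs.mem_nhds (show (c.φ p, v) ∈ s from
          ⟨(hχ hp).2.2, mem_univ _⟩))).clm_apply contDiffAt_const)
  have key : pullBase M χ * (g - algebraMap ℝ _ (g.1 e)) =
      ∑ j, (W j - algebraMap ℝ _ ((W j).1 e)) * h j := by
    refine Subtype.ext (funext fun e' => ?_)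
    rw [NormalFun.sum_apply]
    change χ e'.1 * (g.1 e' - g.1 e) = ∑ j, ((W j).1 e' - (W j).1 e) *
      (χ e'.1 * meanDeriv (c.coordFun g.1) (c.coords e) (c.coords e') (b.prod b j))
    by_cases hp' : χ e'.1 = 0
    · simp [hp']
    · obtain ⟨h1, h2, h3⟩ := hχ (subset_tsupport _ hp')
      have h4 := meanDeriv_apply_sub hO hst hG (x := c.coords e') ⟨h3, mem_univ _⟩
      rw [c.coordFun_coords _ h2, c.coordFun_coords _ hp] at h4
      rw [h4, add_sub_cancel_left]
      conv_lhs => rw [← (b.prod b).sum_repr (c.coords e' - c.coords e), map_sum]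
      rw [Finset.mul_sum]
      refine Finset.sum_congr rfl fun j _ => ?_
      rw [map_smul, map_sub, hWe j e' h2 h1, hWe j e hp hθ1, smul_eq_mul, Finsupp.sub_apply]
      ring
  have hC : ∀ r : ℝ, algebraMap ℝ (NormalFun V M) r ∈ polySub M := (polySub M).algebraMap_mem
  -- The first order Taylor polynomial: the Hadamard coefficients `h j` are frozen at `e`. The error
  -- consists of products of two functions vanishing at `e`.
  refine ⟨algebraMap ℝ _ (g.1 e) +
    ∑ j, (W j - algebraMap ℝ _ ((W j).1 e)) * algebraMap ℝ _ ((h j).1 e),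
    add_mem (hC _) (sum_mem fun j _ => mul_mem (sub_mem (hW j) (hC _)) (hC _)), ?_⟩
  have e1 : g - (algebraMap ℝ _ (g.1 e) +
      ∑ j, (W j - algebraMap ℝ _ ((W j).1 e)) * algebraMap ℝ _ ((h j).1 e)) =
      (1 - pullBase M χ) * (g - algebraMap ℝ _ (g.1 e)) +
        ∑ j, (W j - algebraMap ℝ _ ((W j).1 e)) * (h j - algebraMap ℝ _ ((h j).1 e)) := by
    rw [sub_mul, key]
    simp only [mul_sub, Finset.sum_sub_distrib]
    ring
  have h1 : 1 - pullBase M χ ∈ evalIdeal e := by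
    change 1 - χ e.1 = 0
    rw [hχ1.self_of_nhds, sub_self]
  rw [e1, sq]
  exact add_mem (Ideal.mul_mem_mul h1 (sub_algebraMap_mem_evalIdeal e g))
    (sum_mem fun j _ => Ideal.mul_mem_mul (sub_algebraMap_mem_evalIdeal e _)
      (sub_algebraMap_mem_evalIdeal e _))

theorem DOlt.eq_zero_of_polySub (hM : IsSubmanifold V m M) {n : ℕ}
    {D : Module.End ℝ (NormalFun V M)} (hD : DOlt n D) (h : ∀ r ∈ polySub M, D r = 0) : D = 0 :=
  LinearMap.ext fun g => Subtype.ext (funext fun e =>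
    hD.apply_mem_of_subalgebra (exists_polySub_sub_mem_sq hM e)
      (fun r hr => by rw [h r hr]; exact Ideal.zero_mem _) g)

theorem polySub_le_span : Subalgebra.toSubmodule (polySub M) ≤
    Submodule.span ℝ {g : NormalFun V M | ∃ k G, HasLead k G g} := by
  rw [polySub, Algebra.adjoin_eq_span]
  refine Submodule.span_mono fun g hg => ?_
  induction hg using Submonoid.closure_induction with
  | mem x hx =>
    rcases hx with ⟨f, rfl⟩ | ⟨F, rfl⟩
    · exact ⟨0, f, HasLead.base f⟩
    · exact ⟨1, F.1, HasLead.lin F⟩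
  | one => exact ⟨0, (1 : SmoothFun V 𝓔), HasLead.base 1⟩
  | mul x y _ _ hx hy =>
    obtain ⟨k, G, hG⟩ := hx
    obtain ⟨l, H, hH⟩ := hy
    exact ⟨_, _, hG.mul hH⟩

/-- The values on leading terms are forced; these span a space containing `polySub M`, which
determines a differential operator. -/
theorem IsLead.unique (hM : IsSubmanifold V m M) {d : ℤ} {n : ℕ}
    {D : Module.End ℝ (SmoothFun V 𝓔)} {D₁ D₂ : Module.End ℝ (NormalFun V M)}
    (h₁ : IsLead d D D₁) (h₂ : IsLead d D D₂) (hD₁ : DOlt n D₁) (hD₂ : DOlt n D₂) : D₁ = D₂ := by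
  refine sub_eq_zero.1 ((hD₁.sub hD₂).eq_zero_of_polySub hM fun r hr => ?_)
  have h : Submodule.span ℝ {g : NormalFun V M | ∃ k G, HasLead k G g} ≤ LinearMap.ker (D₁ - D₂) :=
    Submodule.span_le.2 fun g ⟨k, G, hG⟩ =>
      sub_eq_zero.2 ((h₁ k G g hG).unique hM (h₂ k G g hG))
  exact h (polySub_le_span hr)

end Jets

/-! ### Existence of the leading part of a linearizable operator -/

section Existence

open Filter Topology

set_option linter.unusedSectionVars false

theorem Submodule.exists_adapted_basis {V : Type*} [AddCommGroup V] [Module ℝ V]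
    [FiniteDimensional ℝ V] (S : Submodule ℝ V) :
    ∃ (κ : Type) (_ : Fintype κ) (b : Module.Basis κ ℝ V) (w : κ → ℤ),
      ∀ i, (w i = 0 ∧ b i ∈ S) ∨ (w i = 1 ∧ ∀ v ∈ S, b.coord i v = 0) := by
  obtain ⟨W, hW⟩ := S.exists_isCompl
  refine ⟨_, inferInstance, ((Module.finBasis ℝ S).prod (Module.finBasis ℝ W)).map
    (S.prodEquivOfIsCompl W hW), Sum.elim (fun _ => 0) (fun _ => 1), ?_⟩
  rintro (i | i)
  · refine Or.inl ⟨rfl, ?_⟩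
    simp
  · refine Or.inr ⟨rfl, fun v hv => ?_⟩
    have h := Submodule.prodEquivOfIsCompl_symm_apply_left S W hW ⟨v, hv⟩
    rw [Module.Basis.coord_apply, Module.Basis.map_repr, LinearEquiv.trans_apply, h,
      Module.Basis.prod_repr_inr, map_zero]
    rfl

variable {V : Type*} [NormedAddCommGroup V] [NormedSpace ℝ V]
variable {𝓔 : Type*} [TopologicalSpace 𝓔] [ChartedSpace V 𝓔] {M : Set 𝓔} {m : ℕ}
variable [IsManifold 𝓘(ℝ, V) ∞ 𝓔] [FiniteDimensional ℝ V] [T2Space 𝓔]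

theorem isLead_normalDeriv_tangent (hM : IsSubmanifold V m M) {θ : SmoothFun V 𝓔}
    (c : NormalChart V M) (hθ : tsupport θ ⊆ c.φ.source) {a : V} (ha : a ∈ c.S) :
    IsLead 0 (chartDeriv θ c.adapted.1 hθ a : Module.End ℝ (SmoothFun V 𝓔))
      (normalDeriv hM θ c hθ (a, 0) : Module.End ℝ (NormalFun V M)) := fun _ _ _ h =>
  h.derivation
    (fun f => by
      rw [normalDeriv_tangent_pullBase hM c hθ ha]
      exact HasLead.base _)
    (fun F => by
      rw [normalDeriv_tangent_linFun hM c hθ ha]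
      exact HasLead.lin ⟨_, isTangent_chartDeriv c hθ ha F.1 F.2⟩)

theorem isLead_normalDeriv_normal (hM : IsSubmanifold V m M) {θ : SmoothFun V 𝓔}
    (c : NormalChart V M) (hθ : tsupport θ ⊆ c.φ.source) (v : V) :
    IsLead 1 (chartDeriv θ c.adapted.1 hθ v : Module.End ℝ (SmoothFun V 𝓔))
      (normalDeriv hM θ c hθ (0, v) : Module.End ℝ (NormalFun V M)) := fun _ _ _ h =>
  h.derivation
    (fun f => by
      rw [normalDeriv_normal_pullBase]
      exact (HasLead.base _).lower)
    (fun F => by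
      rw [normalDeriv_normal_linFun]
      exact HasLead.base _)

theorem isWeighted_normalDeriv_tangent (hM : IsSubmanifold V m M) {θ : SmoothFun V 𝓔}
    (c : NormalChart V M) (hθ : tsupport θ ⊆ c.φ.source) (a : V) :
    IsWeighted 0 (normalDeriv hM θ c hθ (a, 0) : Module.End ℝ (NormalFun V M)) := fun t ht g => by
  rw [neg_zero, zpow_zero, one_smul]
  exact (pullScale_normalDeriv hM c hθ ht _ g).trans (by rw [smul_zero]; rfl)

theorem isWeighted_normalDeriv_normal (hM : IsSubmanifold V m M) {θ : SmoothFun V 𝓔}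
    (c : NormalChart V M) (hθ : tsupport θ ⊆ c.φ.source) (v : V) :
    IsWeighted 1 (normalDeriv hM θ c hθ (0, v) : Module.End ℝ (NormalFun V M)) := fun t ht g => by
  refine (pullScale_normalDeriv hM c hθ ht _ g).trans (Subtype.ext (funext fun e => ?_))
  have h : ((0 : V), t⁻¹ • v) = t⁻¹ • ((0 : V), v) := by rw [Prod.smul_mk, smul_zero]
  rw [normalDeriv_apply, h, map_smul, zpow_neg_one, smul_eq_mul, mul_left_comm]
  rfl

/-- The operators with a leading part of weight `-d`. -/
theorem isLiftClass_isLead {ι : Type*} {w : ι → ℤ}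
    {Z : ι → Derivation ℝ (SmoothFun V 𝓔) (SmoothFun V 𝓔)}
    {Z' : ι → Derivation ℝ (NormalFun V M) (NormalFun V M)}
    (hw : ∀ i, IsWeighted (w i) (Z' i : Module.End ℝ (NormalFun V M)))
    (hl : ∀ i, IsLead (w i) (Z i : Module.End ℝ (SmoothFun V 𝓔))
      (Z' i : Module.End ℝ (NormalFun V M))) :
    IsLiftClass (vanishingIdeal V M) w Z (fun n d D => DOlt n D ∧
      ∃ D' : Module.End ℝ (NormalFun V M), DOlt n D' ∧ IsWeighted d D' ∧ IsLead d D D') where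
  zero n d := ⟨DOlt.zero n, 0, DOlt.zero n, IsWeighted.zero d, IsLead.zero d⟩
  add _ _ _ _ := fun ⟨h, D', h1, h2, h3⟩ ⟨k, E', k1, k2, k3⟩ =>
    ⟨h.add k, D' + E', h1.add k1, h2.add k2, h3.add k3⟩
  mulOp_comp n d a D := fun ⟨h, D', h1, h2, h3⟩ =>
    ⟨h.mulOp_comp a, mulOp (pullBase M a) * D', h1.mulOp_comp _,
      ((isWeighted_mulOp_pullBase a).comp h2).congr (zero_add d), h3.mulOp_comp a⟩
  of_mul a := ⟨DOlt_one_mulOp a, mulOp (pullBase M a), DOlt_one_mulOp _,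
    isWeighted_mulOp_pullBase a, isLead_mulOp_pullBase a⟩
  of_mem a ha := ⟨DOlt_one_mulOp a, mulOp (linFun V ⟨a, ha⟩), DOlt_one_mulOp _,
    isWeighted_mulOp_linFun _, (HasLead.lin ⟨a, ha⟩).isLead_mulOp⟩
  comp n d i D := fun ⟨h, D', h1, h2, h3⟩ =>
    ⟨((DOlt_two_derivation (Z i)).comp h).mono (by omega), (Z' i : Module.End ℝ _) * D',
      ((DOlt_two_derivation (Z' i)).comp h1).mono (by omega),
      ((hw i).comp h2).congr (add_comm _ _), ((hl i).comp h3).congr (add_comm _ _)⟩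
  mono n d D := fun ⟨h, _, _, _, h3⟩ =>
    ⟨h, 0, DOlt.zero n, IsWeighted.zero _, h3.raise⟩
  succ _ _ _ := fun ⟨h, D', h1, h2, h3⟩ => ⟨h.succ, D', h1.succ, h2, h3⟩
  isDO _ _ _ h := h.1

/-- Linearizability enters only through `apply_mem`: the symbol preserves the vanishing ideal, which
lowers the degree from `q` to `q - 1`. -/
theorem IsLinearizable.exists_local_lead (hM : IsSubmanifold V m M) {q : ℕ}
    {Δ : Module.End ℝ (SmoothFun V 𝓔)} (hΔ : IsLinearizable V M q Δ) (p : M) :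
    ∃ (ψ : SmoothFun V 𝓔) (D' : Module.End ℝ (NormalFun V M)), ψ p ≠ 0 ∧ DOlt (q + 1) D' ∧
      IsWeighted (q - 1) D' ∧ IsLead (q - 1) (mulOp ψ * Δ) D' := by
  obtain ⟨c, hp, -⟩ := exists_normalChart hM p.2
  obtain ⟨κ, _, b, w, hbw⟩ := c.S.exists_adapted_basis
  obtain ⟨θ, ψ, hθ, -, hψ, hfr⟩ := exists_isFrame b c.adapted.1 hp
  have hZ : ∀ i, ∃ Z' : Derivation ℝ (NormalFun V M) (NormalFun V M),
      IsWeighted (w i) (Z' : Module.End ℝ (NormalFun V M)) ∧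
      IsLead (w i) (chartDeriv θ c.adapted.1 hθ (b i) : Module.End ℝ (SmoothFun V 𝓔))
        (Z' : Module.End ℝ (NormalFun V M)) := by
    intro i
    rcases hbw i with ⟨h, hS⟩ | ⟨h, -⟩
    · rw [h]
      exact ⟨_, isWeighted_normalDeriv_tangent hM c hθ _, isLead_normalDeriv_tangent hM c hθ hS⟩
    · rw [h]
      exact ⟨_, isWeighted_normalDeriv_normal hM c hθ _, isLead_normalDeriv_normal hM c hθ _⟩
  choose Z' hw hl using hZ
  obtain ⟨N, -, D', h1, h2, h3⟩ := (isLiftClass_isLead hw hl).of_isDO_of_mem hfr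
    (fun i => (hbw i).imp And.left fun h => ⟨h.1, c.chartCoord_mem hθ h.2⟩)
    (isDO_iff.1 hΔ.1) (fun f hf => hΔ.2.apply_mem f hf)
  refine ⟨ψ ^ N, D', ?_, h1, h2, h3⟩
  rw [SmoothFun.pow_apply]
  exact pow_ne_zero _ hψ

/-- Glueing of operators on the normal bundle which agree up to functions of the base. -/
theorem exists_glue_normal (hM : IsSubmanifold V m M) {ψ : M → SmoothFun V 𝓔}
    (hψ : ∀ p : M, ψ p p ≠ 0) {D : M → Module.End ℝ (NormalFun V M)}
    (h : ∀ p p', mulOp (pullBase M (ψ p)) * D p' = mulOp (pullBase M (ψ p')) * D p) :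
    ∃ D' : Module.End ℝ (NormalFun V M), ∀ p, mulOp (pullBase M (ψ p)) * D' = D p := by
  have hval : ∀ (p : M) (g : NormalFun V M) (e : NormalBundle V M),
      ψ p e.1 * ((ψ e.1 e.1)⁻¹ * (D e.1 g).1 e) = (D p g).1 e := by
    intro p g e
    have h1 := congrArg (fun E : Module.End ℝ (NormalFun V M) => (E g).1 e) (h p e.1)
    change ψ p e.1 * (D e.1 g).1 e = ψ e.1 e.1 * (D p g).1 e at h1
    rw [mul_left_comm, h1, inv_mul_cancel_left₀ (hψ e.1)]
  -- No partition of unity is needed: over each base point the operator indexed by that point is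
  -- divided by its own `ψ`. Compatibility shows that the result is a quotient `D p g / ψ p` near
  -- `p`, hence smooth.
  refine ⟨{
    toFun := fun g => ⟨fun e => (ψ e.1 e.1)⁻¹ * (D e.1 g).1 e, mem_normalFun_of_mul hM fun p =>
      ⟨ψ p, D p g, hψ p, hval p g⟩⟩
    map_add' := fun g g' => Subtype.ext (funext fun e => ?_)
    map_smul' := fun r g => Subtype.ext (funext fun e => ?_) }, fun p => ?_⟩
  · change (ψ e.1 e.1)⁻¹ * (D e.1 (g + g')).1 e =
      (ψ e.1 e.1)⁻¹ * (D e.1 g).1 e + (ψ e.1 e.1)⁻¹ * (D e.1 g').1 e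
    rw [map_add, ← mul_add]
    rfl
  · change (ψ e.1 e.1)⁻¹ * (D e.1 (r • g)).1 e = r * ((ψ e.1 e.1)⁻¹ * (D e.1 g).1 e)
    rw [map_smul, mul_left_comm]
    rfl
  · exact LinearMap.ext fun g => Subtype.ext (funext fun e => hval p g e)

theorem eq_of_forall_pullBase_mul {ψ : M → SmoothFun V 𝓔} (hψ : ∀ p : M, ψ p p ≠ 0)
    {g h : NormalFun V M} (hgh : ∀ p, pullBase M (ψ p) * g = pullBase M (ψ p) * h) : g = h :=
  Subtype.ext (funext fun e => mul_left_cancel₀ (hψ e.1)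
    (congrArg (fun k : NormalFun V M => k.1 e) (hgh e.1)))

/-- A linearizable operator of order `q` has a leading part of weight `1 - q`. -/
theorem IsLinearizable.exists_lead (hM : IsSubmanifold V m M) {q : ℕ}
    {Δ : Module.End ℝ (SmoothFun V 𝓔)} (hΔ : IsLinearizable V M q Δ) :
    ∃ D' : Module.End ℝ (NormalFun V M), DOlt (q + 1) D' ∧ IsWeighted (q - 1) D' ∧
      IsLead (q - 1) Δ D' := by
  choose ψ D hψ h1 h2 h3 using fun p => hΔ.exists_local_lead hM p
  -- Both sides of the compatibility condition are leading parts of the same operator `ψ p * ψ p' *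
  -- Δ`.
  obtain ⟨D', hD'⟩ := exists_glue_normal hM hψ (D := D) fun p p' => by
    refine IsLead.unique hM ((h3 p').mulOp_comp (ψ p)) ?_ ((h1 p').mulOp_comp _)
      ((h1 p).mulOp_comp _)
    have e : mulOp (ψ p) * (mulOp (ψ p') * Δ) = mulOp (ψ p') * (mulOp (ψ p) * Δ) :=
      LinearMap.ext fun x => mul_left_comm _ _ _
    rw [e]
    exact (h3 p).mulOp_comp (ψ p')
  refine ⟨D', DOlt_iff.2 fun f => LinearMap.ext fun g => eq_of_forall_pullBase_mul hψ fun p => ?_,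
    fun t ht g => eq_of_forall_pullBase_mul hψ fun p => ?_, fun k G g hG =>
    HasLead.loc ψ hψ fun p => ?_⟩
  · have h4 := DOlt_iff.1 (h1 p) f
    rw [← hD' p, nestedComm_mulOp_comp] at h4
    exact (LinearMap.congr_fun h4 g).trans (mul_zero _).symm
  · have h4 := h2 p t ht g
    rw [← hD' p] at h4
    exact h4.trans (mul_smul_comm _ _ _).symm
  · have h4 := h3 p k G g hG
    rw [← hD' p] at h4
    exact h4

end Existence

/-! ### The linearization of an operator -/

section Linearization

open Filter Topology

set_option linter.unusedSectionVars false

variable {V : Type*} [NormedAddCommGroup V] [NormedSpace ℝ V]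
variable {𝓔 : Type*} [TopologicalSpace 𝓔] [ChartedSpace V 𝓔] {M : Set 𝓔} {m : ℕ}
variable [IsManifold 𝓘(ℝ, V) ∞ 𝓔]

theorem isFWLDO_iff {q : ℕ} {D : Module.End ℝ (NormalFun V M)} :
    IsFWLDO V q D ↔ DOlt (q + 1) D ∧ IsWeighted (q - 1) D := by
  have e : (1 - (q : ℤ)) = -((q : ℤ) - 1) := by ring
  rw [IsFWLDO, isDO_iff, e]
  refine and_congr_right fun _ => forall₂_congr fun t ht => ⟨fun h g => ?_, fun h g => ?_⟩
  · have h1 := h (pullScale V t g)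
    have h2 := pullScale_pullScale_inv (inv_ne_zero ht) g
    rw [inv_inv] at h2
    rwa [h2] at h1
  · have h1 := h (pullScale V t⁻¹ g)
    rwa [pullScale_pullScale_inv ht] at h1

variable [FiniteDimensional ℝ V] [T2Space 𝓔]

/-- The leading part of an operator is its linearization. -/
theorem IsLead.isLinearization (hM : IsSubmanifold V m M) {q : ℕ}
    {Δ : Module.End ℝ (SmoothFun V 𝓔)} {D : Module.End ℝ (NormalFun V M)} (hD : DOlt (q + 1) D)
    (hw : IsWeighted (q - 1) D) (hl : IsLead (q - 1) Δ D) : IsLinearization V M q Δ D where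
  isFWLDO := isFWLDO_iff.2 ⟨hD, hw⟩
  symbol_lin := by
    refine ⟨⟨isSymMultivector_symbol hD, fun t ht f => ?_⟩, fun F => ?_⟩
    · have h := pullScale_nestedComm (hw t ht) (fun i => pullScale V t⁻¹ (f i)) 1
      simp only [pullScale_pullScale_inv ht] at h
      rw [neg_sub] at h
      exact h
    -- Each commutator with a function vanishing on `M` lowers the degree by one: `q` of them turn
    -- `q - 1` into `-1`, so the value at `1` vanishes to order one. With `q - 1` of them the degree
    -- is `0`, which gives (ii).
    · have h : HasLead 1 (symbol q Δ fun i => (F i).1) (symbol q D fun i => linFun V (F i)) :=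
        (hl.nestedComm F 0 1 _ (HasLead.base 1)).congr (by ring)
      exact ⟨h.mem_vanishingIdeal hM, h.unique hM (HasLead.lin ⟨_, h.mem_vanishingIdeal hM⟩)⟩
  nested_lin n hn F e := by
    have h : HasLead 0 (_root_.nestedComm Δ (fun i => (F i).1) 1)
        (_root_.nestedComm D (fun i => linFun V (F i)) 1) :=
      (hl.nestedComm F 0 1 _ (HasLead.base 1)).congr (by rw [hn]; push_cast; ring)
    rw [h.eq_pullBase hM, pullBase_apply]

theorem linFun_mul (hM : IsSubmanifold V m M) (f : SmoothFun V 𝓔) (F : vanishingIdeal V M) :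
    linFun V ⟨f * F.1, Ideal.mul_mem_left _ f F.2⟩ = pullBase M f * linFun V F :=
  (HasLead.lin ⟨f * F.1, Ideal.mul_mem_left _ f F.2⟩).unique hM
    (((HasLead.lin F).base_mul f).congr rfl)

/-- In positive codimension no nonzero function is annihilated by all the linearizations. -/
theorem eq_zero_of_forall_linFun_mul (hM : IsSubmanifold V m M) (hm : m < Module.finrank ℝ V)
    {g : NormalFun V M} (h : ∀ F, linFun V F * g = 0) : g = 0 := by
  refine Subtype.ext (funext fun e => ?_)
  change g.1 e = 0
  obtain ⟨c, hp, hS⟩ := exists_normalChart hM e.1.2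
  -- Positive codimension provides a direction transverse to `M`, hence a nonzero linear function on
  -- the fibers.
  obtain ⟨v, hv⟩ : ∃ v, c.P v ≠ 0 := by
    by_contra! h0
    have htop : c.S = ⊤ := eq_top_iff.2 fun v _ => by
      have := c.sub_mem v
      rwa [h0 v, sub_zero] at this
    rw [htop, finrank_top] at hS
    omega
  obtain ⟨l, hl⟩ : ∃ l : Module.Dual ℝ V, l (c.P v) ≠ 0 := by
    by_contra! h0
    exact hv ((Module.forall_dual_apply_eq_zero_iff ℝ _).1 h0)
  obtain ⟨θ, hθ1, hθ⟩ := exists_bump (V := V) (c.φ.open_source.mem_nhds hp)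
  let l' : V →L[ℝ] ℝ := l.toContinuousLinearMap ∘L c.P
  have hl' : ∀ v ∈ c.S, l' v = 0 := fun v hv => by
    simp [l', c.P_eq_zero v hv]
  let F : vanishingIdeal V M := ⟨_, c.chartCoord_mem hθ hl'⟩
  have hF : ∀ u : V, c.coordFun (linFun V F).1 (c.φ e.1, u) = l' u := fun u => by
    rw [c.coordFun_linFun F (c.mem_dom e.1.2 hp u), c.base_chart e.1.2 hp,
      c.fderiv_chartCoord hθ l' hp hθ1]
  have hz : ∀ u : V, l' u ≠ 0 → c.coordFun g.1 (c.φ e.1, u) = 0 := fun u hu => by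
    have h1 := c.coordFun_mul (linFun V F) g
    have h2 := congrFun h1 (c.φ e.1, u)
    have h3 : c.coordFun (0 : NormalFun V M).1 (c.φ e.1, u) = 0 :=
      c.coordFun_of_mem _ (c.mem_dom e.1.2 hp u)
    rw [h F, h3, Pi.mul_apply, hF] at h2
    exact (mul_eq_zero.1 h2.symm).resolve_left hu
  rw [← c.coordFun_coords g.1 hp]
  -- Zeros of `l'` are limits, in the direction `v`, of points where `l'` does not vanish.
  by_cases h0 : l' (c.coords e).2 = 0
  · have h1 : Tendsto (fun t : ℝ => c.coordFun g.1 (c.φ e.1, (c.coords e).2 + t • v)) (𝓝[≠] 0)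
        (𝓝 (c.coordFun g.1 (c.coords e))) := by
      have h2 : Tendsto (fun t : ℝ => (c.φ e.1, (c.coords e).2 + t • v)) (𝓝 0)
          (𝓝 (c.coords e)) := by
        have h3 : Continuous fun t : ℝ => (c.φ e.1, (c.coords e).2 + t • v) := by fun_prop
        have h4 := h3.tendsto 0
        rw [zero_smul, add_zero] at h4
        exact h4
      exact ((c.contDiffAt_coordFun g (c.coords_mem_dom hp)).continuousAt.tendsto.comp h2).mono_left
        nhdsWithin_le_nhds
    refine tendsto_nhds_unique h1 (tendsto_const_nhds.congr' ?_)
    filter_upwards [eventually_mem_nhdsWithin] with t ht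
    refine (hz _ ?_).symm
    rw [map_add, h0, zero_add, map_smul]
    exact mul_ne_zero ht hl
  · exact hz _ h0

/-- Smooth functions are not homogeneous of negative degree along the fibers. -/
theorem eq_zero_of_pullScale_eq (hM : IsSubmanifold V m M) {d : ℤ} (hd : 0 < d)
    {g : NormalFun V M} (h : ∀ t : ℝ, t ≠ 0 → pullScale V t g = t ^ (-d) • g) : g = 0 := by
  refine Subtype.ext (funext fun e => ?_)
  change g.1 e = 0
  obtain ⟨c, hp, -⟩ := exists_normalChart hM e.1.2
  have h1 : ContinuousAt (fun t : ℝ => c.coordFun g.1 ((c.coords e).1, t • (c.coords e).2)) 0 :=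
    ContinuousAt.comp (g := c.coordFun g.1)
      (f := fun t : ℝ => ((c.coords e).1, t • (c.coords e).2))
      (c.contDiffAt_coordFun g (c.mem_dom e.1.2 hp _)).continuousAt
      (Continuous.continuousAt (by fun_prop))
  lift d to ℕ using hd.le
  have h2 : ContinuousAt (fun t : ℝ => t ^ d) 0 := (continuous_pow d).continuousAt
  have h3 := (h2.mul h1).tendsto
  -- For `t ≠ 0` the product `t ^ d * g(h_t e)` is the constant `g e`, while it tends to `0` with
  -- `t`.
  rw [Pi.mul_apply, zero_pow (by omega), zero_mul] at h3
  refine tendsto_nhds_unique (tendsto_const_nhds.congr' ?_) (h3.mono_left nhdsWithin_le_nhds :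
    Tendsto _ (𝓝[≠] (0 : ℝ)) _)
  filter_upwards [eventually_mem_nhdsWithin] with t ht
  have h4 := congrArg (fun k : NormalFun V M => k.1 e) (h t ht)
  change g.1 (fiberScale V t e) = t ^ (-(d : ℤ)) * g.1 e at h4
  have h5 : c.coordFun g.1 (c.coords (fiberScale V t e)) = g.1 (fiberScale V t e) :=
    c.coordFun_coords g.1 (e := fiberScale V t e) hp
  change g.1 e = t ^ d * c.coordFun g.1 ((c.coords e).1, t • (c.coords e).2)
  rw [← c.coords_fiberScale hp, h5, h4, zpow_neg, zpow_natCast,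
    mul_inv_cancel_left₀ (pow_ne_zero d ht)]

theorem eq_zero_on_polySub {D : Module.End ℝ (NormalFun V M)}
    (h : ∀ (L : List (vanishingIdeal V M)) (f : SmoothFun V 𝓔),
      D ((L.map (linFun V)).prod * pullBase M f) = 0) : ∀ r ∈ polySub M, D r = 0 := by
  have h1 : Subalgebra.toSubmodule (polySub M) ≤ LinearMap.ker D := by
    rw [polySub, Algebra.adjoin_eq_span, Submodule.span_le]
    intro g hg
    have h2 : ∃ (L : List (vanishingIdeal V M)) (f : SmoothFun V 𝓔),
        g = (L.map (linFun V)).prod * pullBase M f := by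
      induction hg using Submonoid.closure_induction with
      | mem x hx =>
        rcases hx with ⟨f, rfl⟩ | ⟨F, rfl⟩
        · exact ⟨[], f, (one_mul _).symm⟩
        · exact ⟨[F], 1, by simp⟩
      | one => exact ⟨[], 1, by simp⟩
      | mul x y _ _ hx hy =>
        obtain ⟨L, f, rfl⟩ := hx
        obtain ⟨L', f', rfl⟩ := hy
        exact ⟨L ++ L', f * f', by
          rw [List.map_append, List.prod_append, map_mul, mul_mul_mul_comm]⟩
    obtain ⟨L, f, rfl⟩ := h2
    exact h L f
  exact fun r hr => h1 hr

/-- A fiber-wise linear operator is determined by its values on nested commutators with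
linearizations. -/
theorem eq_zero_of_nestedComm_linFun (hM : IsSubmanifold V m M) (hm : m < Module.finrank ℝ V)
    {q : ℕ} {D : Module.End ℝ (NormalFun V M)} (hD : DOlt (q + 1) D) (hw : IsWeighted (q - 1) D)
    (hs : ∀ F : Fin q → vanishingIdeal V M, nestedComm D (fun i => linFun V (F i)) 1 = 0)
    (hn : ∀ n : ℕ, q = n + 1 → ∀ F : Fin n → vanishingIdeal V M,
      nestedComm D (fun i => linFun V (F i)) 1 = 0) : D = 0 := by
  have hzero : ∀ F : Fin q → vanishingIdeal V M, nestedComm D (fun i => linFun V (F i)) = 0 := by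
    intro F
    have h1 : DOlt 1 (nestedComm D (fun i => linFun V (F i))) :=
      (hD.nestedComm _).mono (by omega)
    refine LinearMap.ext fun x => ?_
    rw [h1.apply_of_one, hs, mul_zero]
    rfl
  have hsnoc : ∀ (j : ℕ) (F : Fin j → vanishingIdeal V M) (G : vanishingIdeal V M),
      ⁅nestedComm D (fun i => linFun V (F i)), mulOp (linFun V G)⁆ =
        nestedComm D (fun i => linFun V (Fin.snoc (α := fun _ => vanishingIdeal V M) F G i)) := by
    intro j F G
    rw [nestedComm_succ_last]
    simp only [Fin.snoc_castSucc, Fin.snoc_last]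
  -- The value is homogeneous of degree `j + 1 - q` along the fibers, so it vanishes for `j < q -
  -- 1`. For `j = q - 1` the operator commutes with linear functions by `hzero`; moving `f` into the
  -- linear factor, as `f G_lin = (f G)_lin`, reduces to the value at `1`, and the linear factor can
  -- be cancelled.
  have hbase : ∀ (j : ℕ) (F : Fin j → vanishingIdeal V M) (f : SmoothFun V 𝓔),
      nestedComm D (fun i => linFun V (F i)) (pullBase M f) = 0 := by
    intro j F f
    rcases lt_trichotomy j q with hj | rfl | hj
    · rcases Nat.lt_or_ge (j + 1) q with hj1 | hj1
      · refine eq_zero_of_pullScale_eq hM (d := (q : ℤ) - 1 - j) (by omega) fun t ht => ?_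
        exact (hw.nestedComm F) t ht (pullBase M f)
      · obtain rfl : q = j + 1 := by omega
        have hlin : ∀ G x, nestedComm D (fun i => linFun V (F i)) (linFun V G * x) =
            linFun V G * nestedComm D (fun i => linFun V (F i)) x := by
          intro G x
          have h1 := LinearMap.congr_fun ((hsnoc j F G).trans (hzero _)) x
          rw [bracket_mulOp_apply] at h1
          exact sub_eq_zero.1 h1
        refine eq_zero_of_forall_linFun_mul hM hm fun G => ?_
        rw [← hlin, mul_comm, ← linFun_mul hM, ← mul_one (linFun V _), hlin, hn j rfl, mul_zero]
    · rw [hzero]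
      rfl
    · have h1 := hD.nestedComm fun i => linFun V (F i)
      rw [Nat.sub_eq_zero_of_le hj] at h1
      have h2 : nestedComm D (fun i => linFun V (F i)) = 0 := h1
      rw [h2]
      rfl
  -- Pulling a linear factor out of the argument costs one more commutator, so all `j` have to be
  -- treated together.
  have hprod : ∀ (L : List (vanishingIdeal V M)) (j : ℕ) (F : Fin j → vanishingIdeal V M)
      (f : SmoothFun V 𝓔), nestedComm D (fun i => linFun V (F i))
        ((L.map (linFun V)).prod * pullBase M f) = 0 := by
    intro L
    induction L with
    | nil =>
      intro j F f
      rw [List.map_nil, List.prod_nil, one_mul]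
      exact hbase j F f
    | cons G L ih =>
      intro j F f
      have h1 := bracket_mulOp_apply (nestedComm D (fun i => linFun V (F i))) (linFun V G)
        ((L.map (linFun V)).prod * pullBase M f)
      rw [hsnoc, ih, ih, mul_zero, sub_zero] at h1
      rw [List.map_cons, List.prod_cons, mul_assoc]
      exact h1.symm
  refine hD.eq_zero_of_polySub hM (eq_zero_on_polySub fun L f => ?_)
  have h := hprod L 0 Fin.elim0 f
  rwa [nestedComm_zero'] at h

theorem IsLinearization.unique (hM : IsSubmanifold V m M) (hm : m < Module.finrank ℝ V) {q : ℕ}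
    {Δ : Module.End ℝ (SmoothFun V 𝓔)} {D₁ D₂ : Module.End ℝ (NormalFun V M)}
    (h₁ : IsLinearization V M q Δ D₁) (h₂ : IsLinearization V M q Δ D₂) : D₁ = D₂ := by
  obtain ⟨hD₁, hw₁⟩ := isFWLDO_iff.1 h₁.isFWLDO
  obtain ⟨hD₂, hw₂⟩ := isFWLDO_iff.1 h₂.isFWLDO
  refine sub_eq_zero.1 (eq_zero_of_nestedComm_linFun hM hm (hD₁.sub hD₂) (hw₁.sub hw₂)
    (fun F => ?_) fun n hn F => ?_)
  · obtain ⟨_, e₁⟩ := h₁.symbol_lin.2 F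
    obtain ⟨_, e₂⟩ := h₂.symbol_lin.2 F
    rw [nestedComm_sub, LinearMap.sub_apply]
    exact sub_eq_zero.2 (e₁.trans e₂.symm)
  · rw [nestedComm_sub, LinearMap.sub_apply, sub_eq_zero]
    exact Subtype.ext (funext fun e =>
      (h₁.nested_lin n hn F e).trans (h₂.nested_lin n hn F e).symm)

end Linearization

end

/-! ### The theorem -/

theorem mainTheorem3 (V : Type*) [NormedAddCommGroup V] [NormedSpace ℝ V] [FiniteDimensional ℝ V]
    (𝓔 : Type*) [TopologicalSpace 𝓔] [T2Space 𝓔] [SecondCountableTopology 𝓔]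
    [ChartedSpace V 𝓔] [IsManifold 𝓘(ℝ, V) ∞ 𝓔]
    (M : Set 𝓔) (m : ℕ) (hM : IsSubmanifold V m M) (hm : m < Module.finrank ℝ V) :
    (∀ (q : ℕ) (Δ : Module.End ℝ (SmoothFun V 𝓔)), IsLinearizable V M q Δ →
      ∃! Δlin : Module.End ℝ (NormalFun V M), IsLinearization V M q Δ Δlin) ∧
    (∀ (q q' : ℕ) (Δ Δ' : Module.End ℝ (SmoothFun V 𝓔)),
      IsLinearizable V M (q + 1) Δ → IsLinearizable V M (q' + 1) Δ' →
      IsLinearizable V M (q + q' + 1) ⁅Δ, Δ'⁆ ∧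
      ∀ Δlin Δlin' : Module.End ℝ (NormalFun V M),
        IsLinearization V M (q + 1) Δ Δlin → IsLinearization V M (q' + 1) Δ' Δlin' →
        IsLinearization V M (q + q' + 1) ⁅Δ, Δ'⁆ ⁅Δlin, Δlin'⁆) := by
  refine ⟨fun q Δ hΔ => ?_, fun q q' Δ Δ' hΔ hΔ' => ⟨hΔ.lie hΔ', fun L L' hL hL' => ?_⟩⟩
  · obtain ⟨D, hD, hw, hl⟩ := hΔ.exists_lead hM
    exact ⟨D, hl.isLinearization hM hD hw, fun D' hD' =>
      hD'.unique hM hm (hl.isLinearization hM hD hw)⟩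
  · obtain ⟨D, hD, hw, hl⟩ := hΔ.exists_lead hM
    obtain ⟨D', hD', hw', hl'⟩ := hΔ'.exists_lead hM
    -- By uniqueness the given linearizations are the leading parts, whose commutator is the leading
    -- part of `⁅Δ, Δ'⁆`.
    obtain rfl := hL.unique hM hm (hl.isLinearization hM hD hw)
    obtain rfl := hL'.unique hM hm (hl'.isLinearization hM hD' hw')
    have e : ((q + 1 : ℕ) : ℤ) - 1 + (((q' + 1 : ℕ) : ℤ) - 1) = ((q + q' + 1 : ℕ) : ℤ) - 1 := by
      push_cast
      ring
    exact ((hl.lie hl').congr e).isLinearization hM ((hD.lie hD').mono (by omega))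
      ((hw.lie hw').congr e)
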